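/- Let $\Gamma$ be a group generated by a finite set $S$, with word length $|\cdot|$, and let $(\Gamma_n)_{n\in\mathbb N}$ be a decreasing sequence of finite index normal subgroups of $\Gamma$ with trivial intersection (so $\Gamma$ is residually finite). Let $G=\widehat\Gamma((\Gamma_n))=\varprojlim \Gamma/\Gamma_n$ be the corresponding profinite completion, a compact metrizable group on which $\Gamma$ acts by left translations. *Warped cone.* Let $\mathcal O_\Gamma(G)$ be the warped cone of $(\Gamma,G)$ in a linearization by unitary operators: $H$ is a complex Hilbert space with a unitary representation $U$ of $\Gamma$, $G$ is topologically and $\Gamma$-equivariantly embedded into the unit sphere of $H$, the open cone $\mathcal O G\subset H$ is the union of all rays from the origin which meet $G$, with $\Gamma$ acting on it by $U$, and $\mathcal O_\Gamma(G)$ is $\mathcal O G$ with the warped metric: $\delta_\Gamma(x,y)$ is the infimum of the sums $\sum_{i<n}\big(\|U_{\gamma_i}x_i-x_{i+1}\|+|\gamma_i|\big)$ over all finite sequences $x=x_0,\dots,x_n=y$ in $\mathcal O G$ and $\gamma_0,\dots,\gamma_{n-1}$ in $\Gamma$. *Box space.* Let $\Box_{\Gamma_n}\Gamma$ be the disjoint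 union $\bigsqcup_n\Gamma/\Gamma_n$ with any metric $d$ that restricts to the word metric (of the image of $S$) on each $\Gamma/\Gamma_n$ and satisfies $d(\Gamma/\Gamma_n,\Gamma/\Gamma_m)\to\infty$ as $n+m\to\infty$, $n\ne m$. *Proper actions.* A proper affine isometric action of $\Gamma$ on a Banach space $E$ is an action $\alpha$ by surjective affine isometries of $E$ with $\|\alpha_\gamma(0)\|\to\infty$ as $|\gamma|\to\infty$. *Fibred coarse embeddings.* A metric space $(X,d)$ admits a fibred coarse embedding into a Banach space $E$ if there are a field of Banach spaces $(E_x)_{x\in X}$, a section $s(x)\in E_x$ and two non-decreasing functions $\rho_1,\rho_2:[0,\infty)\to\mathbb R$ tending to $\infty$ at $\infty$ such that for every $r>0$ there are a bounded set $K\subset X$ and, for every $C\subset X\setminus K$ of diameter less than $r$, surjective affine isometries $t_C(x):E_x\to E$ $(x\in C)$ with 1. $\rho_1(d(x,y))\le\|t_C(x)(s(x))-t_C(y)(s(y))\|\le\rho_2(d(x,y))$ for all $x,y\in C$; 2. for all such $C_1,C_2$ with $C_1\cap C_2\neq\emptyset$ there is a surjective affine isometry $t_{C_1C_2}:E\to E$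 with $t_{C_1}(x)\circ t_{C_2}(x)^{-1}=t_{C_1C_2}$ for all $x\in C_1\cap C_2$. Let $1\le p<\infty$, and let all Banach spaces be over a fixed field $\mathbb K\in\{\mathbb R,\mathbb C\}$. The following are equivalent: (1) $\Gamma$ admits a proper affine isometric action on an $L_p$-space, i.e. on a Banach space isometrically isomorphic to $L_p(\Omega,\mu)$ for some measure space $(\Omega,\mu)$; (2) the warped cone $\mathcal O_\Gamma(G)$ admits a fibred coarse embedding into an $L_p$-space; (3) the box space $\Box_{\Gamma_n}\Gamma$ admits a fibred coarse embedding into an $L_p$-space. The same equivalence holds with the class of $L_p$-spaces replaced by any stable class $\mathfrak B$ of Banach spaces, i.e. any class that is invariant under linear isometric isomorphism, contains a nonzero space, and satisfies $$E,F\in\mathfrak B\ \Longrightarrow\ E\oplus_pF\in\mathfrak B,\quad L_p(\Omega,\mu;E)\in\mathfrak B,\quad (E)_{\mathcal U}\in\mathfrak B$$ for all measure spaces $(\Omega,\mu)$ and all non-principal ultrafilters $\mathcal U$ on $\mathbb N$, where $E\oplus_pF$ is the $\ell_p$-direct sum, $L_p(\Omega,\mu;E)$ the Lebesgue-Bochner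 space and $(E)_{\mathcal U}$ the ultrapower $\ell_\infty(\mathbb N;E)/\{(\xi_n):\lim_{\mathcal U}\|\xi_n\|=0\}$. -/

import Mathlib

open Filter Topology
open scoped ENNReal

universe u v w

/-! ### Word length and warped metrics -/

/-- The word length of `g` with respect to `S`: the least length of a word in the letters
`S ∪ S⁻¹` that represents `g` (it is only used for generating sets `S`). -/
noncomputable def wordLength {Γ : Type u} [Group Γ] (S : Set Γ) (g : Γ) : ℕ :=
  sInf {n | ∃ l : List Γ, l.length = n ∧ (∀ s ∈ l, s ∈ S ∨ s⁻¹ ∈ S) ∧ l.prod = g}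

theorem wordLength_one {Γ : Type u} [Group Γ] (S : Set Γ) : wordLength S (1 : Γ) = 0 :=
  Nat.sInf_eq_zero.2 (Or.inl ⟨[], rfl, by simp, by simp⟩)

theorem wordLength_inv {Γ : Type u} [Group Γ] (S : Set Γ) (g : Γ) :
    wordLength S g⁻¹ = wordLength S g := by
  unfold wordLength
  congr 1
  have key : ∀ (g : Γ) (n : ℕ),
      (∃ l : List Γ, l.length = n ∧ (∀ s ∈ l, s ∈ S ∨ s⁻¹ ∈ S) ∧ l.prod = g) →
      ∃ l : List Γ, l.length = n ∧ (∀ s ∈ l, s ∈ S ∨ s⁻¹ ∈ S) ∧ l.prod = g⁻¹ := by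
    rintro g n ⟨l, hl, hS, rfl⟩
    refine ⟨(l.map (fun x => x⁻¹)).reverse, by simpa using hl, ?_, ?_⟩
    · intro s hs
      simp only [List.mem_reverse, List.mem_map] at hs
      obtain ⟨a, ha, rfl⟩ := hs
      simpa [or_comm] using hS a ha
    · rw [List.prod_inv_reverse]
  ext n
  exact ⟨fun h => by simpa using key _ n h, key g n⟩

theorem eq_one_of_wordLength_eq_zero {Γ : Type u} [Group Γ] {S : Set Γ}
    (hS : Subgroup.closure S = ⊤) {g : Γ} (hg : wordLength S g = 0) : g = 1 := by
  rcases Nat.sInf_eq_zero.1 hg with ⟨l, hl, -, rfl⟩ | h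
  · simp [List.length_eq_zero_iff.1 hl]
  · exfalso
    have hmem : g ∈ (Subgroup.closure S).toSubmonoid := by rw [hS]; trivial
    rw [Subgroup.closure_toSubmonoid] at hmem
    obtain ⟨l, hl, hp⟩ := Submonoid.exists_list_of_mem_closure hmem
    simp only [Set.mem_union, Set.mem_inv] at hl
    have : l.length ∈ {n | ∃ l : List Γ, l.length = n ∧ (∀ s ∈ l, s ∈ S ∨ s⁻¹ ∈ S) ∧
        l.prod = g} := ⟨l, rfl, hl, hp⟩
    rw [h] at this
    exact this

/-- `WarpChain S x y c` says that `c = ∑ (d (γ_i x_i, x_{i+1}) + |γ_i|)` for some finite sequence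
`x = x_0, x_1, …, x_n = y` of points and some group elements `γ_0, …, γ_{n-1}`. -/
inductive WarpChain {Γ : Type u} [Group Γ] (S : Set Γ) {X : Type v} [MetricSpace X]
    [MulAction Γ X] : X → X → ℝ → Prop
  | refl (x : X) : WarpChain S x x 0
  | step {x y z : X} {c : ℝ} (γ : Γ) (h : WarpChain S y z c) :
      WarpChain S x z (dist (γ • x) y + wordLength S γ + c)

section Warp

variable {Γ : Type u} [Group Γ] {S : Set Γ} {X : Type v} [MetricSpace X] [MulAction Γ X]

theorem WarpChain.nonneg {x y : X} {c : ℝ} (h : WarpChain S x y c) : 0 ≤ c := by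
  induction h with
  | refl x => exact le_rfl
  | step γ h ih => positivity

theorem WarpChain.trans {x y z : X} {c d : ℝ} (h : WarpChain S x y c) (h' : WarpChain S y z d) :
    WarpChain S x z (c + d) := by
  induction h with
  | refl x => simpa using h'
  | step γ h ih => rw [add_assoc]; exact .step γ (ih h')

theorem WarpChain.symm {x y : X} {c : ℝ} (h : WarpChain S x y c) : WarpChain S y x c := by
  induction h with
  | refl x => exact .refl x
  | @step x y z c γ h ih =>
    have h1 : WarpChain S y (γ • x) (dist (γ • x) y) := by
      have := WarpChain.step (S := S) (x := y) (1 : Γ) (.refl (γ • x))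
      simpa [wordLength_one, dist_comm] using this
    have h2 : WarpChain S (γ • x) x (wordLength S γ) := by
      have := WarpChain.step (S := S) (x := γ • x) (γ⁻¹) (.refl x)
      simpa [wordLength_inv] using this
    have := ih.trans (h1.trans h2)
    rwa [add_comm c] at this

theorem WarpChain.min_le (hS : Subgroup.closure S = ⊤) {x y : X} {c : ℝ}
    (h : WarpChain S x y c) : min 1 (dist x y) ≤ c := by
  induction h with
  | refl x => simp
  | @step x y z c γ h ih =>
    have hc := h.nonneg
    rcases Nat.eq_zero_or_pos (wordLength S γ) with h0 | h0
    · have := eq_one_of_wordLength_eq_zero hS h0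
      subst this
      rw [h0]
      simp only [one_smul, Nat.cast_zero, add_zero]
      have htri := dist_triangle x y z
      have hxy := dist_nonneg (x := x) (y := y)
      rcases min_le_iff.1 ih with h1 | h1
      · exact (min_le_left _ _).trans (by linarith)
      · exact (min_le_right _ _).trans (by linarith)
    · have h1 : (1 : ℝ) ≤ wordLength S γ := by exact_mod_cast h0
      have hxy := dist_nonneg (x := γ • x) (y := y)
      exact (min_le_left _ _).trans (by linarith)

variable (S) in
/-- The warped distance: the infimum of the sums `∑ (d (γ_i x_i, x_{i+1}) + |γ_i|)` over all
finite chains from `x` to `y`. -/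
noncomputable def warpedDist (x y : X) : ℝ := sInf {c | WarpChain S x y c}

theorem warpChain_bddBelow (x y : X) : BddBelow {c | WarpChain S x y c} :=
  ⟨0, fun _ h => WarpChain.nonneg h⟩

theorem warpChain_nonempty (x y : X) : {c | WarpChain S x y c}.Nonempty :=
  ⟨_, WarpChain.step (1 : Γ) (WarpChain.refl y)⟩

/-- The warped metric of a group action on a metric space, relative to a generating set. -/
noncomputable abbrev warpedMetric (hS : Subgroup.closure S = ⊤) : MetricSpace X where
  dist x y := warpedDist S x y
  dist_self x := le_antisymm (csInf_le (warpChain_bddBelow x x) (.refl x))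
    (le_csInf (warpChain_nonempty x x) fun _ h => WarpChain.nonneg h)
  dist_comm x y := by
    change sInf _ = sInf _
    congr 1
    ext c
    exact ⟨.symm, .symm⟩
  dist_triangle x y z := by
    change sInf _ ≤ sInf _ + sInf _
    refine le_of_forall_pos_le_add fun ε hε => ?_
    obtain ⟨a, ha, ha'⟩ := Real.lt_sInf_add_pos (warpChain_nonempty (S := S) x y) (half_pos hε)
    obtain ⟨b, hb, hb'⟩ := Real.lt_sInf_add_pos (warpChain_nonempty (S := S) y z) (half_pos hε)
    have := csInf_le (warpChain_bddBelow x z) (WarpChain.trans ha hb)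
    linarith
  eq_of_dist_eq_zero := by
    intro x y h
    have h1 : min 1 (dist x y) ≤ sInf {c | WarpChain S x y c} :=
      le_csInf (warpChain_nonempty x y) fun _ h => WarpChain.min_le hS h
    have h2 : sInf {c | WarpChain S x y c} = 0 := h
    rw [h2] at h1
    rcases min_le_iff.1 h1 with h3 | h3
    · linarith
    · exact dist_le_zero.1 h3

end Warp

/-! ### Profinite completions, linearizations, warped cones and box spaces -/

/-- The profinite completion of `Γ` along a nested chain of normal subgroups `N n`, as the inverse
limit of the quotients `Γ ⧸ N n` inside their product. -/
def profiniteCompletion {Γ : Type u} [Group Γ] (N : ℕ → Subgroup Γ) [∀ n, (N n).Normal]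
    (hN : Antitone N) : Subgroup (∀ n, Γ ⧸ N n) where
  carrier := {g | ∀ n, QuotientGroup.map (N (n + 1)) (N n) (MonoidHom.id Γ)
    (hN (Nat.le_succ n)) (g (n + 1)) = g n}
  one_mem' := by intro n; simp
  mul_mem' := by intro a b ha hb n; simp only [Pi.mul_apply, map_mul]; rw [ha n, hb n]
  inv_mem' := by intro a ha n; simp only [Pi.inv_apply, map_inv]; rw [ha n]

/-- The topology induced from the product of the discrete spaces `Γ ⧸ N n`. -/
instance profiniteCompletion.instTopologicalSpace {Γ : Type u} [Group Γ] (N : ℕ → Subgroup Γ)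
    [∀ n, (N n).Normal] (hN : Antitone N) : TopologicalSpace (profiniteCompletion N hN) :=
  TopologicalSpace.induced (fun g => (g : ∀ n, Γ ⧸ N n))
    (@Pi.topologicalSpace ℕ (fun n => Γ ⧸ N n) (fun _ => ⊥))

/-- The canonical homomorphism of `Γ` into its completion. -/
def toProfiniteCompletion {Γ : Type u} [Group Γ] (N : ℕ → Subgroup Γ) [∀ n, (N n).Normal]
    (hN : Antitone N) : Γ →* profiniteCompletion N hN where
  toFun γ := ⟨fun n => (γ : Γ ⧸ N n), fun _ => rfl⟩
  map_one' := rfl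
  map_mul' _ _ := rfl

/-- `Γ` acts on its completion by left translations. -/
instance profiniteCompletion.instMulAction {Γ : Type u} [Group Γ] (N : ℕ → Subgroup Γ)
    [∀ n, (N n).Normal] (hN : Antitone N) : MulAction Γ (profiniteCompletion N hN) :=
  MulAction.compHom (profiniteCompletion N hN) (toProfiniteCompletion N hN)

/-- A linearization of the transformation group `(Γ, M)` by unitary operators of the Hilbert space
`H`: a unitary representation of `Γ` on `H` together with an equivariant topological embedding of
`M` into the unit sphere of `H`. -/
structure UnitaryLinearization (Γ : Type u) [Group Γ] (M : Type u) [TopologicalSpace M]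
    [MulAction Γ M] (H : Type v) [NormedAddCommGroup H] [InnerProductSpace ℂ H] where
  rep : Γ →* (H ≃ₗᵢ[ℂ] H)
  emb : M → H
  isEmbedding : IsEmbedding emb
  norm_emb : ∀ m, ‖emb m‖ = 1
  equivariant : ∀ (γ : Γ) (m : M), emb (γ • m) = rep γ (emb m)

section Cone

variable {Γ : Type u} [Group Γ] {M : Type u} [TopologicalSpace M] [MulAction Γ M]
  {H : Type v} [NormedAddCommGroup H] [InnerProductSpace ℂ H]

/-- The open cone in `H`: the union of all rays from the origin that meet the embedded copy
of `M`. -/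
def UnitaryLinearization.openCone (L : UnitaryLinearization Γ M H) : Set H :=
  {h | ∃ (t : ℝ) (m : M), 0 ≤ t ∧ h = (t : ℂ) • L.emb m}

theorem UnitaryLinearization.rep_mem_openCone (L : UnitaryLinearization Γ M H) (γ : Γ) {h : H}
    (hh : h ∈ L.openCone) : L.rep γ h ∈ L.openCone := by
  obtain ⟨t, m, ht, rfl⟩ := hh
  exact ⟨t, γ • m, ht, by rw [L.equivariant, map_smul]⟩

/-- The action of `Γ` on the open cone by restriction of the unitary representation. -/
instance UnitaryLinearization.instMulActionOpenCone (L : UnitaryLinearization Γ M H) :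
    MulAction Γ L.openCone where
  smul γ h := ⟨L.rep γ h, L.rep_mem_openCone γ h.2⟩
  one_smul h := Subtype.ext (by change L.rep 1 (h : H) = h; rw [map_one]; rfl)
  mul_smul γ γ' h := Subtype.ext (by
    change L.rep (γ * γ') (h : H) = L.rep γ (L.rep γ' h); rw [map_mul]; rfl)

/-- The underlying set of the warped cone is the open cone; the metric is the warped one. -/
def WarpedCone (L : UnitaryLinearization Γ M H) {S : Set Γ} (_hS : Subgroup.closure S = ⊤) :
    Type v := L.openCone

noncomputable instance WarpedCone.instMetricSpace (L : UnitaryLinearization Γ M H) {S : Set Γ}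
    (hS : Subgroup.closure S = ⊤) : MetricSpace (WarpedCone L hS) :=
  warpedMetric (X := L.openCone) hS

end Cone

/-- The underlying set of the box space: the disjoint union of the quotients `Γ ⧸ N n`. -/
def BoxSpace {Γ : Type u} [Group Γ] (N : ℕ → Subgroup Γ) : Type u := Σ n, Γ ⧸ N n

/-- The metrics of a box space: on each `Γ ⧸ N n` the word metric of the generating set given by
the image of `S`, and `dist (Γ ⧸ N n) (Γ ⧸ N m) → ∞` as `n + m → ∞` with `n ≠ m`. -/
structure IsBoxMetric {Γ : Type u} [Group Γ] (S : Set Γ) (N : ℕ → Subgroup Γ)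
    [∀ n, (N n).Normal] (d : MetricSpace (BoxSpace N)) : Prop where
  dist_same : ∀ (n : ℕ) (x y : Γ ⧸ N n), d.dist ⟨n, x⟩ ⟨n, y⟩ =
    wordLength ((fun s : Γ => (s : Γ ⧸ N n)) '' S) (x⁻¹ * y)
  dist_ne : ∀ R : ℝ, ∃ k : ℕ, ∀ n m : ℕ, n ≠ m → k ≤ n + m → ∀ (x : Γ ⧸ N n) (y : Γ ⧸ N m),
    R ≤ d.dist ⟨n, x⟩ ⟨m, y⟩

/-! ### Fibred coarse embeddings and proper affine isometric actions -/

/-- The subsets `C` of `X \ K` of diameter less than `r`. -/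
def smallSetsOff {X : Type v} [MetricSpace X] (K : Set X) (r : ℝ) : Set (Set X) :=
  {C | C ⊆ Kᶜ ∧ Bornology.IsBounded C ∧ Metric.diam C < r}

/-- A fibred coarse embedding of the metric space `X` into the Banach space `E`. -/
structure FibredCoarseEmbedding (𝕜 : Type) [RCLike 𝕜] (X : Type v) [MetricSpace X]
    (E : Type w) [NormedAddCommGroup E] [NormedSpace 𝕜 E] where
  /-- the field of Banach spaces -/
  fiber : X → Type w
  [fiberGroup : ∀ x, NormedAddCommGroup (fiber x)]
  [fiberSpace : ∀ x, NormedSpace 𝕜 (fiber x)]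
  [fiberComplete : ∀ x, CompleteSpace (fiber x)]
  /-- the section -/
  sec : ∀ x, fiber x
  ρ₁ : ℝ → ℝ
  ρ₂ : ℝ → ℝ
  monotone₁ : MonotoneOn ρ₁ (Set.Ici 0)
  monotone₂ : MonotoneOn ρ₂ (Set.Ici 0)
  tendsto₁ : Tendsto ρ₁ atTop atTop
  tendsto₂ : Tendsto ρ₂ atTop atTop
  /-- For every `r > 0` there are a bounded set `K` and trivializations `t C` over the subsets
  `C` of `X \ K` of diameter less than `r`, consisting of affine isometries of the fibers
  onto `E`. -/
  exists_trivialization : ∀ r : ℝ, 0 < r → ∃ K : Set X, Bornology.IsBounded K ∧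
    ∃ t : ∀ C ∈ smallSetsOff K r, ∀ x ∈ C, fiber x ≃ᵃⁱ[𝕜] E,
      (∀ (C : Set X) (hC : C ∈ smallSetsOff K r) (x : X) (hx : x ∈ C) (y : X) (hy : y ∈ C),
        ρ₁ (dist x y) ≤ ‖t C hC x hx (sec x) - t C hC y hy (sec y)‖ ∧
        ‖t C hC x hx (sec x) - t C hC y hy (sec y)‖ ≤ ρ₂ (dist x y)) ∧
      (∀ (C₁ : Set X) (hC₁ : C₁ ∈ smallSetsOff K r) (C₂ : Set X) (hC₂ : C₂ ∈ smallSetsOff K r),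
        (C₁ ∩ C₂).Nonempty → ∃ T : E ≃ᵃⁱ[𝕜] E, ∀ (x : X) (hx₁ : x ∈ C₁) (hx₂ : x ∈ C₂),
          (t C₂ hC₂ x hx₂).symm.trans (t C₁ hC₁ x hx₁) = T)

/-- A proper affine isometric action of `Γ` on `E`: writing `α γ ξ = π γ ξ + b γ`, the norm of
`b γ = α γ 0` tends to infinity as the word length of `γ` does. -/
structure ProperAffineIsometricAction (𝕜 : Type) [RCLike 𝕜] {Γ : Type u} [Group Γ] (S : Set Γ)
    (E : Type w) [NormedAddCommGroup E] [NormedSpace 𝕜 E] where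
  act : Γ →* (E ≃ᵃⁱ[𝕜] E)
  proper : Tendsto (fun γ => ‖act γ 0‖) (comap (wordLength S) atTop) atTop

/-! ### Classes of Banach spaces -/

/-- The null sequences of `ℓ^∞(ℕ, E)` along the ultrafilter `U`. -/
def ultraNull (𝕜 : Type) [RCLike 𝕜] (U : Ultrafilter ℕ) (E : Type w) [NormedAddCommGroup E]
    [NormedSpace 𝕜 E] : Submodule 𝕜 (lp (fun _ : ℕ => E) ∞) where
  carrier := {f | Tendsto (fun n => ‖f n‖) U (𝓝 0)}
  zero_mem' := by simp
  add_mem' := by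
    intro f g hf hg
    refine squeeze_zero (fun n => norm_nonneg _) (fun n => norm_add_le (f n) (g n)) ?_
    simpa using Tendsto.add hf hg
  smul_mem' := by
    intro c f hf
    have := Tendsto.const_mul ‖c‖ hf
    simpa [norm_smul] using this

instance ultraNull.instIsClosed (𝕜 : Type) [RCLike 𝕜] (U : Ultrafilter ℕ) (E : Type w)
    [NormedAddCommGroup E] [NormedSpace 𝕜 E] :
    IsClosed (ultraNull 𝕜 U E : Set (lp (fun _ : ℕ => E) ∞)) := by
  refine isClosed_of_closure_subset fun f hf => ?_
  change Tendsto (fun n => ‖f n‖) U (𝓝 0)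
  rw [Metric.tendsto_nhds]
  intro ε hε
  obtain ⟨g, hg, hfg⟩ := Metric.mem_closure_iff.1 hf (ε / 2) (half_pos hε)
  have hg' : Tendsto (fun n => ‖g n‖) U (𝓝 0) := hg
  filter_upwards [(Metric.tendsto_nhds.1 hg') (ε / 2) (half_pos hε)] with n hn
  have h1 : ‖(f - g) n‖ ≤ ‖f - g‖ := lp.norm_apply_le_norm ENNReal.top_ne_zero (f - g) n
  rw [dist_eq_norm] at hfg
  have h2 : ‖f n‖ ≤ ‖(f - g) n‖ + ‖g n‖ := by
    have := norm_add_le ((f - g) n) (g n)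
    simpa using this
  simp only [dist_zero_right, norm_norm] at hn ⊢
  linarith

/-- The Banach space ultrapower `(E)_U`: bounded sequences modulo null sequences along `U`, with
the quotient norm. -/
abbrev Ultrapower (𝕜 : Type) [RCLike 𝕜] (U : Ultrafilter ℕ) (E : Type w) [NormedAddCommGroup E]
    [NormedSpace 𝕜 E] : Type w := lp (fun _ : ℕ => E) ∞ ⧸ ultraNull 𝕜 U E

/-- A class of Banach spaces over `𝕜`. -/
abbrev BanachClass (𝕜 : Type) [RCLike 𝕜] : Type (w + 1) :=
  ∀ (E : Type w) [NormedAddCommGroup E] [NormedSpace 𝕜 E] [CompleteSpace E], Prop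

/-- The class of `L_p`-spaces. -/
def LpClass (𝕜 : Type) [RCLike 𝕜] (p : ℝ≥0∞) [Fact (1 ≤ p)] : BanachClass.{w} 𝕜 :=
  fun E _ _ _ => ∃ (Ω : Type w) (_ : MeasurableSpace Ω) (μ : MeasureTheory.Measure Ω),
    Nonempty (E ≃ₗᵢ[𝕜] MeasureTheory.Lp 𝕜 p μ)

/-- A class of Banach spaces (invariant under linear isometric isomorphism and not reduced to zero
spaces) is stable, for the exponent `p`, if it is closed under `ℓ_p`-direct sums,
Lebesgue-Bochner `L_p`-spaces and ultrapowers. -/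
structure IsStableClass {𝕜 : Type} [RCLike 𝕜] (p : ℝ≥0∞) [Fact (1 ≤ p)] (B : BanachClass.{w} 𝕜) :
    Prop where
  exists_nontrivial : ∃ (E : Type w) (_ : NormedAddCommGroup E) (_ : NormedSpace 𝕜 E)
    (_ : CompleteSpace E), B E ∧ Nontrivial E
  congr : ∀ (E F : Type w) [NormedAddCommGroup E] [NormedSpace 𝕜 E] [CompleteSpace E]
    [NormedAddCommGroup F] [NormedSpace 𝕜 F] [CompleteSpace F], (E ≃ₗᵢ[𝕜] F) → B E → B F
  prod : ∀ (E F : Type w) [NormedAddCommGroup E] [NormedSpace 𝕜 E] [CompleteSpace E]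
    [NormedAddCommGroup F] [NormedSpace 𝕜 F] [CompleteSpace F],
    B E → B F → B (WithLp p (E × F))
  bochner : ∀ (E : Type w) [NormedAddCommGroup E] [NormedSpace 𝕜 E] [CompleteSpace E]
    (Ω : Type) [MeasurableSpace Ω] (μ : MeasureTheory.Measure Ω),
    B E → B (MeasureTheory.Lp E p μ)
  ultra : ∀ (E : Type w) [NormedAddCommGroup E] [NormedSpace 𝕜 E] [CompleteSpace E]
    (U : Ultrafilter ℕ), (U : Filter ℕ) ≤ cofinite → B E → B (Ultrapower 𝕜 U E)

/-- `Γ` admits a proper affine isometric action on a space of the class `B`. -/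
def ActsProperlyOn {𝕜 : Type} [RCLike 𝕜] {Γ : Type u} [Group Γ] (S : Set Γ)
    (B : BanachClass.{w} 𝕜) : Prop :=
  ∃ (E : Type w) (_ : NormedAddCommGroup E) (_ : NormedSpace 𝕜 E) (_ : CompleteSpace E),
    B E ∧ Nonempty (ProperAffineIsometricAction 𝕜 S E)

/-- The metric space `X` admits a fibred coarse embedding into a space of the class `B`. -/
def FibredCoarseEmbedsInto {𝕜 : Type} [RCLike 𝕜] (X : Type v) (d : MetricSpace X)
    (B : BanachClass.{w} 𝕜) : Prop :=
  ∃ (E : Type w) (_ : NormedAddCommGroup E) (_ : NormedSpace 𝕜 E) (_ : CompleteSpace E),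
    B E ∧ Nonempty (FibredCoarseEmbedding 𝕜 X E)

/-!
The equivalence is proved for every class of Banach spaces that contains a nonzero space and is
closed under countable `ℓ_p`-sums `ℓ_p(J; E)` and under ultrapowers
(`HasLpSumsAndUltrapowers`), by a cycle of implications.

*From an action to the warped cone* (`fibredCoarseEmbedsInto_cone_of_actsProperlyOn`). Far from the
origin, two points of the cone at warped distance less than `r` are related by a unique short
element of `Γ` (`exists_forall_eq_of_norm_rep_sub_le`). If `Γ` acts on `W` by affine isometries and
`F` maps the cone to `W`, the inverses of these elements, relative to a base point, trivialize the
constant field `W` near a small set, and a distance in a chart is the displacement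
`‖β_γ (F x) - F y‖`, where `γ` nearly realizes the warped distance. It must control both `|γ|`
and `‖γ x - y‖`. The given proper action controls `|γ|`. For `‖γ x - y‖` one adds walls: at the
finite level `Γ ⧸ N n`, the points `g⁻¹ x` with `g` a lift of a class of `Γ ⧸ N n` nearly
depend only on the class and span a finite dimensional subspace, which embeds into an
`L_1`-space with constants independent of the dimension (`exists_mean_abs_inner`); rounding to
integers and counting, `|m - l|` is the `p`-th power of an `ℓ_p`-distance
(`hasSum_abs_wallFun_sub`). As the levels permute the classes, `Γ` acts on the resulting
`ℓ_p`-sums, and the error vanishes up to constants in the ultrapower (`exists_action_and_map`).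

*From the warped cone to the box space* (`fibredCoarseEmbedsInto_box_of_cone`). The space
`Γ ⧸ N n` is mapped to height `t n` of the cone, where `t n` tends to infinity so slowly that the
choice of lifts does not matter. At bounded scale and far away this map preserves distances up to
an additive constant, hence pulls back fibred coarse embeddings.

*From the box space to an action* (`actsProperlyOn_of_box`). The balls of radius `k` in
`Γ ⧸ N n`, for `n` large, are those of `Γ`. The changes of trivialization between the balls
centred at `x` and at `x γ` form a cocycle over right translations, defined for short `γ`
(`exists_partial_cocycle`). It gives affine isometries of `ℓ_p(Γ ⧸ N n; E)` that are
multiplicative on longer and longer elements; averaging over `Γ ⧸ N n` keeps the displacement of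
the origin between `ρ₁ |γ|` and `ρ₂ |γ|`. In the ultrapower this is a proper action.

A stable class has the closure properties because `ℓ_p(J; E)` is the Lebesgue-Bochner space of the
counting measure. For the class of `L_p`-spaces the point is that an ultrapower of an `L_p`-space
is an `L_p`-space (`exists_ultrapower_linearIsometryEquiv_Lp`). The indicator functions of
`ℕ × Ω` act on the ultrapower as a Boolean algebra of `L_p`-projections. A maximal disjoint family
of vectors decomposes the space into an `ℓ_p`-sum of cyclic subspaces, each of which is the
`L_p`-space of a measure on a Stone space
(`LpProjections.exists_linearIsometryEquiv_Lp`).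
-/

/-! ### Affine isometries of `ℓ_p`-sums and of ultrapowers -/

section AffineIsometries

variable {𝕜 : Type} [RCLike 𝕜] {E : Type w} [NormedAddCommGroup E] [NormedSpace 𝕜 E]

/-- The affine isometry `x ↦ L x + b`. -/
noncomputable def affineIsometryOf (L : E ≃ₗᵢ[𝕜] E) (b : E) : E ≃ᵃⁱ[𝕜] E :=
  L.toAffineIsometryEquiv.trans (AffineIsometryEquiv.constVAdd 𝕜 E b)

@[simp] theorem affineIsometryOf_apply (L : E ≃ₗᵢ[𝕜] E) (b x : E) :
    affineIsometryOf L b x = L x + b := by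
  simp [affineIsometryOf, add_comm]

theorem AffineIsometryEquiv.apply_eq_linear_add (T : E ≃ᵃⁱ[𝕜] E) (x : E) :
    T x = T.linearIsometryEquiv x + T 0 := by
  have := T.map_vadd 0 x
  simpa using this

theorem AffineIsometryEquiv.norm_sub_map {F : Type*} [NormedAddCommGroup F] [NormedSpace 𝕜 F]
    (T : E ≃ᵃⁱ[𝕜] F) (x y : E) : ‖T x - T y‖ = ‖x - y‖ := by
  rw [← dist_eq_norm, T.dist_map, dist_eq_norm]

variable {p : ℝ≥0∞} [Fact (1 ≤ p)] {J : Type*}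

theorem toReal_pos_of_one_le (p : ℝ≥0∞) [Fact (1 ≤ p)] (hp : p ≠ ∞) : 0 < p.toReal :=
  ENNReal.toReal_pos (zero_lt_one.trans_le Fact.out).ne' hp

theorem memℓp_twist (hp : p ≠ ∞) (σ : Equiv.Perm J) (L : J → E ≃ₗᵢ[𝕜] E) {ξ : J → E}
    (h : Memℓp ξ p) : Memℓp (fun j => L j (ξ (σ j))) p := by
  have hq := toReal_pos_of_one_le p hp
  refine memℓp_gen ?_
  simpa [Function.comp_def] using (σ.summable_iff (f := fun j => ‖ξ j‖ ^ p.toReal)).2 (h.summable hq)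

/-- The linear isometry of `ℓ_p(J; E)` that permutes the coordinates by `σ` and moves the `j`-th
coordinate by the linear isometry `L j`. -/
noncomputable def lpTwistLinear (hp : p ≠ ∞) (σ : Equiv.Perm J) (L : J → E ≃ₗᵢ[𝕜] E) :
    lp (fun _ : J => E) p ≃ₗᵢ[𝕜] lp (fun _ : J => E) p where
  toFun ξ := ⟨fun j => L j (ξ (σ j)), memℓp_twist hp σ L (lp.memℓp ξ)⟩
  map_add' ξ η := by ext j; simp; rfl
  map_smul' c ξ := by ext j; simp
  invFun ξ := ⟨fun j => (L (σ.symm j)).symm (ξ (σ.symm j)),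
    memℓp_twist hp σ.symm (fun j => (L (σ.symm j)).symm) (lp.memℓp ξ)⟩
  left_inv ξ := by ext j; simp
  right_inv ξ := by ext j; simp
  norm_map' ξ := by
    have hq := toReal_pos_of_one_le p hp
    rw [← Real.rpow_left_inj (norm_nonneg _) (norm_nonneg _) hq.ne', lp.norm_rpow_eq_tsum hq,
      lp.norm_rpow_eq_tsum hq]
    simpa using σ.tsum_eq (fun j => ‖ξ j‖ ^ p.toReal)

/-- The affine isometry `ξ ↦ (A j (ξ (σ j)))_j` of `ℓ_p(J; E)`. -/
noncomputable def lpTwist (hp : p ≠ ∞) (σ : Equiv.Perm J) (A : J → E ≃ᵃⁱ[𝕜] E)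
    (hA : Memℓp (fun j => A j 0) p) : lp (fun _ : J => E) p ≃ᵃⁱ[𝕜] lp (fun _ : J => E) p :=
  affineIsometryOf (lpTwistLinear hp σ fun j => (A j).linearIsometryEquiv) ⟨fun j => A j 0, hA⟩

@[simp] theorem lpTwist_apply (hp : p ≠ ∞) (σ : Equiv.Perm J) (A : J → E ≃ᵃⁱ[𝕜] E)
    (hA : Memℓp (fun j => A j 0) p) (ξ : lp (fun _ : J => E) p) (j : J) :
    lpTwist hp σ A hA ξ j = A j (ξ (σ j)) := by
  rw [AffineIsometryEquiv.apply_eq_linear_add (A j)]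
  simp [lpTwist]
  rfl

end AffineIsometries

section Ultrapowers

variable {𝕜 : Type} [RCLike 𝕜] {E : Type w} [NormedAddCommGroup E] [NormedSpace 𝕜 E]
  (U : Ultrafilter ℕ)

theorem exists_tendsto_of_bounded {f : ℕ → ℝ} {C : ℝ} (h : ∀ n, |f n| ≤ C) :
    ∃ l, Tendsto f U (𝓝 l) := by
  have hc : IsCompact (Set.Icc (-C) C) := isCompact_Icc
  obtain ⟨l, -, hl⟩ := hc.ultrafilter_le_nhds' (U.map f)
    (by rw [Ultrafilter.mem_map]; exact Filter.univ_mem' fun n => abs_le.1 (h n))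
  exact ⟨l, hl⟩

/-- A bounded sequence, as an element of `ℓ^∞(ℕ; E)`. -/
noncomputable def boundedSeq (ξ : ℕ → E) (h : ∃ C, ∀ n, ‖ξ n‖ ≤ C) : lp (fun _ : ℕ => E) ∞ :=
  ⟨ξ, memℓp_infty (by obtain ⟨C, hC⟩ := h; exact ⟨C, by rintro _ ⟨n, rfl⟩; exact hC n⟩)⟩

@[simp] theorem boundedSeq_apply (ξ : ℕ → E) (h : ∃ C, ∀ n, ‖ξ n‖ ≤ C) (n : ℕ) :
    boundedSeq ξ h n = ξ n := rfl

variable (𝕜) in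
/-- The class in the ultrapower of a bounded sequence. -/
noncomputable def ultraMk (ξ : lp (fun _ : ℕ => E) ∞) : Ultrapower 𝕜 U E :=
  (ultraNull 𝕜 U E).mkQ ξ

theorem ultraMk_surjective : Function.Surjective (ultraMk 𝕜 U (E := E)) :=
  Submodule.mkQ_surjective _

theorem ultraMk_add (ξ η : lp (fun _ : ℕ => E) ∞) :
    ultraMk 𝕜 U (ξ + η) = ultraMk 𝕜 U ξ + ultraMk 𝕜 U η := rfl

theorem ultraMk_sub (ξ η : lp (fun _ : ℕ => E) ∞) :
    ultraMk 𝕜 U (ξ - η) = ultraMk 𝕜 U ξ - ultraMk 𝕜 U η := rfl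

theorem norm_apply_le_linf (ξ : lp (fun _ : ℕ => E) ∞) (n : ℕ) : ‖ξ n‖ ≤ ‖ξ‖ :=
  lp.norm_apply_le_norm ENNReal.top_ne_zero ξ n

/-- The quotient norm of the ultrapower is the limit of the norms along the ultrafilter. -/
theorem tendsto_norm_ultraMk (ξ : lp (fun _ : ℕ => E) ∞) :
    Tendsto (fun n => ‖ξ n‖) U (𝓝 ‖ultraMk 𝕜 U ξ‖) := by
  obtain ⟨l, hl⟩ := exists_tendsto_of_bounded U (f := fun n => ‖ξ n‖) (C := ‖ξ‖)
    (fun n => by rw [abs_norm]; exact norm_apply_le_linf ξ n)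
  have hl0 : 0 ≤ l := ge_of_tendsto hl (Eventually.of_forall fun n => norm_nonneg _)
  suffices h : ‖ultraMk 𝕜 U ξ‖ = l by rwa [h]
  apply le_antisymm
  · refine le_of_forall_pos_le_add fun ε hε => ?_
    -- Replacing `ξ` by `0` off `{n | ‖ξ n‖ < l + ε}` does not change its class.
    classical
    let η : lp (fun _ : ℕ => E) ∞ := boundedSeq (fun n => if ‖ξ n‖ < l + ε then ξ n else 0)
      ⟨l + ε, fun n => by dsimp only; split_ifs with h; exacts [h.le, by simp; positivity]⟩
    have hη : ultraMk 𝕜 U ξ = ultraMk 𝕜 U η := by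
      refine (Submodule.Quotient.eq _).2 ?_
      change Tendsto (fun n => ‖(ξ - η) n‖) U (𝓝 0)
      refine tendsto_const_nhds.congr' ?_
      filter_upwards [hl.eventually (gt_mem_nhds (lt_add_of_pos_right l hε))] with n hn
      have : η n = ξ n := if_pos hn
      simp [this]
    rw [hη]
    refine (Submodule.Quotient.norm_mk_le _ η).trans ?_
    refine lp.norm_le_of_forall_le (by positivity) fun n => ?_
    change ‖if ‖ξ n‖ < l + ε then ξ n else 0‖ ≤ _
    split_ifs with h
    exacts [h.le, by simp; positivity]
  · refine le_of_forall_pos_le_add fun ε hε => ?_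
    obtain ⟨η, hη, hlt⟩ := Submodule.Quotient.norm_mk_lt (S := ultraNull 𝕜 U E)
      (ultraMk 𝕜 U ξ) hε
    have h0 : Tendsto (fun n => ‖(η - ξ) n‖) U (𝓝 0) := (Submodule.Quotient.eq _).1 hη
    have h1 : Tendsto (fun n => ‖η‖ + ‖(η - ξ) n‖) U (𝓝 (‖η‖ + 0)) := h0.const_add _
    rw [add_zero] at h1
    refine (le_of_tendsto_of_tendsto' hl h1 fun n => ?_).trans hlt.le
    have := norm_sub_le (η n) ((η - ξ) n)
    simp only [lp.coeFn_sub, Pi.sub_apply, sub_sub_cancel] at this ⊢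
    exact this.trans (by gcongr; exact norm_apply_le_linf η n)

theorem ultraMk_eq_of_eventually {ξ η : lp (fun _ : ℕ => E) ∞} (h : ∀ᶠ n in U, ξ n = η n) :
    ultraMk 𝕜 U ξ = ultraMk 𝕜 U η := by
  refine (Submodule.Quotient.eq _).2 ?_
  change Tendsto (fun n => ‖(ξ - η) n‖) U (𝓝 0)
  refine tendsto_const_nhds.congr' ?_
  filter_upwards [h] with n hn
  simp [hn]

/-- The linear map of the ultrapower induced by a sequence of linear contractions. -/
noncomputable def ultraMap (T : ℕ → E →ₗ[𝕜] E) (hT : ∀ n x, ‖T n x‖ ≤ ‖x‖) :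
    Ultrapower 𝕜 U E →ₗ[𝕜] Ultrapower 𝕜 U E :=
  (ultraNull 𝕜 U E).mapQ (ultraNull 𝕜 U E)
    { toFun := fun ξ => boundedSeq (fun n => T n (ξ n))
        ⟨‖ξ‖, fun n => (hT n _).trans (norm_apply_le_linf ξ n)⟩
      map_add' := fun ξ η => by ext n; simp
      map_smul' := fun c ξ => by ext n; simp }
    (fun ξ hξ => by
      have hξ' : Tendsto (fun n => ‖ξ n‖) U (𝓝 0) := hξ
      exact squeeze_zero (fun n => norm_nonneg _) (fun n => hT n (ξ n)) hξ')

theorem ultraMap_mk (T : ℕ → E →ₗ[𝕜] E) (hT : ∀ n x, ‖T n x‖ ≤ ‖x‖)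
    (ξ : lp (fun _ : ℕ => E) ∞) :
    ultraMap U T hT (ultraMk 𝕜 U ξ) = ultraMk 𝕜 U (boundedSeq (fun n => T n (ξ n))
      ⟨‖ξ‖, fun n => (hT n _).trans (norm_apply_le_linf ξ n)⟩) := rfl

/-- The linear isometry of the ultrapower induced by a sequence of linear isometries. -/
noncomputable def ultraLinearIsometryEquiv (T : ℕ → E ≃ₗᵢ[𝕜] E) :
    Ultrapower 𝕜 U E ≃ₗᵢ[𝕜] Ultrapower 𝕜 U E where
  toLinearEquiv := LinearEquiv.ofLinearMap
    (ultraMap U (fun n => (T n).toLinearEquiv.toLinearMap) fun n x => ((T n).norm_map x).le)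
    (ultraMap U (fun n => (T n).symm.toLinearEquiv.toLinearMap)
      fun n x => ((T n).symm.norm_map x).le)
    (by
      ext ξ
      exact ultraMk_eq_of_eventually U (Eventually.of_forall fun n => (T n).apply_symm_apply _))
    (by
      ext ξ
      exact ultraMk_eq_of_eventually U (Eventually.of_forall fun n => (T n).symm_apply_apply _))
  norm_map' x := by
    obtain ⟨ξ, rfl⟩ := ultraMk_surjective U x
    refine tendsto_nhds_unique (tendsto_norm_ultraMk U (𝕜 := 𝕜) _)
      ((tendsto_norm_ultraMk U (𝕜 := 𝕜) ξ).congr fun n => ?_)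
    exact ((T n).norm_map _).symm

/-- The affine isometry of the ultrapower induced by a sequence of affine isometries with bounded
translation parts. -/
noncomputable def ultraAffineIsometryEquiv (T : ℕ → E ≃ᵃⁱ[𝕜] E) (hT : ∃ C, ∀ n, ‖T n 0‖ ≤ C) :
    Ultrapower 𝕜 U E ≃ᵃⁱ[𝕜] Ultrapower 𝕜 U E :=
  affineIsometryOf (ultraLinearIsometryEquiv U fun n => (T n).linearIsometryEquiv)
    (ultraMk 𝕜 U (boundedSeq (fun n => T n 0) hT))

theorem bounded_map_of_bounded_zero {T : ℕ → E ≃ᵃⁱ[𝕜] E} (hT : ∃ C, ∀ n, ‖T n 0‖ ≤ C)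
    (ξ : lp (fun _ : ℕ => E) ∞) : ∃ C, ∀ n, ‖T n (ξ n)‖ ≤ C := by
  obtain ⟨C, hC⟩ := hT
  refine ⟨‖ξ‖ + C, fun n => ?_⟩
  rw [AffineIsometryEquiv.apply_eq_linear_add]
  refine (norm_add_le _ _).trans (add_le_add ?_ (hC n))
  rw [LinearIsometryEquiv.norm_map]
  exact norm_apply_le_linf ξ n

theorem ultraAffineIsometryEquiv_mk {T : ℕ → E ≃ᵃⁱ[𝕜] E} (hT : ∃ C, ∀ n, ‖T n 0‖ ≤ C)
    (ξ : lp (fun _ : ℕ => E) ∞) :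
    ultraAffineIsometryEquiv U T hT (ultraMk 𝕜 U ξ) =
      ultraMk 𝕜 U (boundedSeq (fun n => T n (ξ n)) (bounded_map_of_bounded_zero hT ξ)) := by
  rw [ultraAffineIsometryEquiv, affineIsometryOf_apply]
  refine ultraMk_eq_of_eventually U (Eventually.of_forall fun n => ?_)
  exact (AffineIsometryEquiv.apply_eq_linear_add (T n) (ξ n)).symm

/-- A sequence of maps `T n : Γ → Isom(E)`, pointwise bounded at the origin and multiplicative in
the limit along `U`, induces an affine isometric action on the ultrapower. -/
noncomputable def ultraAction {Γ : Type u} [Group Γ] (T : ℕ → Γ → E ≃ᵃⁱ[𝕜] E)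
    (hT : ∀ γ, ∃ C, ∀ n, ‖T n γ 0‖ ≤ C) (h1 : ∀ᶠ n in U, ∀ x, T n 1 x = x)
    (hmul : ∀ γ γ', ∀ᶠ n in U, ∀ x, T n (γ * γ') x = T n γ (T n γ' x)) :
    Γ →* (Ultrapower 𝕜 U E ≃ᵃⁱ[𝕜] Ultrapower 𝕜 U E) where
  toFun γ := ultraAffineIsometryEquiv U (fun n => T n γ) (hT γ)
  map_one' := by
    ext x
    obtain ⟨ξ, rfl⟩ := ultraMk_surjective U x
    rw [ultraAffineIsometryEquiv_mk]
    exact ultraMk_eq_of_eventually U (h1.mono fun n hn => hn _)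
  map_mul' γ γ' := by
    ext x
    obtain ⟨ξ, rfl⟩ := ultraMk_surjective U x
    rw [AffineIsometryEquiv.coe_mul, Function.comp_apply, ultraAffineIsometryEquiv_mk,
      ultraAffineIsometryEquiv_mk, ultraAffineIsometryEquiv_mk]
    exact ultraMk_eq_of_eventually U ((hmul γ γ').mono fun n hn => hn _)

theorem ultraAction_mk {Γ : Type u} [Group Γ] (T : ℕ → Γ → E ≃ᵃⁱ[𝕜] E)
    (hT : ∀ γ, ∃ C, ∀ n, ‖T n γ 0‖ ≤ C) (h1 : ∀ᶠ n in U, ∀ x, T n 1 x = x)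
    (hmul : ∀ γ γ', ∀ᶠ n in U, ∀ x, T n (γ * γ') x = T n γ (T n γ' x)) (γ : Γ)
    (ξ : lp (fun _ : ℕ => E) ∞) :
    ultraAction U T hT h1 hmul γ (ultraMk 𝕜 U ξ) =
      ultraMk 𝕜 U (boundedSeq (fun n => T n γ (ξ n)) (bounded_map_of_bounded_zero (hT γ) ξ)) :=
  ultraAffineIsometryEquiv_mk U (hT γ) ξ

end Ultrapowers

/-! ### Measures on Stone spaces -/

section StoneSpace

/-- The space of ultrafilters on the set `α`, to be equipped with the σ-algebra generated by the
basic clopen sets of the measurable subsets of `α`. -/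
def StoneSpace (α : Type*) := Ultrafilter α

/-- The basic clopen set of `StoneSpace α` given by a subset of `α`. -/
def stoneSet {α : Type*} (s : Set α) : Set (StoneSpace α) := {u | s ∈ (show Ultrafilter α from u)}

variable {α : Type*}

instance : TopologicalSpace (StoneSpace α) := inferInstanceAs (TopologicalSpace (Ultrafilter α))

theorem preimage_pure_stoneSet (s : Set α) :
    (fun a : α => (show StoneSpace α from (pure a : Ultrafilter α))) ⁻¹' stoneSet s = s := by
  ext a
  exact Ultrafilter.mem_pure

theorem stoneSet_empty : stoneSet (∅ : Set α) = ∅ :=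
  Set.eq_empty_of_forall_notMem fun _ hu => Ultrafilter.empty_notMem hu

theorem stoneSet_univ : stoneSet (Set.univ : Set α) = Set.univ :=
  Set.eq_univ_of_forall fun u => (univ_mem : _ ∈ (show Ultrafilter α from u))

theorem stoneSet_inter (s t : Set α) : stoneSet (s ∩ t) = stoneSet s ∩ stoneSet t := by
  ext u
  exact Filter.inter_mem_iff

theorem stoneSet_union (s t : Set α) : stoneSet (s ∪ t) = stoneSet s ∪ stoneSet t := by
  ext u
  exact Ultrafilter.union_mem_iff

theorem stoneSet_compl (s : Set α) : stoneSet sᶜ = (stoneSet s)ᶜ := by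
  ext u
  exact Ultrafilter.compl_mem_iff_notMem

variable (α) in
/-- The algebra of the basic clopen sets of the measurable subsets of `α`. -/
def stoneAlgebra [MeasurableSpace α] : Set (Set (StoneSpace α)) :=
  {c | ∃ s : Set α, MeasurableSet s ∧ stoneSet s = c}

instance [MeasurableSpace α] : MeasurableSpace (StoneSpace α) :=
  MeasurableSpace.generateFrom (stoneAlgebra α)

variable [MeasurableSpace α]

theorem measurableSet_stoneSet {s : Set α} (hs : MeasurableSet s) : MeasurableSet (stoneSet s) :=
  MeasurableSpace.measurableSet_generateFrom ⟨s, hs, rfl⟩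

theorem isSetAlgebra_stoneAlgebra : MeasureTheory.IsSetAlgebra (stoneAlgebra α) where
  empty_mem := ⟨∅, .empty, stoneSet_empty⟩
  compl_mem := by
    rintro _ ⟨s, hs, rfl⟩
    exact ⟨sᶜ, hs.compl, stoneSet_compl s⟩
  union_mem := by
    rintro _ _ ⟨s, hs, rfl⟩ ⟨t, ht, rfl⟩
    exact ⟨s ∪ t, hs.union ht, stoneSet_union s t⟩

/-- A finitely additive measure becomes countably additive on the Stone space: a countable cover
of a clopen set by clopen sets has a finite subcover. -/
theorem exists_measure_stoneSet (m : Set α → ℝ≥0∞) (m_empty : m ∅ = 0)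
    (m_union : ∀ s t, MeasurableSet s → MeasurableSet t → Disjoint s t → m (s ∪ t) = m s + m t) :
    ∃ ν : MeasureTheory.Measure (StoneSpace α), ∀ s, MeasurableSet s → ν (stoneSet s) = m s := by
  have hC := (isSetAlgebra_stoneAlgebra (α := α)).isSetRing
  let ι : α → StoneSpace α := fun a => (pure a : Ultrafilter α)
  have hι : ∀ s, ι ⁻¹' stoneSet s = s := preimage_pure_stoneSet
  let M : MeasureTheory.AddContent ℝ≥0∞ (stoneAlgebra α) :=
    hC.addContent_of_union (fun c => m (ι ⁻¹' c)) (by simpa using m_empty) (by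
      rintro _ _ ⟨s, hs, rfl⟩ ⟨t, ht, rfl⟩ hd
      have hd' : Disjoint s t := by
        have := hd.preimage ι
        rwa [hι, hι] at this
      rw [Set.preimage_union, hι, hι]
      exact m_union s t hs ht hd')
  have hsub : M.IsSigmaSubadditive := by
    intro f hf hU
    have hopen : ∀ i, IsOpen (f i) := fun i => by
      obtain ⟨s, -, hs⟩ := hf i
      rw [← hs]; exact ultrafilter_isOpen_basic s
    have hcpt : IsCompact (⋃ i, f i) := by
      obtain ⟨s, -, hs⟩ := hU
      rw [← hs]; exact (ultrafilter_isClosed_basic s).isCompact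
    obtain ⟨F, hF⟩ := hcpt.elim_finite_subcover f hopen subset_rfl
    have hEq : (⋃ i, f i) = ⋃ i ∈ F, f i :=
      hF.antisymm (Set.iUnion₂_subset fun i _ => Set.subset_iUnion f i)
    rw [hEq]
    exact (MeasureTheory.addContent_biUnion_le hC fun i _ => hf i).trans
      (ENNReal.sum_le_tsum F)
  refine ⟨M.measure hC.isSetSemiring le_rfl hsub, fun s hs => ?_⟩
  rw [MeasureTheory.AddContent.measure_eq M hC.isSetSemiring rfl hsub ⟨s, hs, rfl⟩]
  exact congrArg m (hι s)

end StoneSpace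

/-! ### Boolean algebras of `L_p`-projections -/

/-- A Boolean algebra of `L_q`-projections of `X`, indexed by the measurable subsets of `α`: the
model is the multiplication by indicator functions on `L_q(α)`. Nothing is required of the
values `proj s` for non-measurable `s`. -/
structure LpProjections (𝕜 : Type) [RCLike 𝕜] (q : ℝ) (α : Type*) [MeasurableSpace α]
    (X : Type*) [NormedAddCommGroup X] [NormedSpace 𝕜 X] where
  proj : Set α → X →ₗ[𝕜] X
  proj_univ : ∀ x, proj Set.univ x = x
  proj_inter : ∀ s t, MeasurableSet s → MeasurableSet t → ∀ x,
    proj (s ∩ t) x = proj s (proj t x)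
  proj_add_compl : ∀ s, MeasurableSet s → ∀ x, proj s x + proj sᶜ x = x
  norm_rpow : ∀ s, MeasurableSet s → ∀ x, ‖proj s x‖ ^ q + ‖proj sᶜ x‖ ^ q = ‖x‖ ^ q

namespace LpProjections

variable {𝕜 : Type} [RCLike 𝕜] {q : ℝ} {α : Type*} [MeasurableSpace α]
  {X : Type*} [NormedAddCommGroup X] [NormedSpace 𝕜 X] (P : LpProjections 𝕜 q α X)

theorem proj_empty (x : X) : P.proj ∅ x = 0 := by
  have := P.proj_add_compl Set.univ .univ x
  rw [P.proj_univ, Set.compl_univ] at this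
  simpa using this

theorem proj_comm {s t : Set α} (hs : MeasurableSet s) (ht : MeasurableSet t) (x : X) :
    P.proj s (P.proj t x) = P.proj t (P.proj s x) := by
  rw [← P.proj_inter s t hs ht, Set.inter_comm, P.proj_inter t s ht hs]

theorem proj_self {s : Set α} (hs : MeasurableSet s) (x : X) :
    P.proj s (P.proj s x) = P.proj s x := by
  rw [← P.proj_inter s s hs hs, Set.inter_self]

theorem proj_of_disjoint {s t : Set α} (hs : MeasurableSet s) (ht : MeasurableSet t)
    (h : Disjoint s t) (x : X) : P.proj s (P.proj t x) = 0 := by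
  rw [← P.proj_inter s t hs ht, h.inter_eq, P.proj_empty]

theorem proj_union {s t : Set α} (hs : MeasurableSet s) (ht : MeasurableSet t)
    (h : Disjoint s t) (x : X) : P.proj (s ∪ t) x = P.proj s x + P.proj t x := by
  have h1 : s ∩ (s ∪ t) = s := by simp
  have h2 : sᶜ ∩ (s ∪ t) = t := by
    ext a
    have := fun h1 : a ∈ s => Set.disjoint_left.1 h h1
    simp only [Set.mem_inter_iff, Set.mem_compl_iff, Set.mem_union]
    tauto
  rw [← P.proj_add_compl s hs (P.proj (s ∪ t) x), ← P.proj_inter s _ hs (hs.union ht),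
    ← P.proj_inter _ _ hs.compl (hs.union ht), h1, h2]

theorem norm_proj_union_rpow {s t : Set α} (hs : MeasurableSet s) (ht : MeasurableSet t)
    (h : Disjoint s t) (x : X) :
    ‖P.proj (s ∪ t) x‖ ^ q = ‖P.proj s x‖ ^ q + ‖P.proj t x‖ ^ q := by
  have h1 : s ∩ (s ∪ t) = s := by simp
  have h2 : sᶜ ∩ (s ∪ t) = t := by
    ext a
    have := fun h1 : a ∈ s => Set.disjoint_left.1 h h1
    simp only [Set.mem_inter_iff, Set.mem_compl_iff, Set.mem_union]
    tauto
  rw [← P.norm_rpow s hs (P.proj (s ∪ t) x), ← P.proj_inter s _ hs (hs.union ht),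
    ← P.proj_inter _ _ hs.compl (hs.union ht), h1, h2]

theorem norm_proj_le (hq : 0 < q) {s : Set α} (hs : MeasurableSet s) (x : X) :
    ‖P.proj s x‖ ≤ ‖x‖ := by
  rw [← Real.rpow_le_rpow_iff (norm_nonneg _) (norm_nonneg _) hq, ← P.norm_rpow s hs x]
  exact le_add_of_nonneg_right (by positivity)

theorem norm_proj_sub_proj {s t : Set α} (hs : MeasurableSet s)
    (ht : MeasurableSet t) (h : s ⊆ t) (x : X) :
    ‖P.proj t x - P.proj s x‖ ^ q = ‖P.proj t x‖ ^ q - ‖P.proj s x‖ ^ q := by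
  have h1 : P.proj s (P.proj t x) = P.proj s x := by
    rw [← P.proj_inter s t hs ht, Set.inter_eq_left.2 h]
  have h2 := P.norm_rpow s hs (P.proj t x)
  have h3 := P.proj_add_compl s hs (P.proj t x)
  rw [h1] at h2 h3
  rw [← h2, sub_eq_of_eq_add' h3.symm]
  ring

end LpProjections

/-! ### Cyclic subspaces and disjoint vectors -/

namespace LpProjections

variable {𝕜 : Type} [RCLike 𝕜] {q : ℝ} {α : Type*} [MeasurableSpace α]
  {X : Type*} [NormedAddCommGroup X] [NormedSpace 𝕜 X] (P : LpProjections 𝕜 q α X)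

/-- The closed subspace generated by the vectors `P.proj s e`. -/
def cyclic (e : X) : Submodule 𝕜 X :=
  (Submodule.span 𝕜 {x | ∃ s, MeasurableSet s ∧ P.proj s e = x}).topologicalClosure

theorem cyclic_le {e : X} {V : Submodule 𝕜 X} (hV : IsClosed (V : Set X))
    (h : ∀ s, MeasurableSet s → P.proj s e ∈ V) : P.cyclic e ≤ V := by
  refine Submodule.topologicalClosure_minimal _ (Submodule.span_le.2 ?_) hV
  rintro _ ⟨s, hs, rfl⟩
  exact h s hs

theorem isClosed_cyclic (e : X) : IsClosed (P.cyclic e : Set X) :=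
  Submodule.isClosed_topologicalClosure _

theorem proj_mem_cyclic (e : X) {s : Set α} (hs : MeasurableSet s) : P.proj s e ∈ P.cyclic e :=
  Submodule.le_topologicalClosure _ (Submodule.subset_span ⟨s, hs, rfl⟩)

theorem continuous_proj (hq : 0 < q) {s : Set α} (hs : MeasurableSet s) :
    Continuous (P.proj s) :=
  AddMonoidHomClass.continuous_of_bound (P.proj s) 1 fun x => by
    rw [one_mul]; exact P.norm_proj_le hq hs x

theorem proj_mem_cyclic_of_mem (hq : 0 < q) {e x : X} (hx : x ∈ P.cyclic e) {s : Set α}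
    (hs : MeasurableSet s) : P.proj s x ∈ P.cyclic e := by
  refine P.cyclic_le (V := (P.cyclic e).comap (P.proj s))
    ((P.isClosed_cyclic e).preimage (P.continuous_proj hq hs)) (fun t ht => ?_) hx
  rw [Submodule.mem_comap, ← P.proj_inter s t hs ht]
  exact P.proj_mem_cyclic e (hs.inter ht)

/-- Two vectors are disjoint if they are almost carried by complementary sets. -/
def Perp (x y : X) : Prop :=
  ∀ ε > 0, ∃ s, MeasurableSet s ∧ ‖P.proj sᶜ x‖ ≤ ε ∧ ‖P.proj s y‖ ≤ ε

variable {P}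

theorem Perp.symm {x y : X} (h : P.Perp x y) : P.Perp y x := fun ε hε => by
  obtain ⟨s, hs, h1, h2⟩ := h ε hε
  exact ⟨sᶜ, hs.compl, by rwa [compl_compl], h1⟩

theorem Perp.eq_zero {x : X} (h : P.Perp x x) : x = 0 := by
  rw [← norm_le_zero_iff]
  refine le_of_forall_pos_le_add fun ε hε => ?_
  obtain ⟨s, hs, h1, h2⟩ := h (ε / 2) (half_pos hε)
  have := norm_add_le (P.proj s x) (P.proj sᶜ x)
  rw [P.proj_add_compl s hs] at this
  linarith

theorem Perp.norm_add_rpow (hq : 0 < q) {x y : X} (h : P.Perp x y) :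
    ‖x + y‖ ^ q = ‖x‖ ^ q + ‖y‖ ^ q := by
  choose s hs h1 h2 using fun n : ℕ => h (1 / ((n : ℝ) + 1)) Nat.one_div_pos_of_nat
  have h0 := tendsto_one_div_add_atTop_nhds_zero_nat (𝕜 := ℝ)
  have key : ∀ (u v : X) (t : ℕ → Set α), (∀ n, MeasurableSet (t n)) →
      (∀ n, ‖P.proj (t n)ᶜ u‖ ≤ 1 / ((n : ℝ) + 1)) → (∀ n, ‖P.proj (t n) v‖ ≤ 1 / ((n : ℝ) + 1)) →
      Tendsto (fun n => ‖P.proj (t n) (u + v)‖ ^ q) atTop (𝓝 (‖u‖ ^ q)) := by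
    intro u v t ht hu hv
    refine Tendsto.rpow_const ?_ (Or.inr hq.le)
    refine Tendsto.norm ?_
    rw [tendsto_iff_norm_sub_tendsto_zero]
    refine squeeze_zero (fun n => norm_nonneg _) (fun n => ?_) (by simpa only [add_zero] using h0.add h0)
    have : P.proj (t n) (u + v) - u = P.proj (t n) v - P.proj (t n)ᶜ u := by
      conv_lhs => rw [← P.proj_add_compl (t n) (ht n) u]
      rw [P.proj_add_compl (t n) (ht n) u, map_add]
      nth_rw 2 [← P.proj_add_compl (t n) (ht n) u]
      abel
    rw [this]
    exact (norm_sub_le _ _).trans (add_le_add (hv n) (hu n))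
  have hx := key x y s hs h1 h2
  have hy := key y x (fun n => (s n)ᶜ) (fun n => (hs n).compl)
    (fun n => by rw [compl_compl]; exact h2 n) h1
  refine tendsto_nhds_unique (tendsto_const_nhds.congr fun n => ?_) (hx.add hy)
  rw [add_comm y x]
  exact (P.norm_rpow (s n) (hs n) (x + y)).symm

variable (P) in
/-- The closed subspace of the vectors disjoint from `y`. -/
def perpSubmodule (hq : 0 < q) (y : X) : Submodule 𝕜 X where
  carrier := {x | P.Perp x y}
  zero_mem' := fun ε hε => ⟨∅, .empty, by simp [hε.le], by simp [P.proj_empty, hε.le]⟩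
  add_mem' := by
    intro x x' hx hx' ε hε
    obtain ⟨s, hs, h1, h2⟩ := hx (ε / 2) (half_pos hε)
    obtain ⟨t, ht, h3, h4⟩ := hx' (ε / 2) (half_pos hε)
    refine ⟨s ∪ t, hs.union ht, ?_, ?_⟩
    · rw [map_add, Set.compl_union]
      have e1 : ‖P.proj (sᶜ ∩ tᶜ) x‖ ≤ ε / 2 := by
        rw [P.proj_inter _ _ hs.compl ht.compl, P.proj_comm hs.compl ht.compl]
        exact (P.norm_proj_le hq ht.compl _).trans h1
      have e2 : ‖P.proj (sᶜ ∩ tᶜ) x'‖ ≤ ε / 2 := by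
        rw [P.proj_inter _ _ hs.compl ht.compl]
        exact (P.norm_proj_le hq hs.compl _).trans h3
      linarith [norm_add_le (P.proj (sᶜ ∩ tᶜ) x) (P.proj (sᶜ ∩ tᶜ) x')]
    · have hst : s ∪ t = s ∪ (sᶜ ∩ t) := by ext a; by_cases a ∈ s <;> simp [*]
      have hd : Disjoint s (sᶜ ∩ t) := Set.disjoint_left.2 fun a h h' => h'.1 h
      rw [hst, P.proj_union hs (hs.compl.inter ht) hd, P.proj_inter _ _ hs.compl ht]
      have := P.norm_proj_le hq hs.compl (P.proj t y)
      linarith [norm_add_le (P.proj s y) (P.proj sᶜ (P.proj t y))]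
  smul_mem' := by
    intro c x hx ε hε
    have hc : 0 < ‖c‖ + 1 := by positivity
    obtain ⟨s, hs, h1, h2⟩ := hx (ε / (‖c‖ + 1)) (by positivity)
    refine ⟨s, hs, ?_, h2.trans (div_le_self hε.le (by simp))⟩
    rw [map_smul, norm_smul]
    calc ‖c‖ * ‖P.proj sᶜ x‖ ≤ (‖c‖ + 1) * (ε / (‖c‖ + 1)) := by gcongr; linarith
      _ = ε := by field_simp

theorem isClosed_perpSubmodule (hq : 0 < q) (y : X) :
    IsClosed (P.perpSubmodule hq y : Set X) := by
  refine isClosed_of_closure_subset fun x hx ε hε => ?_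
  obtain ⟨z, hz, hxz⟩ := Metric.mem_closure_iff.1 hx (ε / 2) (half_pos hε)
  obtain ⟨s, hs, h1, h2⟩ := (show P.Perp z y from hz) (ε / 2) (half_pos hε)
  refine ⟨s, hs, ?_, h2.trans (by linarith)⟩
  have h3 := P.norm_proj_le hq hs.compl (x - z)
  rw [← dist_eq_norm] at h3
  have h4 := norm_add_le (P.proj sᶜ (x - z)) (P.proj sᶜ z)
  rw [← map_add, sub_add_cancel] at h4
  rw [dist_eq_norm] at h3 hxz
  linarith

theorem Perp.proj_left (hq : 0 < q) {x y : X} (h : P.Perp x y) {s : Set α}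
    (hs : MeasurableSet s) : P.Perp (P.proj s x) y := fun ε hε => by
  obtain ⟨t, ht, h1, h2⟩ := h ε hε
  refine ⟨t, ht, ?_, h2⟩
  rw [P.proj_comm ht.compl hs]
  exact (P.norm_proj_le hq hs _).trans h1

theorem Perp.of_mem_cyclic (hq : 0 < q) {e x y : X} (h : P.Perp e y) (hx : x ∈ P.cyclic e) :
    P.Perp x y :=
  P.cyclic_le (V := P.perpSubmodule hq y) (isClosed_perpSubmodule hq y)
    (fun _ hs => h.proj_left hq hs) hx

variable (P) in
/-- If `x` belongs to the cyclic subspace of `e` up to projections that carry almost all of `e`,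
then `x` splits into a part in the cyclic subspace and a part disjoint from `e`. -/
theorem exists_cyclic_add_perp [CompleteSpace X] (hq : 0 < q) (e x : X)
    (h : ∀ ε > 0, ∃ s, MeasurableSet s ∧ ‖P.proj sᶜ e‖ ≤ ε ∧ P.proj s x ∈ P.cyclic e) :
    ∃ y ∈ P.cyclic e, P.Perp (x - y) e := by
  choose A hA h1 h2 using fun n : ℕ => h (1 / ((n : ℝ) + 1)) Nat.one_div_pos_of_nat
  let B : ℕ → Set α := Set.accumulate A
  have hB : ∀ n, MeasurableSet (B n) := fun n =>
    MeasurableSet.biUnion (Set.to_countable _) fun i _ => hA i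
  have hBmono : Monotone B := Set.monotone_accumulate
  have hBmem : ∀ n, P.proj (B n) x ∈ P.cyclic e := by
    intro n
    induction n with
    | zero => simpa [B, Set.accumulate_zero_nat] using h2 0
    | succ n ih =>
      have hst : B (n + 1) = B n ∪ ((B n)ᶜ ∩ A (n + 1)) := by
        change Set.accumulate A (n + 1) = _
        rw [Set.accumulate_succ]
        change B n ∪ A (n + 1) = _
        ext a; by_cases h : a ∈ B n <;> simp [h]
      have hd : Disjoint (B n) ((B n)ᶜ ∩ A (n + 1)) := Set.disjoint_left.2 fun a h h' => h'.1 h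
      rw [hst, P.proj_union (hB n) ((hB n).compl.inter (hA _)) hd,
        P.proj_inter _ _ (hB n).compl (hA _)]
      exact add_mem ih (P.proj_mem_cyclic_of_mem hq (h2 _) (hB n).compl)
  have hBe : ∀ n, ‖P.proj (B n)ᶜ e‖ ≤ 1 / ((n : ℝ) + 1) := by
    intro n
    have : (B n)ᶜ = (B n)ᶜ ∩ (A n)ᶜ :=
      (Set.inter_eq_left.2 (Set.compl_subset_compl.2 Set.subset_accumulate)).symm
    rw [this, P.proj_inter _ _ (hB n).compl (hA n).compl]
    exact (P.norm_proj_le hq (hB n).compl _).trans (h1 n)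
  -- The norms `‖P.proj (B n) x‖ ^ q` are increasing and bounded, and their increments are the
  -- powers of the distances.
  have hmono : Monotone fun n => ‖P.proj (B n) x‖ ^ q := by
    intro m n hmn
    have := P.norm_proj_sub_proj (hB m) (hB n) (hBmono hmn) x
    have h0 : 0 ≤ ‖P.proj (B n) x - P.proj (B m) x‖ ^ q := by positivity
    dsimp only
    linarith
  have hbdd : BddAbove (Set.range fun n => ‖P.proj (B n) x‖ ^ q) :=
    ⟨‖x‖ ^ q, by
      rintro _ ⟨n, rfl⟩
      exact Real.rpow_le_rpow (norm_nonneg _) (P.norm_proj_le hq (hB n) x) hq.le⟩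
  have hcau := (tendsto_atTop_ciSup hmono hbdd).cauchySeq
  have hcauchy : CauchySeq fun n => P.proj (B n) x := by
    rw [Metric.cauchySeq_iff'] at hcau ⊢
    intro ε hε
    obtain ⟨N, hN⟩ := hcau (ε ^ q) (by positivity)
    refine ⟨N, fun n hn => ?_⟩
    have h3 := hN n hn
    rw [dist_eq_norm, ← Real.rpow_lt_rpow_iff (norm_nonneg _) hε.le hq,
      P.norm_proj_sub_proj (hB N) (hB n) (hBmono hn)]
    exact (le_abs_self _).trans_lt h3
  obtain ⟨y, hy⟩ := cauchySeq_tendsto_of_complete hcauchy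
  refine ⟨y, (P.isClosed_cyclic e).mem_of_tendsto hy (Eventually.of_forall hBmem), ?_⟩
  have hzero : ∀ n, P.proj (B n) (x - y) = 0 := by
    intro n
    have h3 : Tendsto (fun m => P.proj (B n) (x - P.proj (B m) x)) atTop
        (𝓝 (P.proj (B n) (x - y))) :=
      ((P.continuous_proj hq (hB n)).tendsto _).comp (tendsto_const_nhds.sub hy)
    refine tendsto_nhds_unique h3 (tendsto_const_nhds.congr' ?_)
    filter_upwards [eventually_ge_atTop n] with m hm
    rw [map_sub, ← P.proj_inter _ _ (hB n) (hB m), Set.inter_eq_left.2 (hBmono hm), sub_self]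
  refine Perp.symm fun ε hε => ?_
  obtain ⟨n, hn⟩ := exists_nat_one_div_lt hε
  exact ⟨B n, hB n, (hBe n).trans hn.le, by simp [hzero n, hε.le]⟩

theorem norm_sum_proj_insert [DecidableEq {s : Set α // MeasurableSet s}]
    (P : LpProjections 𝕜 q α X) (d : {s : Set α // MeasurableSet s} → 𝕜) {B : Set α}
    (hB : MeasurableSet B) (c : 𝕜) (e : X) {t : {s : Set α // MeasurableSet s}}
    {F : Finset {s : Set α // MeasurableSet s}} (ht : t ∉ F) :
    ‖(∑ s ∈ insert t F, d s • P.proj B (P.proj s e)) + c • P.proj B e‖ ^ q =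
      ‖(∑ s ∈ F, d s • P.proj (t ∩ B) (P.proj s e)) + (d t + c) • P.proj (t ∩ B) e‖ ^ q +
      ‖(∑ s ∈ F, d s • P.proj (tᶜ ∩ B) (P.proj s e)) + c • P.proj (tᶜ ∩ B) e‖ ^ q := by
  rw [Finset.sum_insert ht, ← P.norm_rpow t t.2]
  simp only [map_add, map_sum, map_smul, P.proj_inter t B t.2 hB,
    P.proj_inter (tᶜ : Set α) B t.2.compl hB]
  congr 3
  · rw [P.proj_comm hB t.2, P.proj_self t.2, add_smul]
    abel
  · rw [P.proj_comm hB t.2, P.proj_of_disjoint t.2.compl t.2 disjoint_compl_left]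
    simp

/-- The norms of the combinations of the vectors `P.proj s e` are determined by the norms
`‖P.proj s e‖`. -/
theorem norm_linearCombination_eq (hq : 0 < q) {X' : Type*} [NormedAddCommGroup X']
    [NormedSpace 𝕜 X'] (P' : LpProjections 𝕜 q α X') {e : X} {e' : X'}
    (h : ∀ s, MeasurableSet s → ‖P.proj s e‖ = ‖P'.proj s e'‖)
    (d : {s : Set α // MeasurableSet s} →₀ 𝕜) :
    ‖Finsupp.linearCombination 𝕜 (fun s : {s : Set α // MeasurableSet s} => P.proj s e) d‖ =
      ‖Finsupp.linearCombination 𝕜 (fun s : {s : Set α // MeasurableSet s} => P'.proj s e') d‖ := by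
  classical
  have key : ∀ (F : Finset {s : Set α // MeasurableSet s}) (B : Set α), MeasurableSet B →
      ∀ c : 𝕜, ‖(∑ s ∈ F, d s • P.proj B (P.proj s e)) + c • P.proj B e‖ ^ q =
        ‖(∑ s ∈ F, d s • P'.proj B (P'.proj s e')) + c • P'.proj B e'‖ ^ q := by
    intro F
    induction F using Finset.induction_on with
    | empty => intro B hB c; simp [norm_smul, h B hB]
    | insert t F ht ih =>
      intro B hB c
      rw [norm_sum_proj_insert P d hB c e ht, norm_sum_proj_insert P' d hB c e' ht,
        ih _ (t.2.inter hB), ih _ (t.2.compl.inter hB)]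
  have := key d.support Set.univ .univ 0
  simp only [P.proj_univ, P'.proj_univ, zero_smul, add_zero] at this
  rw [Real.rpow_left_inj (norm_nonneg _) (norm_nonneg _) hq.ne'] at this
  simpa [Finsupp.linearCombination_apply, Finsupp.sum] using this

end LpProjections

/-! ### Multiplication by indicator functions -/

section LpIndicator

open MeasureTheory

variable {𝕜 : Type} [RCLike 𝕜] {p : ℝ≥0∞}

/-- Transport of projections along a homomorphism of the algebras of sets. -/
def LpProjections.comap {q : ℝ} {α β : Type*} [MeasurableSpace α] [MeasurableSpace β]
    {X : Type*} [NormedAddCommGroup X] [NormedSpace 𝕜 X] (P : LpProjections 𝕜 q β X)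
    (φ : Set α → Set β) (hφ : ∀ s, MeasurableSet s → MeasurableSet (φ s))
    (huniv : φ Set.univ = Set.univ) (hinter : ∀ s t, φ (s ∩ t) = φ s ∩ φ t)
    (hcompl : ∀ s, φ sᶜ = (φ s)ᶜ) : LpProjections 𝕜 q α X where
  proj s := P.proj (φ s)
  proj_univ x := by rw [huniv, P.proj_univ]
  proj_inter s t hs ht x := by rw [hinter, P.proj_inter _ _ (hφ s hs) (hφ t ht)]
  proj_add_compl s hs x := by rw [hcompl, P.proj_add_compl _ (hφ s hs)]
  norm_rpow s hs x := by rw [hcompl, P.norm_rpow _ (hφ s hs)]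

/-- Transport of projections along a linear isometry. -/
noncomputable def LpProjections.congr {q : ℝ} {α : Type*} [MeasurableSpace α]
    {X Y : Type*} [NormedAddCommGroup X] [NormedSpace 𝕜 X] [NormedAddCommGroup Y]
    [NormedSpace 𝕜 Y] (P : LpProjections 𝕜 q α Y) (e : X ≃ₗᵢ[𝕜] Y) : LpProjections 𝕜 q α X where
  proj s := e.symm.toLinearEquiv.toLinearMap ∘ₗ P.proj s ∘ₗ e.toLinearEquiv.toLinearMap
  proj_univ x := by simp [P.proj_univ]
  proj_inter s t hs ht x := by simp [P.proj_inter s t hs ht]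
  proj_add_compl s hs x := by
    apply e.injective
    simp [P.proj_add_compl s hs]
  norm_rpow s hs x := by simpa using P.norm_rpow s hs (e x)

variable {Ω : Type*} [MeasurableSpace Ω] (μ : Measure Ω)

open Classical in
/-- The product of an element of `L_p(μ)` and the indicator function of a measurable set. -/
noncomputable def lpIndicatorFun (s : Set Ω) (f : Lp 𝕜 p μ) : Lp 𝕜 p μ :=
  if hs : MeasurableSet s then ((Lp.memLp f).indicator hs).toLp _ else 0

theorem coeFn_lpIndicatorFun {s : Set Ω} (hs : MeasurableSet s) (f : Lp 𝕜 p μ) :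
    lpIndicatorFun μ s f =ᵐ[μ] s.indicator f := by
  rw [lpIndicatorFun, dif_pos hs]
  exact MemLp.coeFn_toLp _

theorem lpIndicatorFun_of_not_measurableSet {s : Set Ω} (hs : ¬ MeasurableSet s) (f : Lp 𝕜 p μ) :
    lpIndicatorFun μ s f = 0 := dif_neg hs

variable (𝕜 p) in
/-- The multiplication by the indicator function of a measurable set, on `L_p(μ)`. -/
noncomputable def lpIndicator (s : Set Ω) : Lp 𝕜 p μ →ₗ[𝕜] Lp 𝕜 p μ where
  toFun := lpIndicatorFun μ s
  map_add' f g := by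
    by_cases hs : MeasurableSet s
    · ext1
      filter_upwards [Lp.coeFn_add f g, coeFn_lpIndicatorFun μ hs (f + g),
        coeFn_lpIndicatorFun μ hs f, coeFn_lpIndicatorFun μ hs g,
        Lp.coeFn_add (lpIndicatorFun μ s f) (lpIndicatorFun μ s g)] with ω h1 h2 h3 h4 h5
      rw [h2, h5, Pi.add_apply, h3, h4]
      by_cases h : ω ∈ s
      · rw [Set.indicator_of_mem h, Set.indicator_of_mem h, Set.indicator_of_mem h, h1,
          Pi.add_apply]
      · rw [Set.indicator_of_notMem h, Set.indicator_of_notMem h, Set.indicator_of_notMem h,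
          add_zero]
    · simp [lpIndicatorFun_of_not_measurableSet μ hs]
  map_smul' c f := by
    by_cases hs : MeasurableSet s
    · ext1
      filter_upwards [Lp.coeFn_smul c f, coeFn_lpIndicatorFun μ hs (c • f),
        coeFn_lpIndicatorFun μ hs f, Lp.coeFn_smul c (lpIndicatorFun μ s f)] with ω h1 h2 h3 h4
      rw [h2, RingHom.id_apply, h4, Pi.smul_apply, h3]
      by_cases h : ω ∈ s
      · rw [Set.indicator_of_mem h, Set.indicator_of_mem h, h1, Pi.smul_apply]
      · rw [Set.indicator_of_notMem h, Set.indicator_of_notMem h, smul_zero]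
    · simp [lpIndicatorFun_of_not_measurableSet μ hs]

theorem coeFn_lpIndicator {s : Set Ω} (hs : MeasurableSet s) (f : Lp 𝕜 p μ) :
    lpIndicator 𝕜 p μ s f =ᵐ[μ] s.indicator f :=
  coeFn_lpIndicatorFun μ hs f

theorem lpIndicator_indicatorConstLp {s t : Set Ω} (hs : MeasurableSet s) (ht : MeasurableSet t)
    (hμt : μ t ≠ ∞) (c : 𝕜) :
    lpIndicator 𝕜 p μ s (indicatorConstLp p ht hμt c) =
      indicatorConstLp p (hs.inter ht) (measure_ne_top_of_subset Set.inter_subset_right hμt) c := by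
  ext1
  filter_upwards [coeFn_lpIndicator μ hs (indicatorConstLp p ht hμt c),
    indicatorConstLp_coeFn (p := p) (hs := ht) (hμs := hμt) (c := c),
    indicatorConstLp_coeFn (p := p) (hs := hs.inter ht)
      (hμs := measure_ne_top_of_subset Set.inter_subset_right hμt) (c := c)] with ω h1 h2 h3
  rw [h1, h3, ← Set.indicator_indicator]
  by_cases h : ω ∈ s
  · simp [h, h2]
  · simp [h]

variable [Fact (1 ≤ p)]

theorem Lp.norm_rpow_eq_lintegral {F : Type*} [NormedAddCommGroup F] (hp : p ≠ ∞) (f : Lp F p μ) :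
    ENNReal.ofReal (‖f‖ ^ p.toReal) = ∫⁻ ω, ‖f ω‖ₑ ^ p.toReal ∂μ := by
  have hq := toReal_pos_of_one_le p hp
  have hp0 : p ≠ 0 := (zero_lt_one.trans_le Fact.out).ne'
  rw [← ENNReal.ofReal_rpow_of_nonneg (norm_nonneg _) hq.le, ofReal_norm, Lp.enorm_def,
    eLpNorm_eq_lintegral_rpow_enorm_toReal hp0 hp, ← ENNReal.rpow_mul, one_div,
    inv_mul_cancel₀ hq.ne', ENNReal.rpow_one]

/-- The projections of `L_p(μ)` given by the multiplications by indicator functions. -/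
noncomputable def lpIndicatorProjections (hp : p ≠ ∞) :
    LpProjections 𝕜 p.toReal Ω (Lp 𝕜 p μ) where
  proj := lpIndicator 𝕜 p μ
  proj_univ f := by
    ext1
    filter_upwards [coeFn_lpIndicator μ .univ f] with ω h
    rw [h, Set.indicator_univ]
  proj_inter s t hs ht f := by
    ext1
    filter_upwards [coeFn_lpIndicator μ (hs.inter ht) f, coeFn_lpIndicator μ ht f,
      coeFn_lpIndicator μ hs (lpIndicator 𝕜 p μ t f)] with ω h1 h2 h3
    rw [h1, h3, ← Set.indicator_indicator]
    by_cases h : ω ∈ s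
    · simp [h, h2]
    · simp [h]
  proj_add_compl s hs f := by
    ext1
    filter_upwards [coeFn_lpIndicator μ hs f, coeFn_lpIndicator μ hs.compl f,
      Lp.coeFn_add (lpIndicator 𝕜 p μ s f) (lpIndicator 𝕜 p μ sᶜ f)] with ω h1 h2 h3
    rw [h3, Pi.add_apply, h1, h2]
    by_cases h : ω ∈ s <;> simp [h]
  norm_rpow s hs f := by
    have hq := toReal_pos_of_one_le p hp
    rw [← ENNReal.ofReal_eq_ofReal_iff (by positivity) (by positivity),
      ENNReal.ofReal_add (by positivity) (by positivity), Lp.norm_rpow_eq_lintegral μ hp,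
      Lp.norm_rpow_eq_lintegral μ hp, Lp.norm_rpow_eq_lintegral μ hp,
      ← lintegral_add_left' ((Lp.aestronglyMeasurable _).enorm.pow_const _)]
    refine lintegral_congr_ae ?_
    filter_upwards [coeFn_lpIndicator μ hs f, coeFn_lpIndicator μ hs.compl f] with ω h1 h2
    rw [h1, h2]
    by_cases h : ω ∈ s <;> simp [h, hq]

end LpIndicator

/-! ### Cyclic subspaces as `L_p`-spaces -/

section CyclicIso

open MeasureTheory

variable {𝕜 : Type} [RCLike 𝕜] {p : ℝ≥0∞} [Fact (1 ≤ p)]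

/-- The span of the indicator functions of the sets of a generating algebra is dense in
`L_p(ν)`, for a finite measure `ν`. -/
theorem topologicalClosure_indicatorConstLp (hp : p ≠ ∞) {Ω : Type*} [m : MeasurableSpace Ω]
    (ν : Measure Ω) [IsFiniteMeasure ν] {𝒜 : Set (Set Ω)} (h𝒜 : IsSetAlgebra 𝒜)
    (hgen : m = MeasurableSpace.generateFrom 𝒜) (V : Submodule 𝕜 (Lp 𝕜 p ν))
    (hV : IsClosed (V : Set (Lp 𝕜 p ν)))
    (h : ∀ s ∈ 𝒜, ∀ hs : MeasurableSet s, indicatorConstLp p hs (measure_ne_top ν s) (1 : 𝕜) ∈ V) :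
    V = ⊤ := by
  have : Fact (p ≠ ∞) := ⟨hp⟩
  have hd := Measure.MeasureDense.of_generateFrom_isSetAlgebra_finite ν h𝒜 hgen
  refine Submodule.eq_top_iff'.2 fun f => ?_
  induction f using Lp.induction hp with
  | indicatorConst c hs hμs =>
    rename_i s
    rw [Lp.simpleFunc.coe_indicatorConst]
    have h1 := hd.indicatorConstLp_subset_closure p c ⟨s, hs, hμs.ne, rfl⟩
    refine closure_minimal ?_ hV h1
    rintro _ ⟨t, ht, hμt, rfl⟩
    have hsmul : indicatorConstLp p (hd.measurable t ht) hμt c =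
        c • indicatorConstLp p (hd.measurable t ht) hμt (1 : 𝕜) := by
      ext1
      filter_upwards [indicatorConstLp_coeFn (p := p) (hs := hd.measurable t ht) (hμs := hμt)
        (c := c), indicatorConstLp_coeFn (p := p) (hs := hd.measurable t ht) (hμs := hμt)
        (c := (1 : 𝕜)), Lp.coeFn_smul c (indicatorConstLp p (hd.measurable t ht) hμt (1 : 𝕜))]
        with ω h1 h2 h3
      rw [h1, h3, Pi.smul_apply, h2]
      by_cases h : ω ∈ t <;> simp [h]
    rw [hsmul]
    exact V.smul_mem c (h t ht (hd.measurable t ht))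
  | add hf hg hd h1 h2 => exact V.add_mem h1 h2
  | isClosed => exact hV

variable {α : Type*} [MeasurableSpace α] {X : Type*} [NormedAddCommGroup X] [NormedSpace 𝕜 X]
  [CompleteSpace X]

/-- A cyclic subspace is isometric to the `L_p`-space of a finite measure on the Stone space. -/
theorem LpProjections.exists_linearIsometry_cyclic (hp : p ≠ ∞)
    (P : LpProjections 𝕜 p.toReal α X) (e : X) :
    ∃ (ν : Measure (StoneSpace α)) (Θ : Lp 𝕜 p ν →ₗᵢ[𝕜] X),
      LinearMap.range Θ.toLinearMap = P.cyclic e := by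
  have hq := toReal_pos_of_one_le p hp
  obtain ⟨ν, hν⟩ := exists_measure_stoneSet
    (fun s : Set α => ENNReal.ofReal (‖P.proj s e‖ ^ p.toReal)) (by simp [P.proj_empty, hq.ne'])
    (fun s t hs ht hst => by
      rw [← ENNReal.ofReal_add (by positivity) (by positivity),
        P.norm_proj_union_rpow hs ht hst])
  have : IsFiniteMeasure ν := ⟨by
    rw [← stoneSet_univ, hν _ .univ]; exact ENNReal.ofReal_lt_top⟩
  refine ⟨ν, ?_⟩
  let Q : LpProjections 𝕜 p.toReal α (Lp 𝕜 p ν) := (lpIndicatorProjections ν hp).comap stoneSet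
    (fun s hs => measurableSet_stoneSet hs) stoneSet_univ stoneSet_inter stoneSet_compl
  let e' : Lp 𝕜 p ν := indicatorConstLp p .univ (measure_ne_top ν _) 1
  have hQe : ∀ s (hs : MeasurableSet s), Q.proj s e' =
      indicatorConstLp p (measurableSet_stoneSet hs) (measure_ne_top ν _) 1 := by
    intro s hs
    refine (lpIndicator_indicatorConstLp ν (measurableSet_stoneSet hs) .univ _ (1 : 𝕜)).trans ?_
    congr 1
    exact Set.inter_univ _
  have hnorm : ∀ s, MeasurableSet s → ‖P.proj s e‖ = ‖Q.proj s e'‖ := by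
    intro s hs
    rw [hQe s hs, norm_indicatorConstLp (zero_lt_one.trans_le Fact.out).ne' hp, norm_one, one_mul,
      measureReal_def, hν s hs, ENNReal.toReal_ofReal (by positivity),
      ← Real.rpow_mul (norm_nonneg _), mul_one_div_cancel hq.ne', Real.rpow_one]
  let a := Finsupp.linearCombination 𝕜 (fun s : {s : Set α // MeasurableSet s} => P.proj s e)
  let b := Finsupp.linearCombination 𝕜 (fun s : {s : Set α // MeasurableSet s} => Q.proj s e')
  have hab : ∀ d, ‖a d‖ = ‖b d‖ := LpProjections.norm_linearCombination_eq hq Q hnorm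
  have hsingle : ∀ s (hs : MeasurableSet s), b (Finsupp.single ⟨s, hs⟩ 1) = Q.proj s e' := by
    intro s hs; simp [b]
  have hsingle' : ∀ s (hs : MeasurableSet s), a (Finsupp.single ⟨s, hs⟩ 1) = P.proj s e := by
    intro s hs; simp [a]
  have hdense : DenseRange b := by
    have := topologicalClosure_indicatorConstLp hp ν (isSetAlgebra_stoneAlgebra (α := α)) rfl
      (LinearMap.range b).topologicalClosure (Submodule.isClosed_topologicalClosure _) (by
        rintro _ ⟨s, hs, rfl⟩ hs'
        refine Submodule.le_topologicalClosure _ ⟨Finsupp.single ⟨s, hs⟩ 1, ?_⟩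
        rw [hsingle s hs, hQe s hs])
    have h2 := (Submodule.dense_iff_topologicalClosure_eq_top (s := LinearMap.range b)).2 this
    rwa [LinearMap.coe_range] at h2
  have hbound : ∃ C, ∀ d, ‖a d‖ ≤ C * ‖b d‖ := ⟨1, fun d => by rw [hab, one_mul]⟩
  have hext := LinearMap.extendOfNorm_eq hdense hbound
  let Θ : Lp 𝕜 p ν →ₗᵢ[𝕜] X :=
    { toLinearMap := (a.extendOfNorm b).toLinearMap
      norm_map' := fun x => by
        refine hdense.induction_on (p := fun x => ‖a.extendOfNorm b x‖ = ‖x‖) x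
          (isClosed_eq (by fun_prop) (by fun_prop)) fun d => ?_
        rw [hext, hab] }
  have hΘ : ∀ d, Θ (b d) = a d := hext
  refine ⟨Θ, le_antisymm ?_ ?_⟩
  · rintro _ ⟨x, rfl⟩
    refine hdense.induction_on (p := fun x => Θ x ∈ P.cyclic e) x
      ((P.isClosed_cyclic e).preimage Θ.continuous) fun d => ?_
    rw [hΘ]
    refine Submodule.le_topologicalClosure _ ?_
    have : a d ∈ LinearMap.range a := ⟨d, rfl⟩
    rw [Finsupp.range_linearCombination] at this
    refine Submodule.span_mono ?_ this
    rintro _ ⟨s, rfl⟩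
    exact ⟨s, s.2, rfl⟩
  · refine P.cyclic_le ?_ fun s hs => ⟨Q.proj s e', ?_⟩
    · exact Θ.isometry.isClosedEmbedding.isClosed_range
    · rw [← hsingle s hs, ← hsingle' s hs]
      exact hΘ _

end CyclicIso

/-! ### Disjoint unions of measure spaces -/

section SigmaMeasure

open MeasureTheory

variable {I : Type*} {Ω : Type*} [MeasurableSpace Ω]

/-- The disjoint union of a family of measures, on the disjoint union of copies of `Ω`. -/
noncomputable def sigmaMeasure (μ : I → Measure Ω) : Measure (Σ _ : I, Ω) :=
  Measure.sum fun i => (μ i).map (Sigma.mk i)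

theorem measurableSet_sigma_iff {s : Set (Σ _ : I, Ω)} :
    MeasurableSet s ↔ ∀ i, MeasurableSet (Sigma.mk i ⁻¹' s) :=
  MeasurableSpace.measurableSet_iInf

theorem measurable_sigma_mk (i : I) : Measurable fun ω : Ω => (⟨i, ω⟩ : Σ _ : I, Ω) :=
  fun _ hs => measurableSet_sigma_iff.1 hs i

theorem measurable_of_sigma {β : Type*} [MeasurableSpace β] {f : (Σ _ : I, Ω) → β}
    (h : ∀ i, Measurable fun ω => f ⟨i, ω⟩) : Measurable f :=
  fun _ hs => measurableSet_sigma_iff.2 fun i => h i hs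

theorem lintegral_sigmaMeasure (μ : I → Measure Ω) {f : (Σ _ : I, Ω) → ℝ≥0∞} (hf : Measurable f) :
    ∫⁻ x, f x ∂(sigmaMeasure μ) = ∑' i, ∫⁻ ω, f ⟨i, ω⟩ ∂(μ i) := by
  rw [sigmaMeasure, lintegral_sum_measure]
  exact tsum_congr fun i => lintegral_map hf (measurable_sigma_mk i)

theorem ae_eq_sigmaMeasure {𝕜 : Type*} [RCLike 𝕜] (μ : I → Measure Ω) {f g : (Σ _ : I, Ω) → 𝕜}
    (hf : Measurable f) (hg : Measurable g)
    (h : ∀ i, (fun ω => f ⟨i, ω⟩) =ᵐ[μ i] fun ω => g ⟨i, ω⟩) : f =ᵐ[sigmaMeasure μ] g := by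
  have hs : MeasurableSet {x | f x = g x}ᶜ := (measurableSet_eq_fun hf hg).compl
  rw [Filter.EventuallyEq, ae_iff]
  change sigmaMeasure μ {x | f x = g x}ᶜ = 0
  rw [sigmaMeasure, Measure.sum_apply _ hs, ENNReal.tsum_eq_zero]
  intro i
  rw [Measure.map_apply (measurable_sigma_mk i) hs]
  exact h i

variable {𝕜 : Type} [RCLike 𝕜] {p : ℝ≥0∞} (μ : I → Measure Ω)

/-- The function on the disjoint union that is given by a family of functions. -/
noncomputable def sigmaGlue (f : ∀ i, Lp 𝕜 p (μ i)) (x : Σ _ : I, Ω) : 𝕜 := f x.1 x.2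

theorem measurable_sigmaGlue (f : ∀ i, Lp 𝕜 p (μ i)) : Measurable (sigmaGlue μ f) :=
  measurable_of_sigma fun i => (Lp.stronglyMeasurable (f i)).measurable

variable [Fact (1 ≤ p)]

theorem lintegral_sigmaGlue (hp : p ≠ ∞) (f : lp (fun i => Lp 𝕜 p (μ i)) p) :
    ∫⁻ x, ‖sigmaGlue μ f x‖ₑ ^ p.toReal ∂(sigmaMeasure μ) =
      ENNReal.ofReal (‖f‖ ^ p.toReal) := by
  have hq := toReal_pos_of_one_le p hp
  rw [lintegral_sigmaMeasure μ ((measurable_sigmaGlue μ f).enorm.pow_const _),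
    lp.norm_rpow_eq_tsum hq, ENNReal.ofReal_tsum_of_nonneg (fun i => by positivity)
    ((lp.memℓp f).summable hq)]
  exact tsum_congr fun i => (Lp.norm_rpow_eq_lintegral (μ i) hp (f i)).symm

theorem memLp_of_lintegral_lt_top {𝕜 : Type*} [RCLike 𝕜] (hp : p ≠ ∞) {Ω : Type*}
    [MeasurableSpace Ω] {μ : Measure Ω} {f : Ω → 𝕜} (hf : Measurable f)
    (h : ∫⁻ x, ‖f x‖ₑ ^ p.toReal ∂μ < ∞) : MemLp f p μ := by
  refine ⟨hf.aestronglyMeasurable, ?_⟩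
  rwa [eLpNorm_lt_top_iff_lintegral_rpow_enorm_lt_top (zero_lt_one.trans_le Fact.out).ne' hp]

theorem memLp_sigmaGlue (hp : p ≠ ∞) (f : lp (fun i => Lp 𝕜 p (μ i)) p) :
    MemLp (sigmaGlue μ f) p (sigmaMeasure μ) :=
  memLp_of_lintegral_lt_top hp (measurable_sigmaGlue μ f) (by
    rw [lintegral_sigmaGlue μ hp f]; exact ENNReal.ofReal_lt_top)

/-- The `ℓ_p`-sum of a family of `L_p`-spaces, embedded into the `L_p`-space of the disjoint
union. -/
noncomputable def lpSumToSigma (hp : p ≠ ∞) :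
    lp (fun i => Lp 𝕜 p (μ i)) p →ₗᵢ[𝕜] Lp 𝕜 p (sigmaMeasure μ) where
  toFun f := (memLp_sigmaGlue μ hp f).toLp _
  map_add' f g := by
    rw [← MemLp.toLp_add]
    refine MemLp.toLp_congr _ _ (ae_eq_sigmaMeasure μ (measurable_sigmaGlue μ _)
      ((measurable_sigmaGlue μ _).add (measurable_sigmaGlue μ _)) fun i => ?_)
    exact Lp.coeFn_add (f i) (g i)
  map_smul' c f := by
    rw [RingHom.id_apply, ← MemLp.toLp_const_smul]
    refine MemLp.toLp_congr _ _ (ae_eq_sigmaMeasure μ (measurable_sigmaGlue μ _)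
      ((measurable_sigmaGlue μ _).const_smul c) fun i => ?_)
    exact Lp.coeFn_smul c (f i)
  norm_map' f := by
    have hq := toReal_pos_of_one_le p hp
    rw [← Real.rpow_left_inj (norm_nonneg _) (norm_nonneg _) hq.ne',
      ← ENNReal.ofReal_eq_ofReal_iff (by positivity) (by positivity),
      ← lintegral_sigmaGlue μ hp f, Lp.norm_rpow_eq_lintegral _ hp]
    refine lintegral_congr_ae ?_
    filter_upwards [MemLp.coeFn_toLp (memLp_sigmaGlue μ hp f)] with x hx
    exact congrArg (fun a : 𝕜 => ‖a‖ₑ ^ p.toReal) hx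

theorem lpSumToSigma_surjective (hp : p ≠ ∞) :
    Function.Surjective (lpSumToSigma (𝕜 := 𝕜) μ hp) := by
  have hq := toReal_pos_of_one_le p hp
  intro h
  have hm : Measurable h := (Lp.stronglyMeasurable h).measurable
  have hint : ∑' i, ∫⁻ ω, ‖h ⟨i, ω⟩‖ₑ ^ p.toReal ∂(μ i) = ENNReal.ofReal (‖h‖ ^ p.toReal) := by
    rw [Lp.norm_rpow_eq_lintegral _ hp, lintegral_sigmaMeasure μ (hm.enorm.pow_const _)]
  have hne : ∑' i, ∫⁻ ω, ‖h ⟨i, ω⟩‖ₑ ^ p.toReal ∂(μ i) ≠ ∞ := by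
    rw [hint]; exact ENNReal.ofReal_ne_top
  have hmem : ∀ i, MemLp (fun ω => h ⟨i, ω⟩) p (μ i) := fun i =>
    memLp_of_lintegral_lt_top hp (hm.comp (measurable_sigma_mk i))
      ((ENNReal.le_tsum i).trans_lt hne.lt_top)
  have hnorm : ∀ i, ENNReal.ofReal (‖(hmem i).toLp‖ ^ p.toReal) =
      ∫⁻ ω, ‖h ⟨i, ω⟩‖ₑ ^ p.toReal ∂(μ i) := by
    intro i
    rw [Lp.norm_rpow_eq_lintegral _ hp]
    refine lintegral_congr_ae ?_
    filter_upwards [MemLp.coeFn_toLp (hmem i)] with x hx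
    exact congrArg (fun a : 𝕜 => ‖a‖ₑ ^ p.toReal) hx
  let f : lp (fun i => Lp 𝕜 p (μ i)) p := ⟨fun i => (hmem i).toLp, memℓp_gen (by
    have := ENNReal.summable_toReal hne
    refine this.congr fun i => ?_
    rw [← hnorm, ENNReal.toReal_ofReal (by positivity)])⟩
  refine ⟨f, ?_⟩
  have : (memLp_sigmaGlue μ hp f).toLp _ = (Lp.memLp h).toLp _ :=
    MemLp.toLp_congr _ _ (ae_eq_sigmaMeasure μ (measurable_sigmaGlue μ _) hm fun i =>
      MemLp.coeFn_toLp (hmem i))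
  rw [Lp.toLp_coeFn] at this
  exact this

/-- The `ℓ_p`-sum of a family of `L_p`-spaces is the `L_p`-space of the disjoint union. -/
noncomputable def lpSumEquivSigma (hp : p ≠ ∞) :
    lp (fun i => Lp 𝕜 p (μ i)) p ≃ₗᵢ[𝕜] Lp 𝕜 p (sigmaMeasure μ) :=
  LinearIsometryEquiv.ofSurjective (lpSumToSigma μ hp) (lpSumToSigma_surjective μ hp)

end SigmaMeasure

/-! ### A representation theorem for `L_p`-spaces -/

section InternalSum

variable {𝕜 : Type} [RCLike 𝕜] {p : ℝ≥0∞} [Fact (1 ≤ p)] {X : Type*} [NormedAddCommGroup X]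
  [NormedSpace 𝕜 X] [CompleteSpace X] {I : Type*} {G : I → Type*}
  [∀ i, NormedAddCommGroup (G i)] [∀ i, NormedSpace 𝕜 (G i)]

/-- A `p`-additive family of isometric embeddings is summable on the `ℓ_p`-sum. -/
theorem summable_of_norm_sum_rpow (hp : p ≠ ∞) (Θ : ∀ i, G i →ₗᵢ[𝕜] X)
    (hΘ : ∀ (F : Finset I) (x : ∀ i, G i),
      ‖∑ i ∈ F, Θ i (x i)‖ ^ p.toReal = ∑ i ∈ F, ‖x i‖ ^ p.toReal)
    (f : lp G p) : Summable fun i => Θ i (f i) := by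
  have hq := toReal_pos_of_one_le p hp
  have hs := (lp.memℓp f).summable hq
  rw [summable_iff_vanishing_norm] at hs ⊢
  intro ε hε
  obtain ⟨F, hF⟩ := hs (ε ^ p.toReal) (by positivity)
  refine ⟨F, fun t ht => ?_⟩
  have := hF t ht
  rw [← Real.rpow_lt_rpow_iff (norm_nonneg _) hε.le hq, hΘ]
  exact (le_abs_self _).trans_lt this

/-- The isometric embedding of an `ℓ_p`-sum given by a `p`-additive family of isometric
embeddings of the summands. -/
noncomputable def lpInternalSum (hp : p ≠ ∞) (Θ : ∀ i, G i →ₗᵢ[𝕜] X)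
    (hΘ : ∀ (F : Finset I) (x : ∀ i, G i),
      ‖∑ i ∈ F, Θ i (x i)‖ ^ p.toReal = ∑ i ∈ F, ‖x i‖ ^ p.toReal) : lp G p →ₗᵢ[𝕜] X where
  toFun f := ∑' i, Θ i (f i)
  map_add' f g := by
    rw [← (summable_of_norm_sum_rpow hp Θ hΘ f).tsum_add (summable_of_norm_sum_rpow hp Θ hΘ g)]
    simp
  map_smul' c f := by
    rw [RingHom.id_apply, ← (summable_of_norm_sum_rpow hp Θ hΘ f).tsum_const_smul c]
    simp
  norm_map' f := by
    have hq := toReal_pos_of_one_le p hp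
    rw [← Real.rpow_left_inj (norm_nonneg _) (norm_nonneg _) hq.ne']
    have h1 := ((summable_of_norm_sum_rpow hp Θ hΘ f).hasSum.norm).rpow_const
      (p := p.toReal) (Or.inr hq.le)
    have h2 := lp.hasSum_norm hq f
    exact tendsto_nhds_unique (h1.congr fun F => hΘ F f) h2

end InternalSum

section Representation

open MeasureTheory

variable {𝕜 : Type} [RCLike 𝕜] {p : ℝ≥0∞} [Fact (1 ≤ p)] {α : Type*} [MeasurableSpace α]
  {X : Type*} [NormedAddCommGroup X] [NormedSpace 𝕜 X]

theorem LpProjections.exists_maximal_perp (q : ℝ) (P : LpProjections 𝕜 q α X) :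
    ∃ I : Set X, (∀ e ∈ I, ∀ f ∈ I, e ≠ f → P.Perp e f) ∧
      ∀ y, (∀ e ∈ I, P.Perp y e) → y = 0 := by
  obtain ⟨I, hI⟩ := zorn_subset {I : Set X | I.Pairwise P.Perp} (by
    intro c hc hchain
    refine ⟨⋃₀ c, ?_, fun s hs => Set.subset_sUnion_of_mem hs⟩
    exact (Set.pairwise_sUnion hchain.directedOn).2 fun s hs => hc hs)
  refine ⟨I, fun e he f hf hef => hI.1 he hf hef, fun y hy => ?_⟩
  have h1 : insert y I ∈ {I : Set X | I.Pairwise P.Perp} :=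
    Set.Pairwise.insert hI.1 fun e he _ => ⟨hy e he, (hy e he).symm⟩
  have h2 : y ∈ I := hI.2 h1 (Set.subset_insert y I) (Set.mem_insert y I)
  exact (hy y h2).eq_zero

theorem LpProjections.norm_sum_rpow_of_perp {q : ℝ} (hq : 0 < q) (P : LpProjections 𝕜 q α X)
    {I : Type*} (e : I → X) (he : ∀ i j, i ≠ j → P.Perp (e i) (e j)) (F : Finset I) (x : I → X)
    (hx : ∀ i, x i ∈ P.cyclic (e i)) : ‖∑ i ∈ F, x i‖ ^ q = ∑ i ∈ F, ‖x i‖ ^ q := by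
  classical
  induction F using Finset.induction_on with
  | empty => simp [hq.ne']
  | insert i F hi ih =>
    rw [Finset.sum_insert hi, Finset.sum_insert hi, ← ih]
    refine Perp.norm_add_rpow hq (Perp.of_mem_cyclic hq (Perp.symm ?_) (hx i))
    refine (P.perpSubmodule hq (e i)).sum_mem fun j hj => ?_
    refine Perp.of_mem_cyclic hq (he j i ?_) (hx j)
    rintro rfl
    exact hi hj

variable [CompleteSpace X]

/-- A Banach space with a Boolean algebra of `L_p`-projections is an `L_p`-space, provided that
any vector `x` lies in the cyclic subspace of any vector `e` up to projections that carry almost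
all of `e`. -/
theorem LpProjections.exists_linearIsometryEquiv_Lp (hp : p ≠ ∞)
    (P : LpProjections 𝕜 p.toReal α X)
    (h : ∀ e x : X, ∀ ε > 0, ∃ s, MeasurableSet s ∧ ‖P.proj sᶜ e‖ ≤ ε ∧ P.proj s x ∈ P.cyclic e) :
    ∃ (I : Set X) (ν : I → Measure (StoneSpace α)),
      Nonempty (X ≃ₗᵢ[𝕜] Lp 𝕜 p (sigmaMeasure ν)) := by
  classical
  have hq := toReal_pos_of_one_le p hp
  obtain ⟨I, hI, hmax⟩ := P.exists_maximal_perp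
  have hI' : ∀ i j : I, i ≠ j → P.Perp (i : X) j := fun i j hij =>
    hI i i.2 j j.2 fun h => hij (Subtype.ext h)
  choose ν Θ hΘ using fun e : I => P.exists_linearIsometry_cyclic hp (e : X)
  have hmem : ∀ (i : I) f, Θ i f ∈ P.cyclic (i : X) := fun i f => by
    rw [← hΘ]; exact ⟨f, rfl⟩
  have hadd : ∀ (F : Finset I) (x : ∀ i, Lp 𝕜 p (ν i)),
      ‖∑ i ∈ F, Θ i (x i)‖ ^ p.toReal = ∑ i ∈ F, ‖x i‖ ^ p.toReal := by
    intro F x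
    rw [P.norm_sum_rpow_of_perp hq (fun i : I => (i : X)) hI' F _ fun i => hmem i (x i)]
    simp
  let Ψ := lpInternalSum hp Θ hadd
  have hsurj : Function.Surjective Ψ := by
    intro x
    choose y hy hyp using fun i : I => P.exists_cyclic_add_perp hq (i : X) x (h i x)
    have hy' : ∀ i, ∃ f, Θ i f = y i := fun i => by
      have := hy i
      rw [← hΘ] at this
      exact this
    choose f hf using hy'
    -- The parts of `x` in the cyclic subspaces are `p`-summable.
    have hperp : ∀ (F : Finset I) (i : I), i ∈ F → P.Perp (x - ∑ j ∈ F, y j) i := by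
      intro F i hi
      rw [← Finset.add_sum_erase F y hi, ← sub_sub]
      refine (P.perpSubmodule hq (i : X)).sub_mem (hyp i)
        ((P.perpSubmodule hq (i : X)).sum_mem fun j hj => ?_)
      exact Perp.of_mem_cyclic hq (hI' j i (Finset.ne_of_mem_erase hj)) (hy j)
    have hle : ∀ F : Finset I, ∑ i ∈ F, ‖f i‖ ^ p.toReal ≤ ‖x‖ ^ p.toReal := by
      intro F
      rw [← hadd F f]
      simp only [hf]
      have hP : P.Perp (∑ j ∈ F, y j) (x - ∑ j ∈ F, y j) := by
        refine (P.perpSubmodule hq (x - ∑ j ∈ F, y j)).sum_mem fun j hj => ?_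
        exact Perp.of_mem_cyclic hq (hperp F j hj).symm (hy j)
      have := hP.norm_add_rpow hq
      rw [add_sub_cancel] at this
      rw [this]
      exact le_add_of_nonneg_right (by positivity)
    let g : lp (fun i => Lp 𝕜 p (ν i)) p := ⟨f, memℓp_gen' hle⟩
    refine ⟨g, ?_⟩
    have hsum : HasSum y (Ψ g) := by
      have := (summable_of_norm_sum_rpow hp Θ hadd g).hasSum
      exact this.congr_fun fun i => (hf i).symm
    refine (sub_eq_zero.1 (hmax (x - Ψ g) fun e he => ?_)).symm
    refine (isClosed_perpSubmodule (P := P) hq e).mem_of_tendsto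
      (tendsto_const_nhds.sub hsum) ?_
    filter_upwards [eventually_ge_atTop {(⟨e, he⟩ : I)}] with F hF
    exact hperp F ⟨e, he⟩ (Finset.singleton_subset_iff.1 hF)
  exact ⟨I, ν, ⟨(LinearIsometryEquiv.ofSurjective Ψ hsurj).symm.trans (lpSumEquivSigma ν hp)⟩⟩

end Representation

/-! ### Ultrapowers of `L_p`-spaces -/

section UltrapowerLp

open MeasureTheory

variable {𝕜 : Type} [RCLike 𝕜]

theorem exists_simpleFunc_norm_sub_le {α : Type*} [MeasurableSpace α] {m : α → 𝕜}
    (hm : Measurable m) {K : ℝ} (hK : ∀ a, ‖m a‖ ≤ K) {δ : ℝ} (hδ : 0 < δ) :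
    ∃ g : SimpleFunc α 𝕜, ∀ a, ‖m a - g a‖ ≤ δ := by
  have hc : IsCompact (Metric.closedBall (0 : 𝕜) K) := isCompact_closedBall 0 K
  obtain ⟨F, hF⟩ := hc.elim_finite_subcover (fun k : ℕ => Metric.ball (TopologicalSpace.denseSeq 𝕜 k) δ)
    (fun k => Metric.isOpen_ball) (fun x _ => by
      obtain ⟨k, hk⟩ := (TopologicalSpace.denseRange_denseSeq 𝕜).exists_dist_lt x hδ
      exact Set.mem_iUnion.2 ⟨k, hk⟩)
  refine ⟨(SimpleFunc.nearestPt (TopologicalSpace.denseSeq 𝕜) (F.sup id)).comp m hm, fun a => ?_⟩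
  have ha : m a ∈ Metric.closedBall (0 : 𝕜) K := by simpa using hK a
  obtain ⟨k, hk, hak⟩ := Set.mem_iUnion₂.1 (hF ha)
  have h1 := SimpleFunc.edist_nearestPt_le (TopologicalSpace.denseSeq 𝕜) (m a)
    (Finset.le_sup (f := id) hk)
  rw [edist_dist, edist_dist, ENNReal.ofReal_le_ofReal_iff dist_nonneg] at h1
  rw [← dist_eq_norm, dist_comm]
  refine h1.trans ?_
  rw [dist_comm]
  exact (Metric.mem_ball.1 hak).le

variable {p : ℝ≥0∞}

theorem norm_lpIndicator_le {Ω : Type*} [MeasurableSpace Ω] {μ : Measure Ω} (u v : Lp 𝕜 p μ)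
    {t : Set Ω} (ht : MeasurableSet t) {C : ℝ} (h : ∀ ω ∈ t, ‖v ω‖ ≤ C * ‖u ω‖) (hC : 0 ≤ C) :
    ‖lpIndicator 𝕜 p μ t v‖ ≤ C * ‖u‖ := by
  refine Lp.norm_le_mul_norm_of_ae_le_mul ?_
  filter_upwards [coeFn_lpIndicator μ ht v] with ω hω
  rw [hω]
  by_cases hωt : ω ∈ t
  · simpa [hωt] using h ω hωt
  · simp only [hωt, not_false_eq_true, Set.indicator_of_notMem, norm_zero]; positivity

theorem norm_lpIndicator_sub_sum_le {Ω : Type*} [MeasurableSpace Ω] {μ : Measure Ω}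
    (u v : Lp 𝕜 p μ) {t : Set Ω} (ht : MeasurableSet t) {g : Ω → 𝕜} (hg : Measurable g)
    {R : Finset 𝕜} (hR : ∀ ω, g ω ∈ R) {δ : ℝ}
    (h : ∀ ω, ‖t.indicator u ω - g ω * v ω‖ ≤ δ * ‖v ω‖) :
    ‖lpIndicator 𝕜 p μ t u - ∑ c ∈ R, c • lpIndicator 𝕜 p μ (g ⁻¹' {c}) v‖ ≤ δ * ‖v‖ := by
  refine Lp.norm_le_mul_norm_of_ae_le_mul ?_
  have hae : ∀ᵐ ω ∂μ, ∀ c ∈ R, (c • lpIndicator 𝕜 p μ (g ⁻¹' {c}) v : Lp 𝕜 p μ) ω =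
      c * (g ⁻¹' {c}).indicator v ω := by
    rw [Filter.eventually_all_finset]
    intro c _
    filter_upwards [coeFn_lpIndicator μ (hg (measurableSet_singleton c)) v,
      Lp.coeFn_smul c (lpIndicator 𝕜 p μ (g ⁻¹' {c}) v)] with ω h1 h2
    rw [h2, Pi.smul_apply, h1, smul_eq_mul]
  filter_upwards [coeFn_lpIndicator μ ht u, hae, Lp.coeFn_sub (lpIndicator 𝕜 p μ t u)
    (∑ c ∈ R, c • lpIndicator 𝕜 p μ (g ⁻¹' {c}) v),
    Lp.coeFn_finsetSum R fun c => c • lpIndicator 𝕜 p μ (g ⁻¹' {c}) v] with ω h1 h2 h3 h4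
  rw [h3, Pi.sub_apply, h1, h4, Finset.sum_apply, Finset.sum_congr rfl h2]
  rw [Finset.sum_eq_single (g ω)]
  · rw [Set.indicator_of_mem (show ω ∈ g ⁻¹' {g ω} from rfl)]
    exact h ω
  · intro c _ hc
    rw [Set.indicator_of_notMem (by simpa using hc.symm), mul_zero]
  · intro hn
    exact absurd (hR ω) hn

variable [Fact (1 ≤ p)]

section UltraProjections

variable {E : Type w} [NormedAddCommGroup E] [NormedSpace 𝕜 E] (U : Ultrafilter ℕ) {q : ℝ}
  {α : Type*} [MeasurableSpace α]

open Classical in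
/-- The projections of the ultrapower induced by a sequence of families of projections. -/
noncomputable def ultraProjections (hq : 0 < q) (P : ℕ → LpProjections 𝕜 q α E) :
    LpProjections 𝕜 q α (Ultrapower 𝕜 U E) where
  proj s := if hs : MeasurableSet s then
    ultraMap U (fun n => (P n).proj s) (fun n x => (P n).norm_proj_le hq hs x) else 0
  proj_univ x := by
    obtain ⟨ξ, rfl⟩ := ultraMk_surjective U x
    rw [dif_pos .univ, ultraMap_mk]
    exact ultraMk_eq_of_eventually U (Eventually.of_forall fun n => (P n).proj_univ _)
  proj_inter s t hs ht x := by
    obtain ⟨ξ, rfl⟩ := ultraMk_surjective U x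
    rw [dif_pos (hs.inter ht), dif_pos hs, dif_pos ht, ultraMap_mk, ultraMap_mk, ultraMap_mk]
    exact ultraMk_eq_of_eventually U
      (Eventually.of_forall fun n => (P n).proj_inter s t hs ht _)
  proj_add_compl s hs x := by
    obtain ⟨ξ, rfl⟩ := ultraMk_surjective U x
    rw [dif_pos hs, dif_pos hs.compl, ultraMap_mk, ultraMap_mk, ← ultraMk_add]
    exact ultraMk_eq_of_eventually U
      (Eventually.of_forall fun n => (P n).proj_add_compl s hs _)
  norm_rpow s hs x := by
    obtain ⟨ξ, rfl⟩ := ultraMk_surjective U x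
    rw [dif_pos hs, dif_pos hs.compl, ultraMap_mk, ultraMap_mk]
    refine tendsto_nhds_unique
      (((tendsto_norm_ultraMk U _).rpow_const (Or.inr hq.le)).add
        ((tendsto_norm_ultraMk U _).rpow_const (Or.inr hq.le)))
      (((tendsto_norm_ultraMk U ξ).rpow_const (Or.inr hq.le)).congr fun n => ?_)
    exact ((P n).norm_rpow s hs (ξ n)).symm

theorem ultraProjections_mk (hq : 0 < q) (P : ℕ → LpProjections 𝕜 q α E) {s : Set α}
    (hs : MeasurableSet s) (ξ : lp (fun _ : ℕ => E) ∞) :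
    (ultraProjections U hq P).proj s (ultraMk 𝕜 U ξ) =
      ultraMk 𝕜 U (boundedSeq (fun n => (P n).proj s (ξ n))
        ⟨‖ξ‖, fun n => ((P n).norm_proj_le hq hs _).trans (norm_apply_le_linf ξ n)⟩) := by
  simp only [ultraProjections]
  rw [dif_pos hs, ultraMap_mk]

end UltraProjections

theorem norm_ultraMk_le {E : Type w} [NormedAddCommGroup E] [NormedSpace 𝕜 E] (U : Ultrafilter ℕ)
    {ξ : lp (fun _ : ℕ => E) ∞} {C : ℝ} (h : ∀ n, ‖ξ n‖ ≤ C) : ‖ultraMk 𝕜 U ξ‖ ≤ C :=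
  le_of_tendsto (tendsto_norm_ultraMk U ξ) (Eventually.of_forall h)

theorem sum_smul_ultraMk {E : Type w} [NormedAddCommGroup E] [NormedSpace 𝕜 E]
    (U : Ultrafilter ℕ) (R : Finset 𝕜) (ζ : 𝕜 → lp (fun _ : ℕ => E) ∞) :
    ∑ c ∈ R, c • ultraMk 𝕜 U (ζ c) = ultraMk 𝕜 U (∑ c ∈ R, c • ζ c) := by
  change ∑ c ∈ R, c • (ultraNull 𝕜 U E).mkQ (ζ c) = (ultraNull 𝕜 U E).mkQ (∑ c ∈ R, c • ζ c)
  rw [map_sum]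
  rfl

/-- An ultrapower of an `L_p`-space is an `L_p`-space. -/
theorem exists_ultrapower_linearIsometryEquiv_Lp (hp : p ≠ ∞) {E : Type w}
    [NormedAddCommGroup E] [NormedSpace 𝕜 E] [CompleteSpace E] (U : Ultrafilter ℕ) {Ω : Type w}
    [MeasurableSpace Ω] (μ : Measure Ω) (θ : E ≃ₗᵢ[𝕜] Lp 𝕜 p μ) :
    ∃ (I : Set (Ultrapower 𝕜 U E)) (ν : I → Measure (StoneSpace (ℕ × Ω))),
      Nonempty (Ultrapower 𝕜 U E ≃ₗᵢ[𝕜] Lp 𝕜 p (sigmaMeasure ν)) := by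
  have hq := toReal_pos_of_one_le p hp
  let P : ℕ → LpProjections 𝕜 p.toReal (ℕ × Ω) E := fun n =>
    ((lpIndicatorProjections μ hp).comap (fun s => Prod.mk n ⁻¹' s)
      (fun s hs => measurable_prodMk_left hs) rfl (fun _ _ => rfl) fun _ => rfl).congr θ
  have hP : ∀ n s x, θ ((P n).proj s x) = lpIndicator 𝕜 p μ (Prod.mk n ⁻¹' s) (θ x) :=
    fun n s x => θ.apply_symm_apply _
  refine (ultraProjections U hq P).exists_linearIsometryEquiv_Lp hp fun e x ε hε => ?_
  obtain ⟨η, rfl⟩ := ultraMk_surjective U e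
  obtain ⟨ξ, rfl⟩ := ultraMk_surjective U x
  -- The projection is onto the set where `|x| ≤ K |e|`; there `x / e` is bounded, and it is a
  -- uniform limit of simple functions.
  let K : ℝ := ‖ξ‖ / ε + 1
  have hK : 0 < K := by positivity
  let u : ℕ × Ω → 𝕜 := fun z => θ (ξ z.1) z.2
  let v : ℕ × Ω → 𝕜 := fun z => θ (η z.1) z.2
  have hu : Measurable u := measurable_from_prod_countable_right fun n =>
    (Lp.stronglyMeasurable (θ (ξ n))).measurable
  have hv : Measurable v := measurable_from_prod_countable_right fun n =>
    (Lp.stronglyMeasurable (θ (η n))).measurable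
  let s : Set (ℕ × Ω) := {z | ‖u z‖ ≤ K * ‖v z‖}
  have hs : MeasurableSet s := measurableSet_le hu.norm (hv.norm.const_mul K)
  refine ⟨s, hs, ?_, ?_⟩
  · rw [ultraProjections_mk U hq P hs.compl]
    refine norm_ultraMk_le U fun n => ?_
    rw [boundedSeq_apply, ← θ.norm_map, hP]
    refine (norm_lpIndicator_le (θ (ξ n)) (θ (η n)) (C := K⁻¹) (measurable_prodMk_left hs.compl)
      (fun ω hω => ?_) (by positivity)).trans ?_
    · have : ¬ ‖θ (ξ n) ω‖ ≤ K * ‖θ (η n) ω‖ := hω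
      rw [inv_mul_eq_div, le_div_iff₀' hK]
      exact (not_le.1 this).le
    · rw [θ.norm_map, inv_mul_eq_div, div_le_iff₀ hK]
      refine (norm_apply_le_linf ξ n).trans ?_
      have : ε * K = ‖ξ‖ + ε := by simp only [K]; field_simp
      linarith
  · have hclosed := (ultraProjections U hq P).isClosed_cyclic (ultraMk 𝕜 U η)
    rw [← SetLike.mem_coe, ← hclosed.closure_eq, Metric.mem_closure_iff]
    intro δ hδ
    let m : ℕ × Ω → 𝕜 := s.indicator fun z => u z / v z
    have hm : Measurable m := (hu.div hv).indicator hs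
    have hmK : ∀ z, ‖m z‖ ≤ K := by
      intro z
      by_cases hz : z ∈ s
      · simp only [m, Set.indicator_of_mem hz, norm_div]
        exact div_le_of_le_mul₀ (norm_nonneg _) hK.le hz
      · simp only [m, Set.indicator_of_notMem hz, norm_zero, hK.le]
    have hmv : ∀ z, s.indicator u z = m z * v z := by
      intro z
      by_cases hz : z ∈ s
      · simp only [m, Set.indicator_of_mem hz]
        by_cases h0 : v z = 0
        · have h1 : ‖u z‖ ≤ K * ‖v z‖ := hz
          rw [h0, norm_zero, mul_zero] at h1
          rw [norm_le_zero_iff.1 h1, zero_div, zero_mul]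
        · rw [div_mul_cancel₀ _ h0]
      · simp only [m, Set.indicator_of_notMem hz, zero_mul]
    have hδ' : 0 < δ / (2 * (‖η‖ + 1)) := by positivity
    obtain ⟨g, hg⟩ := exists_simpleFunc_norm_sub_le hm hmK hδ'
    have hpre : ∀ c, MeasurableSet (g ⁻¹' {c}) := fun c => g.measurableSet_preimage {c}
    refine ⟨∑ c ∈ g.range, c • (ultraProjections U hq P).proj (g ⁻¹' {c}) (ultraMk 𝕜 U η),
      Submodule.sum_mem _ fun c _ => Submodule.smul_mem _ c
        ((ultraProjections U hq P).proj_mem_cyclic _ (hpre c)), ?_⟩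
    rw [dist_eq_norm]
    let ζ : 𝕜 → lp (fun _ : ℕ => E) ∞ := fun c => boundedSeq (fun n => (P n).proj (g ⁻¹' {c}) (η n))
      ⟨‖η‖, fun n => ((P n).norm_proj_le hq (hpre c) _).trans (norm_apply_le_linf η n)⟩
    have hζ : ∀ c n, ζ c n = (P n).proj (g ⁻¹' {c}) (η n) := fun c n => rfl
    have hsum : ∑ c ∈ g.range, c • (ultraProjections U hq P).proj (g ⁻¹' {c}) (ultraMk 𝕜 U η) =
        ultraMk 𝕜 U (∑ c ∈ g.range, c • ζ c) := by
      rw [← sum_smul_ultraMk]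
      exact Finset.sum_congr rfl fun c _ => by rw [ultraProjections_mk U hq P (hpre c)]
    rw [hsum, ultraProjections_mk U hq P hs, ← ultraMk_sub]
    refine (norm_ultraMk_le (𝕜 := 𝕜) U (C := δ / 2) fun n => ?_).trans_lt (half_lt_self hδ)
    have hbound := norm_lpIndicator_sub_sum_le (θ (ξ n)) (θ (η n))
      (measurable_prodMk_left (x := n) hs) (g := fun ω => g (n, ω))
      (g.measurable.comp measurable_prodMk_left) (fun ω => g.mem_range_self _)
      (δ := δ / (2 * (‖η‖ + 1))) (fun ω => by
        have h1 : (Prod.mk n ⁻¹' s).indicator (θ (ξ n)) ω = s.indicator u (n, ω) := rfl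
        rw [h1, hmv, ← sub_mul, norm_mul]
        exact mul_le_mul_of_nonneg_right (hg (n, ω)) (norm_nonneg _))
    rw [lp.coeFn_sub, lp.coeFn_sum, Pi.sub_apply, Finset.sum_apply, ← θ.norm_map, map_sub, map_sum]
    simp only [lp.coeFn_smul, Pi.smul_apply, boundedSeq_apply, map_smul, hζ, hP]
    refine hbound.trans ?_
    rw [θ.norm_map]
    have h2 : ‖η n‖ ≤ ‖η‖ + 1 := (norm_apply_le_linf η n).trans (by linarith)
    calc δ / (2 * (‖η‖ + 1)) * ‖η n‖ ≤ δ / (2 * (‖η‖ + 1)) * (‖η‖ + 1) := by gcongr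
      _ = δ / 2 := by field_simp

end UltrapowerLp

/-! ### The closure properties of the classes -/

section Classes

open MeasureTheory

variable {𝕜 : Type} [RCLike 𝕜] {p : ℝ≥0∞} [Fact (1 ≤ p)]

/-- The closure properties of a class of Banach spaces on which the equivalence depends: they are
shared by the stable classes and by the class of `L_p`-spaces. -/
structure HasLpSumsAndUltrapowers (p : ℝ≥0∞) [Fact (1 ≤ p)] (B : BanachClass.{w} 𝕜) : Prop where
  exists_nontrivial : ∃ (E : Type w) (_ : NormedAddCommGroup E) (_ : NormedSpace 𝕜 E)
    (_ : CompleteSpace E), B E ∧ Nontrivial E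
  lpSum : ∀ (E : Type w) [NormedAddCommGroup E] [NormedSpace 𝕜 E] [CompleteSpace E]
    (J : Type) [Countable J], B E → B (lp (fun _ : J => E) p)
  ultra : ∀ (E : Type w) [NormedAddCommGroup E] [NormedSpace 𝕜 E] [CompleteSpace E]
    (U : Ultrafilter ℕ), (U : Filter ℕ) ≤ cofinite → B E → B (Ultrapower 𝕜 U E)

theorem ae_eq_count_iff {J : Type*} [MeasurableSpace J] [MeasurableSingletonClass J]
    {F : Type*} {f g : J → F} : f =ᵐ[Measure.count] g ↔ f = g := by
  rw [Filter.EventuallyEq, Measure.ae_count_iff, funext_iff]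

theorem Lp.norm_rpow_count (hp : p ≠ ∞) {E : Type*} [NormedAddCommGroup E] {J : Type*}
    [MeasurableSpace J] [MeasurableSingletonClass J] (f : Lp E p (Measure.count : Measure J)) :
    ENNReal.ofReal (‖f‖ ^ p.toReal) = ∑' j, ENNReal.ofReal (‖f j‖ ^ p.toReal) := by
  have hq := toReal_pos_of_one_le p hp
  rw [Lp.norm_rpow_eq_lintegral _ hp, lintegral_count]
  refine tsum_congr fun j => ?_
  rw [← ofReal_norm, ENNReal.ofReal_rpow_of_nonneg (norm_nonneg _) hq.le]

theorem Lp.memℓp_count (hp : p ≠ ∞) {E : Type*} [NormedAddCommGroup E] {J : Type*}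
    [MeasurableSpace J] [MeasurableSingletonClass J] (f : Lp E p (Measure.count : Measure J)) :
    Memℓp f p := by
  refine memℓp_gen ?_
  have h : ∑' j, ENNReal.ofReal (‖f j‖ ^ p.toReal) ≠ ∞ := by
    rw [← Lp.norm_rpow_count hp f]; exact ENNReal.ofReal_ne_top
  exact (ENNReal.summable_toReal h).congr fun j => ENNReal.toReal_ofReal (by positivity)

variable (𝕜) in
/-- The `L_p`-space of the counting measure of a countable set is the `ℓ_p`-sum. -/
noncomputable def lpCountEquiv (hp : p ≠ ∞) (E : Type*) [NormedAddCommGroup E] [NormedSpace 𝕜 E]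
    (J : Type*) [MeasurableSpace J] [MeasurableSingletonClass J] [Countable J] :
    Lp E p (Measure.count : Measure J) ≃ₗᵢ[𝕜] lp (fun _ : J => E) p :=
  LinearIsometryEquiv.ofSurjective
    { toFun := fun f => ⟨fun j => f j, Lp.memℓp_count hp f⟩
      map_add' := fun f g => Subtype.ext (ae_eq_count_iff.1 (Lp.coeFn_add f g))
      map_smul' := fun c f => Subtype.ext (ae_eq_count_iff.1 (Lp.coeFn_smul c f))
      norm_map' := fun f => by
        have hq := toReal_pos_of_one_le p hp
        have h1 := lp.norm_rpow_eq_tsum hq (⟨fun j => f j, Lp.memℓp_count hp f⟩ :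
          lp (fun _ : J => E) p)
        refine (Real.rpow_left_inj (norm_nonneg _) (norm_nonneg _) hq.ne').1 (h1.trans ?_)
        rw [← ENNReal.ofReal_eq_ofReal_iff (tsum_nonneg fun j => by positivity) (by positivity),
          Lp.norm_rpow_count hp f]
        exact ENNReal.ofReal_tsum_of_nonneg (fun j => by positivity)
          ((Lp.memℓp_count hp f).summable hq) }
    (fun f => by
      have hq := toReal_pos_of_one_le p hp
      have hmeas : AEStronglyMeasurable (fun j => f j) (Measure.count : Measure J) :=
        StronglyMeasurable.of_discrete.aestronglyMeasurable
      have hmem : MemLp (fun j => f j) p (Measure.count : Measure J) := by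
        refine ⟨hmeas, ?_⟩
        rw [eLpNorm_lt_top_iff_lintegral_rpow_enorm_lt_top (zero_lt_one.trans_le Fact.out).ne' hp,
          lintegral_count]
        have h1 : ∀ j, ‖f j‖ₑ ^ p.toReal = ENNReal.ofReal (‖f j‖ ^ p.toReal) := fun j => by
          rw [← ofReal_norm, ENNReal.ofReal_rpow_of_nonneg (norm_nonneg _) hq.le]
        simp only [h1]
        rw [← ENNReal.ofReal_tsum_of_nonneg (fun j => by positivity) ((lp.memℓp f).summable hq)]
        exact ENNReal.ofReal_lt_top
      exact ⟨hmem.toLp, Subtype.ext (ae_eq_count_iff.1 (MemLp.coeFn_toLp hmem))⟩)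

theorem IsStableClass.hasLpSumsAndUltrapowers (hp : p ≠ ∞) {B : BanachClass.{w} 𝕜}
    (hB : IsStableClass p B) : HasLpSumsAndUltrapowers p B where
  exists_nontrivial := hB.exists_nontrivial
  lpSum E _ _ _ J _ hE := by
    let _ : MeasurableSpace J := ⊤
    exact hB.congr _ _ (lpCountEquiv 𝕜 hp E J) (hB.bochner E J Measure.count hE)
  ultra E _ _ _ U hU hE := hB.ultra E U hU hE

/-- A linear isometry of the summands induces one of the `ℓ_p`-sums. -/
noncomputable def lpCongr (hp : p ≠ ∞) {E F : Type*} [NormedAddCommGroup E] [NormedSpace 𝕜 E]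
    [NormedAddCommGroup F] [NormedSpace 𝕜 F] (J : Type*) (e : E ≃ₗᵢ[𝕜] F) :
    lp (fun _ : J => E) p ≃ₗᵢ[𝕜] lp (fun _ : J => F) p where
  toFun ξ := ⟨fun j => e (ξ j), memℓp_gen (by
    simpa using (lp.memℓp ξ).summable (toReal_pos_of_one_le p hp))⟩
  map_add' ξ η := by ext j; simp; rfl
  map_smul' c ξ := by ext j; simp
  invFun ξ := ⟨fun j => e.symm (ξ j), memℓp_gen (by
    simpa using (lp.memℓp ξ).summable (toReal_pos_of_one_le p hp))⟩
  left_inv ξ := by ext j; simp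
  right_inv ξ := by ext j; simp
  norm_map' ξ := by
    have hq := toReal_pos_of_one_le p hp
    rw [← Real.rpow_left_inj (norm_nonneg _) (norm_nonneg _) hq.ne', lp.norm_rpow_eq_tsum hq,
      lp.norm_rpow_eq_tsum hq]
    simp

theorem LpClass.hasLpSumsAndUltrapowers (hp : p ≠ ∞) :
    HasLpSumsAndUltrapowers p (LpClass.{w} 𝕜 p) where
  exists_nontrivial := by
    let _ : MeasurableSpace PUnit.{w + 1} := ⊤
    refine ⟨Lp 𝕜 p (Measure.dirac PUnit.unit.{w + 1}), inferInstance, inferInstance,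
      inferInstance, ⟨PUnit, inferInstance, _, ⟨LinearIsometryEquiv.refl 𝕜 _⟩⟩, ?_⟩
    refine ⟨indicatorConstLp p .univ (measure_ne_top _ _) 1, 0, fun h => ?_⟩
    have := congrArg norm h
    rw [norm_indicatorConstLp (zero_lt_one.trans_le Fact.out).ne' hp] at this
    simp at this
  lpSum := by
    rintro E _ _ _ J _ ⟨Ω, _, μ, ⟨e⟩⟩
    exact ⟨Σ _ : J, Ω, inferInstance, sigmaMeasure fun _ => μ,
      ⟨(lpCongr hp J e).trans (lpSumEquivSigma (fun _ : J => μ) hp)⟩⟩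
  ultra := by
    rintro E _ _ _ U - ⟨Ω, _, μ, ⟨e⟩⟩
    obtain ⟨I, ν, h⟩ := exists_ultrapower_linearIsometryEquiv_Lp hp U μ e
    exact ⟨_, _, _, h⟩

end Classes

/-! ### Word lengths -/

section WordLength

variable {Γ : Type u} [Group Γ] {S : Set Γ}

theorem wordLength_le_of_list (l : List Γ) (hl : ∀ s ∈ l, s ∈ S ∨ s⁻¹ ∈ S) :
    wordLength S l.prod ≤ l.length := Nat.sInf_le ⟨l, rfl, hl, rfl⟩

theorem exists_list_of_closure_eq_top (hS : Subgroup.closure S = ⊤) (g : Γ) :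
    ∃ l : List Γ, l.length = wordLength S g ∧ (∀ s ∈ l, s ∈ S ∨ s⁻¹ ∈ S) ∧ l.prod = g := by
  have hmem : g ∈ (Subgroup.closure S).toSubmonoid := by rw [hS]; trivial
  rw [Subgroup.closure_toSubmonoid] at hmem
  obtain ⟨l, hl, hp⟩ := Submonoid.exists_list_of_mem_closure hmem
  simp only [Set.mem_union, Set.mem_inv] at hl
  exact Nat.sInf_mem (s := {n | ∃ l : List Γ, l.length = n ∧ (∀ s ∈ l, s ∈ S ∨ s⁻¹ ∈ S) ∧
    l.prod = g}) ⟨_, l, rfl, hl, hp⟩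

theorem wordLength_mul_le (hS : Subgroup.closure S = ⊤) (g h : Γ) :
    wordLength S (g * h) ≤ wordLength S g + wordLength S h := by
  obtain ⟨l, hl, hlS, rfl⟩ := exists_list_of_closure_eq_top hS g
  obtain ⟨m, hm, hmS, rfl⟩ := exists_list_of_closure_eq_top hS h
  rw [← hl, ← hm, ← List.length_append, ← List.prod_append]
  exact wordLength_le_of_list _ fun s hs => (List.mem_append.1 hs).elim (hlS s) (hmS s)

theorem finite_wordLength_le (hfin : S.Finite) (hS : Subgroup.closure S = ⊤) (R : ℕ) :
    {g | wordLength S g ≤ R}.Finite := by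
  have hA : {s | s ∈ S ∨ s⁻¹ ∈ S}.Finite :=
    hfin.union (hfin.preimage inv_injective.injOn)
  induction R with
  | zero =>
    refine (Set.finite_singleton (1 : Γ)).subset fun g hg => ?_
    exact eq_one_of_wordLength_eq_zero hS (Nat.le_zero.1 hg)
  | succ R ih =>
    refine ((hA.mul ih).union (Set.finite_singleton (1 : Γ))).subset fun g hg => ?_
    obtain ⟨l, hl, hlS, rfl⟩ := exists_list_of_closure_eq_top hS g
    cases l with
    | nil => right; rfl
    | cons s l =>
      left
      rw [List.prod_cons]
      refine Set.mul_mem_mul (hlS s (by simp)) ?_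
      have h1 : (s :: l).length ≤ R + 1 := hl.le.trans hg
      have h2 := wordLength_le_of_list l fun a ha => hlS a (List.mem_cons_of_mem s ha)
      exact h2.trans (by simpa using h1)

theorem wordLength_map_le (hS : Subgroup.closure S = ⊤) (M : Subgroup Γ) [M.Normal] (g : Γ) :
    wordLength ((fun s : Γ => (s : Γ ⧸ M)) '' S) (g : Γ ⧸ M) ≤ wordLength S g := by
  obtain ⟨l, hl, hlS, rfl⟩ := exists_list_of_closure_eq_top hS g
  have h := wordLength_le_of_list (S := (fun s : Γ => (s : Γ ⧸ M)) '' S)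
    (l.map (QuotientGroup.mk' M)) (by
      intro s hs
      obtain ⟨a, ha, rfl⟩ := List.mem_map.1 hs
      exact (hlS a ha).imp (fun h => ⟨a, h, rfl⟩) fun h => ⟨a⁻¹, h, rfl⟩)
  rw [← map_list_prod, List.length_map, hl] at h
  exact h

theorem closure_image_mk_eq_top (hS : Subgroup.closure S = ⊤) (M : Subgroup Γ) [M.Normal] :
    Subgroup.closure ((fun s : Γ => (s : Γ ⧸ M)) '' S) = ⊤ := by
  have h := MonoidHom.map_closure (QuotientGroup.mk' M) S
  rw [hS, Subgroup.map_top_of_surjective _ (QuotientGroup.mk'_surjective M)] at h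
  exact h.symm

theorem exists_lift_wordLength_le (hS : Subgroup.closure S = ⊤) (M : Subgroup Γ) [M.Normal]
    (x : Γ ⧸ M) : ∃ g : Γ, (g : Γ ⧸ M) = x ∧
      wordLength S g ≤ wordLength ((fun s : Γ => (s : Γ ⧸ M)) '' S) x := by
  obtain ⟨l, hl, hlS, rfl⟩ := exists_list_of_closure_eq_top (closure_image_mk_eq_top hS M) x
  rw [← hl]
  clear hl
  induction l with
  | nil => exact ⟨1, rfl, by simp [wordLength_one]⟩
  | cons a l ih =>
    obtain ⟨g, hg, hgl⟩ := ih fun s hs => hlS s (List.mem_cons_of_mem a hs)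
    have ha : ∃ s : Γ, (s : Γ ⧸ M) = a ∧ (s ∈ S ∨ s⁻¹ ∈ S) := by
      rcases hlS a (by simp) with ⟨s, hs, rfl⟩ | ⟨s, hs, h⟩
      · exact ⟨s, rfl, Or.inl hs⟩
      · refine ⟨s⁻¹, ?_, Or.inr (by simpa using hs)⟩
        rw [QuotientGroup.mk_inv]
        exact inv_eq_iff_eq_inv.2 h
    obtain ⟨s, hsa, hs⟩ := ha
    refine ⟨s * g, by rw [List.prod_cons, QuotientGroup.mk_mul, hsa, hg], ?_⟩
    have h1 := wordLength_mul_le hS s g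
    have h2 := wordLength_le_of_list (S := S) [s] (by simpa using hs)
    rw [List.prod_singleton, List.length_singleton] at h2
    rw [List.length_cons]
    omega

/-- The word length is unchanged in a quotient by a subgroup without short elements. -/
theorem wordLength_mk_eq (hS : Subgroup.closure S = ⊤) (M : Subgroup Γ) [M.Normal] {g : Γ} {R : ℕ}
    (hg : 2 * wordLength S g ≤ R) (hM : ∀ h ∈ M, wordLength S h ≤ R → h = 1) :
    wordLength ((fun s : Γ => (s : Γ ⧸ M)) '' S) (g : Γ ⧸ M) = wordLength S g := by
  refine le_antisymm (wordLength_map_le hS M g) ?_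
  obtain ⟨g', hg', hle⟩ := exists_lift_wordLength_le hS M (g : Γ ⧸ M)
  have h1 := wordLength_map_le hS M g
  have h2 : g⁻¹ * g' = 1 := by
    refine hM _ (QuotientGroup.eq.1 hg'.symm) ((wordLength_mul_le hS _ _).trans ?_)
    rw [wordLength_inv]
    omega
  rw [inv_mul_eq_one.1 h2]
  rwa [← inv_mul_eq_one.1 h2] at hle ⊢

end WordLength

/-! ### The warped cone -/

section Cone

variable {Γ : Type u} [Group Γ] {M : Type u} [TopologicalSpace M] [MulAction Γ M]
  {H : Type v} [NormedAddCommGroup H] [InnerProductSpace ℂ H] (L : UnitaryLinearization Γ M H)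
  {S : Set Γ} (hS : Subgroup.closure S = ⊤)

/-- The vector of `H` underlying a point of the warped cone. -/
def coneVec {L : UnitaryLinearization Γ M H} {hS : Subgroup.closure S = ⊤}
    (x : WarpedCone L hS) : H :=
  (show L.openCone from x).1

variable {L hS}

theorem coneVec_mem (x : WarpedCone L hS) : coneVec x ∈ L.openCone :=
  (show L.openCone from x).2

theorem rep_mul_apply (γ γ' : Γ) (h : H) : L.rep (γ * γ') h = L.rep γ (L.rep γ' h) := by
  rw [map_mul]; rfl

theorem rep_one_apply (h : H) : L.rep 1 h = h := by
  rw [map_one]; rfl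

theorem dist_cone_le (x y : WarpedCone L hS) (γ : Γ) :
    dist x y ≤ wordLength S γ + ‖L.rep γ (coneVec x) - coneVec y‖ := by
  have h := csInf_le (warpChain_bddBelow (S := S) (show L.openCone from x) y)
    (WarpChain.step γ (WarpChain.refl (show L.openCone from y)))
  refine h.trans (le_of_eq ?_)
  rw [add_zero, add_comm, Subtype.dist_eq, dist_eq_norm]
  rfl

theorem exists_wordLength_add_norm_lt {x y : WarpedCone L hS} {R : ℝ} (h : dist x y < R) :
    ∃ γ : Γ, wordLength S γ + ‖L.rep γ (coneVec x) - coneVec y‖ < R := by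
  obtain ⟨c, hc, hcR⟩ := exists_lt_of_csInf_lt
    (warpChain_nonempty (S := S) (show L.openCone from x) y) h
  have key : ∀ {x y : L.openCone} {c : ℝ}, WarpChain S x y c →
      ∃ γ : Γ, wordLength S γ + ‖L.rep γ x.1 - y.1‖ ≤ c := by
    intro x y c hc
    induction hc with
    | refl x => exact ⟨1, by simp [wordLength_one]⟩
    | @step x y z c γ h ih =>
      obtain ⟨γ', hγ'⟩ := ih
      refine ⟨γ' * γ, ?_⟩
      have h1 : dist (γ • x) y = ‖L.rep γ x.1 - y.1‖ := by
        rw [Subtype.dist_eq, dist_eq_norm]; rfl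
      have h2 : ((wordLength S (γ' * γ) : ℕ) : ℝ) ≤ wordLength S γ' + wordLength S γ := by
        exact_mod_cast wordLength_mul_le hS γ' γ
      have h3 : ‖L.rep (γ' * γ) x.1 - z.1‖ ≤
          ‖L.rep γ x.1 - y.1‖ + ‖L.rep γ' y.1 - z.1‖ := by
        rw [rep_mul_apply, ← (L.rep γ').norm_map (L.rep γ x.1 - y.1), map_sub]
        exact norm_sub_le_norm_sub_add_norm_sub _ _ _
      rw [h1]
      linarith
  obtain ⟨γ, hγ⟩ := key hc
  exact ⟨γ, hγ.trans_lt hcR⟩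

theorem abs_norm_sub_norm_le_dist (x y : WarpedCone L hS) :
    |‖coneVec x‖ - ‖coneVec y‖| ≤ dist x y := by
  refine le_of_forall_gt fun R hR => ?_
  obtain ⟨γ, hγ⟩ := exists_wordLength_add_norm_lt hR
  have h1 := abs_norm_sub_norm_le (L.rep γ (coneVec x)) (coneVec y)
  rw [LinearIsometryEquiv.norm_map] at h1
  have h2 : (0 : ℝ) ≤ wordLength S γ := Nat.cast_nonneg _
  linarith

end Cone

/-! ### The action on the profinite completion -/

section Profinite

variable {Γ : Type u} [Group Γ] {N : ℕ → Subgroup Γ} [∀ n, (N n).Normal] {hN : Antitone N}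

theorem profiniteCompletion.coord_of_le (g : profiniteCompletion N hN) {γ : Γ} {m n : ℕ}
    (hmn : m ≤ n) (h : g.1 n = (γ : Γ ⧸ N n)) : g.1 m = (γ : Γ ⧸ N m) := by
  induction n, hmn using Nat.le_induction with
  | base => exact h
  | succ n _ ih =>
    refine ih ?_
    rw [← g.2 n, h]
    rfl

theorem profiniteCompletion.coord_smul (γ : Γ) (g : profiniteCompletion N hN) (n : ℕ) :
    (γ • g).1 n = (γ : Γ ⧸ N n) * g.1 n := rfl

theorem profiniteCompletion.isOpen_coord_eq_one (n : ℕ) :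
    IsOpen {g : profiniteCompletion N hN | g.1 n = 1} := by
  let _ : ∀ n, TopologicalSpace (Γ ⧸ N n) := fun _ => ⊥
  have : ∀ n, DiscreteTopology (Γ ⧸ N n) := fun _ => ⟨rfl⟩
  have hc : Continuous fun g : profiniteCompletion N hN => g.1 n :=
    (continuous_apply n).comp continuous_induced_dom
  exact (isOpen_discrete {(1 : Γ ⧸ N n)}).preimage hc

theorem profiniteCompletion.exists_forall_coord_eq_one {s : Set (profiniteCompletion N hN)}
    (hs : s ∈ 𝓝 (1 : profiniteCompletion N hN)) : ∃ n, ∀ g, g.1 n = 1 → g ∈ s := by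
  let _ : ∀ n, TopologicalSpace (Γ ⧸ N n) := fun _ => ⊥
  have : ∀ n, DiscreteTopology (Γ ⧸ N n) := fun _ => ⟨rfl⟩
  rw [nhds_induced, mem_comap] at hs
  obtain ⟨t, ht, hts⟩ := hs
  rw [nhds_pi, Filter.mem_pi] at ht
  obtain ⟨I, hI, V, hV, hVt⟩ := ht
  obtain ⟨n, hn⟩ := hI.bddAbove
  refine ⟨n, fun g hg => hts (hVt fun i hi => ?_)⟩
  have h1 : g.1 i = ((1 : Γ) : Γ ⧸ N i) := profiniteCompletion.coord_of_le g (hn hi) hg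
  change g.1 i ∈ V i
  rw [h1]
  exact mem_of_mem_nhds (hV i)

variable {H : Type v} [NormedAddCommGroup H] [InnerProductSpace ℂ H]
  (L : UnitaryLinearization Γ (profiniteCompletion N hN) H)

theorem exists_norm_emb_sub_one_le {ε : ℝ} (hε : 0 < ε) :
    ∃ n₀, ∀ n ≥ n₀, ∀ g, g.1 n = 1 → ‖L.emb g - L.emb 1‖ ≤ ε := by
  have h1 := L.isEmbedding.continuous.continuousAt (x := 1) (Metric.closedBall_mem_nhds _ hε)
  obtain ⟨n₀, hn₀⟩ := profiniteCompletion.exists_forall_coord_eq_one h1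
  refine ⟨n₀, fun n hn g hg => ?_⟩
  have := hn₀ g (profiniteCompletion.coord_of_le g (γ := 1) hn hg)
  rwa [Set.mem_preimage, Metric.mem_closedBall, dist_eq_norm] at this

theorem exists_coord_eq_one_of_norm_emb_sub_lt (n : ℕ) :
    ∃ c > 0, ∀ g, ‖L.emb g - L.emb 1‖ < c → g.1 n = 1 := by
  have h1 : {g : profiniteCompletion N hN | g.1 n = 1} ∈ 𝓝 (1 : profiniteCompletion N hN) :=
    (profiniteCompletion.isOpen_coord_eq_one n).mem_nhds rfl
  rw [L.isEmbedding.isInducing.nhds_eq_comap, mem_comap] at h1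
  obtain ⟨t, ht, hts⟩ := h1
  obtain ⟨c, hc, hct⟩ := Metric.mem_nhds_iff.1 ht
  refine ⟨c, hc, fun g hg => hts (hct ?_)⟩
  rwa [Metric.mem_ball, dist_eq_norm]

theorem norm_emb_smul_sub (γ : Γ) (g h : profiniteCompletion N hN) :
    ‖L.emb (γ • g) - L.emb (γ • h)‖ = ‖L.emb g - L.emb h‖ := by
  rw [L.equivariant, L.equivariant, ← map_sub, LinearIsometryEquiv.norm_map]

/-- The embedding is uniformly continuous: points of the completion with the same coordinate are
close. Since the distance is invariant under `Γ`, it suffices to consider points near `1`. -/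
theorem exists_norm_emb_sub_le {ε : ℝ} (hε : 0 < ε) :
    ∃ n₀, ∀ n ≥ n₀, ∀ g h, g.1 n = h.1 n → ‖L.emb g - L.emb h‖ ≤ ε := by
  obtain ⟨n₀, hn₀⟩ := exists_norm_emb_sub_one_le L (half_pos hε)
  refine ⟨n₀, fun n hn g h hgh => ?_⟩
  obtain ⟨γ, hγ⟩ := QuotientGroup.mk_surjective (h.1 n)
  have key : ∀ k : profiniteCompletion N hN, k.1 n = h.1 n →
      ‖L.emb (γ⁻¹ • k) - L.emb 1‖ ≤ ε / 2 := fun k hk => by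
    refine hn₀ n hn _ ?_
    rw [profiniteCompletion.coord_smul, hk, ← hγ, QuotientGroup.mk_inv, inv_mul_cancel]
  rw [← norm_emb_smul_sub L γ⁻¹]
  have h1 := key g hgh
  have h2 := key h rfl
  have h3 := norm_sub_le_norm_sub_add_norm_sub (L.emb (γ⁻¹ • g)) (L.emb 1) (L.emb (γ⁻¹ • h))
  rw [norm_sub_rev (L.emb 1)] at h3
  linarith

/-- The action of `Γ` on its completion is uniformly free. -/
theorem exists_le_norm_emb_smul_sub (hbot : ⨅ n, N n = ⊥) {γ : Γ} (hγ : γ ≠ 1) :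
    ∃ ε > 0, ∀ g, ε ≤ ‖L.emb (γ • g) - L.emb g‖ := by
  obtain ⟨m, hm⟩ : ∃ m, γ ∉ N m := by
    by_contra! h
    refine hγ ?_
    have : γ ∈ ⨅ n, N n := Subgroup.mem_iInf.2 h
    rwa [hbot, Subgroup.mem_bot] at this
  obtain ⟨c, hc, hcm⟩ := exists_coord_eq_one_of_norm_emb_sub_lt L m
  obtain ⟨n₀, hn₀⟩ := exists_norm_emb_sub_one_le L (half_pos hc)
  refine ⟨c / 2, half_pos hc, fun g => ?_⟩
  by_contra! hlt
  let n := max n₀ m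
  obtain ⟨δ, hδ⟩ := QuotientGroup.mk_surjective (g.1 n)
  have hδm : g.1 m = (δ : Γ ⧸ N m) := profiniteCompletion.coord_of_le g (le_max_right n₀ m) hδ.symm
  have h1 : ‖L.emb (δ⁻¹ • g) - L.emb 1‖ ≤ c / 2 := by
    refine hn₀ n (le_max_left _ _) _ ?_
    rw [profiniteCompletion.coord_smul, ← hδ, QuotientGroup.mk_inv, inv_mul_cancel]
  rw [← norm_emb_smul_sub L δ⁻¹] at hlt
  have h2 : (δ⁻¹ • γ • g).1 m = 1 := by
    refine hcm _ ?_
    have h3 := norm_sub_le_norm_sub_add_norm_sub (L.emb (δ⁻¹ • γ • g)) (L.emb (δ⁻¹ • g)) (L.emb 1)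
    linarith
  rw [profiniteCompletion.coord_smul, profiniteCompletion.coord_smul, hδm, ← QuotientGroup.mk_mul,
    ← QuotientGroup.mk_mul, QuotientGroup.eq_one_iff] at h2
  refine hm ?_
  have h4 := (inferInstance : (N m).Normal).conj_mem _ h2 δ
  simpa [mul_assoc] using h4

theorem exists_le_norm_emb_smul_sub_of_wordLength_le {S : Set Γ} (hfin : S.Finite)
    (hS : Subgroup.closure S = ⊤) (hbot : ⨅ n, N n = ⊥) (R : ℕ) :
    ∃ ε > 0, ∀ γ : Γ, wordLength S γ ≤ R → γ ≠ 1 → ∀ g, ε ≤ ‖L.emb (γ • g) - L.emb g‖ := by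
  have hf := finite_wordLength_le hfin hS R
  have h : ∀ γ : Γ, ∃ ε > 0, γ ≠ 1 → ∀ g, ε ≤ ‖L.emb (γ • g) - L.emb g‖ := fun γ => by
    by_cases hγ : γ = 1
    · exact ⟨1, one_pos, fun h => absurd hγ h⟩
    · obtain ⟨ε, hε, h⟩ := exists_le_norm_emb_smul_sub L hbot hγ
      exact ⟨ε, hε, fun _ => h⟩
  choose ε hε hεγ using h
  obtain ⟨γ₀, -, h0⟩ := hf.toFinset.exists_min_image ε
    ⟨1, by simp [wordLength_one]⟩
  exact ⟨ε γ₀, hε γ₀, fun γ hγ hne g => (h0 γ (by simpa using hγ)).trans (hεγ γ hne g)⟩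

/-- Far from the origin, the elements of a ball of `Γ` move the points of the cone far apart. -/
theorem exists_forall_eq_of_norm_rep_sub_le {S : Set Γ} (hfin : S.Finite)
    (hS : Subgroup.closure S = ⊤) (hbot : ⨅ n, N n = ⊥) (R : ℕ) (D : ℝ) :
    ∃ T : ℝ, ∀ x ∈ L.openCone, T ≤ ‖x‖ → ∀ γ γ' : Γ, wordLength S γ ≤ R → wordLength S γ' ≤ R →
      ‖L.rep γ x - L.rep γ' x‖ ≤ D → γ = γ' := by
  obtain ⟨ε, hε, h⟩ := exists_le_norm_emb_smul_sub_of_wordLength_le L hfin hS hbot (2 * R)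
  refine ⟨(|D| + 1) / ε, ?_⟩
  rintro x ⟨t, g, ht, rfl⟩ hT γ γ' hγ hγ' hD
  rw [norm_smul, L.norm_emb, mul_one, Complex.norm_real, Real.norm_of_nonneg ht, div_le_iff₀ hε]
    at hT
  by_contra hne
  have h1 := h (γ'⁻¹ * γ) ((wordLength_mul_le hS _ _).trans (by rw [wordLength_inv]; omega))
    (fun h => hne (inv_mul_eq_one.1 h).symm) g
  rw [mul_smul, ← norm_emb_smul_sub L γ', smul_inv_smul, L.equivariant, L.equivariant] at h1
  rw [map_smul, map_smul, ← smul_sub, norm_smul, Complex.norm_real, Real.norm_of_nonneg ht] at hD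
  have h2 := mul_le_mul_of_nonneg_left h1 ht
  have h3 := le_abs_self D
  linarith

/-- A vector of the embedded completion above a given element of `Γ ⧸ N n`. -/
noncomputable def liftVec (n : ℕ) (q : Γ ⧸ N n) : H :=
  L.emb (toProfiniteCompletion N hN q.out)

theorem toProfiniteCompletion_out_coord (n : ℕ) (q : Γ ⧸ N n) :
    (toProfiniteCompletion N hN q.out).1 n = q := QuotientGroup.out_eq' q

theorem rep_liftVec (γ : Γ) (n : ℕ) (q : Γ ⧸ N n) :
    L.rep γ (liftVec L n q) = L.emb (γ • toProfiniteCompletion N hN q.out) :=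
  (L.equivariant γ _).symm

end Profinite

/-! ### Counting walls -/

section Walls

/-- The function `1_{(-∞, m)} - 1_{(-∞, 0)}` on `ℤ`. Its `ℓ_q`-distance to the function of `l` is
`|m - l| ^ (1 / q)`. -/
noncomputable def wallFun (m k : ℤ) : ℝ := (if k < m then 1 else 0) - (if k < 0 then 1 else 0)

@[simp] theorem wallFun_zero (k : ℤ) : wallFun 0 k = 0 := by simp [wallFun]

theorem hasSum_abs_wallFun_sub (m l : ℤ) {q : ℝ} (hq : 0 < q) :
    HasSum (fun k => |wallFun m k - wallFun l k| ^ q) |(m : ℝ) - l| := by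
  wlog h : m ≤ l generalizing m l
  · have := this l m (le_of_not_ge h)
    rw [abs_sub_comm (m : ℝ)]
    exact this.congr_fun fun k => by rw [abs_sub_comm]
  have h1 : ∀ k, |wallFun m k - wallFun l k| ^ q = if k ∈ Finset.Ico m l then (1 : ℝ) else 0 := by
    intro k
    simp only [wallFun, Finset.mem_Ico]
    split_ifs <;> first | omega | simp [hq.ne']
  have h2 : |(m : ℝ) - l| = ∑ k ∈ Finset.Ico m l, if k ∈ Finset.Ico m l then (1 : ℝ) else 0 := by
    rw [Finset.sum_ite_mem, Finset.inter_self, Finset.sum_const, Int.card_Ico, nsmul_eq_mul,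
      mul_one, abs_sub_comm, abs_of_nonneg (by exact_mod_cast sub_nonneg.2 h)]
    have h3 : ((l - m).toNat : ℤ) = l - m := Int.toNat_of_nonneg (by omega)
    exact_mod_cast h3.symm
  simp only [h1]
  rw [h2]
  exact hasSum_sum_of_ne_finset_zero fun k hk => if_neg hk

theorem hasSum_fintype_prod {β K : Type*} [Fintype β] {f : β × K → ℝ} {g : β → ℝ}
    (h : ∀ b, HasSum (fun k => f (b, k)) (g b)) : HasSum f (∑ b, g b) := by
  classical
  have h1 : ∀ b ∈ Finset.univ, HasSum (fun z : β × K => if z.1 = b then f z else 0) (g b) := by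
    intro b _
    refine ((Prod.mk_right_injective b).hasSum_iff ?_).1 ?_
    · rintro ⟨b', k⟩ hz
      refine if_neg ?_
      rintro rfl
      exact hz ⟨k, rfl⟩
    · simpa [Function.comp_def] using h b
  simpa using hasSum_sum h1

variable {𝕜 : Type} [RCLike 𝕜] {E : Type w} [NormedAddCommGroup E] [NormedSpace 𝕜 E]

variable {P : ℕ → Type u}

/-- The vector with the coordinate `t` at the distinguished index and, on the `n`-th block, the
normalized wall functions of `b` minus those of `b'`, in the direction `e₀`. -/
noncomputable def wallVec [∀ n, Fintype (P n)] (𝕜 : Type) [RCLike 𝕜] {E : Type w}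
    [NormedAddCommGroup E] [NormedSpace 𝕜 E] (q : ℝ) (e₀ : E) (n : ℕ) (t : E)
    (b b' : ∀ n, P n → ℤ) : (Unit ⊕ Σ n, P n × ℤ) → E :=
  Sum.elim (fun _ => t) fun s => if s.1 = n then
    (((Fintype.card (P s.1) : ℝ) ^ (-(1 / q)) *
      (wallFun (b s.1 s.2.1) s.2.2 - wallFun (b' s.1 s.2.1) s.2.2) : ℝ) : 𝕜) • e₀ else 0

theorem hasSum_norm_wallVec [∀ n, Fintype (P n)] {q : ℝ} (hq : 0 < q) {e₀ : E} (he₀ : ‖e₀‖ = 1)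
    (n : ℕ) (t : E) (b b' : ∀ n, P n → ℤ) :
    HasSum (fun i => ‖wallVec 𝕜 q e₀ n t b b' i‖ ^ q)
      (‖t‖ ^ q + (Fintype.card (P n) : ℝ)⁻¹ * ∑ z, |(b n z : ℝ) - b' n z|) := by
  refine HasSum.sum ?_ ?_
  · exact hasSum_unique fun _ : Unit => ‖t‖ ^ q
  · refine ((sigma_mk_injective (i := n)).hasSum_iff ?_).1 ?_
    · rintro ⟨m, z⟩ hz
      have : m ≠ n := by rintro rfl; exact hz ⟨z, rfl⟩
      simp [wallVec, this, hq.ne']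
    · rw [Finset.mul_sum]
      refine hasSum_fintype_prod fun z => ?_
      have h1 := (hasSum_abs_wallFun_sub (b n z) (b' n z) hq).mul_left
        ((Fintype.card (P n) : ℝ)⁻¹)
      refine h1.congr_fun fun k => ?_
      have hc : (0 : ℝ) ≤ (Fintype.card (P n) : ℝ) ^ (-(1 / q)) := by positivity
      have hcq : ((Fintype.card (P n) : ℝ) ^ (-(1 / q))) ^ q = (Fintype.card (P n) : ℝ)⁻¹ := by
        rw [← Real.rpow_mul (Nat.cast_nonneg _), neg_mul, one_div_mul_cancel hq.ne',
          Real.rpow_neg_one]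
      simp only [Function.comp_apply, wallVec, Sum.elim_inr, if_true]
      rw [norm_smul, he₀, mul_one, RCLike.norm_ofReal, abs_mul, abs_of_nonneg hc,
        Real.mul_rpow hc (abs_nonneg _), hcq]

variable {p : ℝ≥0∞} [Fact (1 ≤ p)]

/-- Let `a n x` be integer valued functions on finite `Γ`-sets `P n`, equivariant in the point `x`
of the `Γ`-set `X`. Adding the wall functions of `a n x` to an affine isometric action `α` on `E`
gives an action on an ultrapower of `ℓ_p(E)` together with a map of `X`, whose displacements are the
displacements of `α` plus the limits of the mean distances of the functions `a n x`. -/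
theorem exists_ultrapower_action {Γ : Type u} [Group Γ] {X : Type v} [MulAction Γ X]
    [∀ n, Fintype (P n)] (σ : ∀ n, Γ →* Equiv.Perm (P n)) (hΓ : Countable (Σ n, P n × ℤ))
    (a : X → ∀ n, P n → ℤ) (ha : ∀ γ x n z, a (γ • x) n (σ n γ z) = a x n z)
    (hbd : ∀ x, ∃ C, ∀ n, (Fintype.card (P n) : ℝ)⁻¹ * ∑ z, |(a x n z : ℝ)| ≤ C)
    (hp : p ≠ ∞) (U : Ultrafilter ℕ) [Nontrivial E] (α : Γ →* (E ≃ᵃⁱ[𝕜] E)) :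
    ∃ (J : Type) (_ : Countable J) (β : Γ →* (Ultrapower 𝕜 U (lp (fun _ : J => E) p) ≃ᵃⁱ[𝕜]
      Ultrapower 𝕜 U (lp (fun _ : J => E) p)))
      (F : X → Ultrapower 𝕜 U (lp (fun _ : J => E) p)), ∀ γ x y,
      Tendsto (fun n => ‖α γ 0‖ ^ p.toReal +
        (Fintype.card (P n) : ℝ)⁻¹ * ∑ z, |(a (γ • x) n z : ℝ) - a y n z|) U
        (𝓝 (‖β γ (F x) - F y‖ ^ p.toReal)) := by
  classical
  have hq := toReal_pos_of_one_le p hp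
  set q := p.toReal with hqdef
  obtain ⟨e₀, he₀⟩ : ∃ e₀ : E, ‖e₀‖ = 1 :=
    let ⟨v, hv⟩ := exists_ne (0 : E)
    ⟨((‖v‖ : 𝕜)⁻¹) • v, norm_smul_inv_norm hv⟩
  obtain ⟨J, hJ, ⟨e⟩⟩ : ∃ J : Type, Countable J ∧ Nonempty (J ≃ Unit ⊕ Σ n, P n × ℤ) :=
    ⟨Shrink.{0} (Unit ⊕ Σ n, P n × ℤ), (equivShrink _).symm.countable_iff.2 inferInstance,
      ⟨(equivShrink _).symm⟩⟩
  -- The action permutes the blocks by `σ`, and is `α` at the distinguished index.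
  let τ : Γ → Equiv.Perm (Unit ⊕ Σ n, P n × ℤ) := fun γ => Equiv.sumCongr (Equiv.refl _)
    (Equiv.sigmaCongrRight fun n => Equiv.prodCongr (σ n γ⁻¹) (Equiv.refl _))
  let A : Γ → (Unit ⊕ Σ n, P n × ℤ) → (E ≃ᵃⁱ[𝕜] E) := fun γ =>
    Sum.elim (fun _ => α γ) fun _ => .refl 𝕜 E
  have hA : ∀ γ, Memℓp (fun j => A γ (e j) 0) p := fun γ => memℓp_gen <|
    summable_of_ne_finset_zero (s := {e.symm (Sum.inl ())}) fun j hj => by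
      rcases h : e j with u | s
      · exact absurd (by rw [← Subsingleton.elim u (), ← h, e.symm_apply_apply]; simp) hj
      · simp [A, hq.ne', ← hqdef]
  have hτ : ∀ γ γ' i, τ (γ * γ') i = τ γ' (τ γ i) := by
    rintro γ γ' (u | ⟨n, z, k⟩)
    · rfl
    · simp [τ, Equiv.sigmaCongrRight]
      rfl
  let π : Γ →* (lp (fun _ : J => E) p ≃ᵃⁱ[𝕜] lp (fun _ : J => E) p) :=
    MonoidHom.mk' (fun γ => lpTwist hp ((e.trans (τ γ)).trans e.symm) (fun j => A γ (e j)) (hA γ))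
      fun γ γ' => by
        ext ξ j
        change _ = lpTwist hp _ _ (hA γ) (lpTwist hp _ _ (hA γ') ξ) j
        simp only [lpTwist_apply, Equiv.trans_apply, Equiv.apply_symm_apply, hτ]
        rcases e j with u | s
        · change α (γ * γ') _ = α γ (α γ' _)
          rw [map_mul]; rfl
        · rfl
  have hπ : ∀ γ ξ j, π γ ξ j = A γ (e j) (ξ (e.symm (τ γ (e j)))) := fun γ ξ j =>
    lpTwist_apply hp _ _ (hA γ) ξ j
  have hmem : ∀ n x, Memℓp (fun j => wallVec 𝕜 q e₀ n 0 (a x) 0 (e j)) p := fun n x =>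
    memℓp_gen ((e.summable_iff (f := fun i => ‖wallVec 𝕜 q e₀ n 0 (a x) 0 i‖ ^ q)).2
      (hasSum_norm_wallVec hq he₀ n 0 (a x) 0).summable)
  let f : ℕ → X → lp (fun _ : J => E) p := fun n x => ⟨_, hmem n x⟩
  have hf : ∀ n x j, f n x j = wallVec 𝕜 q e₀ n 0 (a x) 0 (e j) := fun n x j => rfl
  have hnorm : ∀ (η : lp (fun _ : J => E) p) n t b b', (∀ j, η j = wallVec 𝕜 q e₀ n t b b' (e j)) →
      ‖η‖ ^ q = ‖t‖ ^ q + (Fintype.card (P n) : ℝ)⁻¹ * ∑ z, |(b n z : ℝ) - b' n z| := by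
    intro η n t b b' h
    rw [lp.norm_rpow_eq_tsum hq, ← (hasSum_norm_wallVec (𝕜 := 𝕜) hq he₀ n t b b').tsum_eq,
      ← e.tsum_eq]
    simp only [h, hqdef]
  have hsub : ∀ n γ x y j, (π γ (f n x) - f n y) j =
      wallVec 𝕜 q e₀ n (α γ 0) (a (γ • x)) (a y) (e j) := by
    intro n γ x y j
    rw [lp.coeFn_sub, Pi.sub_apply, hπ, hf, hf, Equiv.apply_symm_apply]
    rcases e j with u | ⟨m, z, k⟩
    · simp [A, wallVec, τ]
    · have h1 : a (γ • x) m z = a x m (σ m γ⁻¹ z) := by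
        rw [← ha γ x m, map_inv]
        exact congrArg (a (γ • x) m) ((σ m γ).apply_symm_apply z).symm
      simp only [A, wallVec, τ, Sum.elim_inr, Equiv.sumCongr_apply, Sum.map_inr,
        Equiv.sigmaCongrRight_apply, Equiv.prodCongr_apply, Prod.map, h1,
        AffineIsometryEquiv.coe_refl, id, Equiv.coe_refl, Pi.zero_apply, wallFun_zero, sub_zero]
      split_ifs
      · rw [← sub_smul, mul_sub]; push_cast; rfl
      · rw [sub_zero]
  have hfbd : ∀ x, ∃ C, ∀ n, ‖f n x‖ ≤ C := fun x => by
    obtain ⟨C, hC⟩ := hbd x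
    refine ⟨C ^ q⁻¹, fun n => ?_⟩
    rw [Real.le_rpow_inv_iff_of_pos (norm_nonneg _) (le_trans (by positivity) (hC n)) hq,
      hnorm (f n x) n 0 (a x) 0 (hf n x)]
    simpa [hq.ne'] using hC n
  let β := ultraAction U (fun _ => π) (fun γ => ⟨‖π γ 0‖, fun _ => le_rfl⟩)
    (Eventually.of_forall fun _ ξ => by rw [map_one]; rfl)
    (fun γ γ' => Eventually.of_forall fun _ ξ => by rw [map_mul]; rfl)
  refine ⟨J, hJ, β, fun x => ultraMk 𝕜 U (boundedSeq (fun n => f n x) (hfbd x)), fun γ x y => ?_⟩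
  rw [ultraAction_mk, ← ultraMk_sub]
  refine ((tendsto_norm_ultraMk U _).rpow_const (Or.inr hq.le)).congr fun n => ?_
  exact hnorm _ n (α γ 0) (a (γ • x)) (a y) (hsub n γ x y)

end Walls

/-! ### Mean values of linear functionals on Hilbert spaces -/

section Rademacher

variable {V : Type*} [NormedAddCommGroup V] [InnerProductSpace ℝ V]

/-- The second and fourth moments of the signed sums of the vectors `b i`. Each step of the
induction chooses one more sign. -/
theorem exists_moments_signed_sums {ι : Type*} [DecidableEq ι] (b : ι → V) (s : Finset ι) :
    ∃ (Ω : Type) (_ : Fintype Ω) (_ : Nonempty Ω) (w : Ω → V), ∀ v,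
      ∑ ω, inner ℝ (w ω) v ^ 2 = Fintype.card Ω * ∑ i ∈ s, inner ℝ (b i) v ^ 2 ∧
      ∑ ω, inner ℝ (w ω) v ^ 4 ≤ Fintype.card Ω * (3 * (∑ i ∈ s, inner ℝ (b i) v ^ 2) ^ 2) := by
  induction s using Finset.induction_on with
  | empty => exact ⟨Unit, inferInstance, inferInstance, fun _ => 0, fun v => by simp⟩
  | insert a s ha ih =>
    obtain ⟨Ω, i1, i2, w, hw⟩ := ih
    refine ⟨Ω × Bool, inferInstance, inferInstance,
      fun z => w z.1 + if z.2 then b a else -b a, fun v => ?_⟩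
    obtain ⟨h2, h4⟩ := hw v
    rw [Finset.sum_insert ha, Fintype.sum_prod_type, Fintype.sum_prod_type, Fintype.card_prod,
      Fintype.card_bool]
    simp only [Fintype.sum_bool, if_true, Bool.false_eq_true, if_false, inner_add_left,
      inner_neg_left]
    set c := inner ℝ (b a) v
    set A := ∑ i ∈ s, inner ℝ (b i) v ^ 2
    have hA : 0 ≤ A := Finset.sum_nonneg fun i _ => sq_nonneg _
    have e2 : ∀ ω, (inner ℝ (w ω) v + c) ^ 2 + (inner ℝ (w ω) v + -c) ^ 2 =
        2 * inner ℝ (w ω) v ^ 2 + 2 * c ^ 2 := fun ω => by ring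
    have e4 : ∀ ω, (inner ℝ (w ω) v + c) ^ 4 + (inner ℝ (w ω) v + -c) ^ 4 =
        2 * inner ℝ (w ω) v ^ 4 + (12 * c ^ 2) * inner ℝ (w ω) v ^ 2 + 2 * c ^ 4 :=
      fun ω => by ring
    simp only [e2, e4, Finset.sum_add_distrib, ← Finset.mul_sum, h2, Finset.sum_const,
      Finset.card_univ, nsmul_eq_mul]
    push_cast
    refine ⟨by ring, ?_⟩
    have h5 : (0 : ℝ) ≤ Fintype.card Ω * c ^ 4 := by positivity
    linarith

/-- A finite dimensional Hilbert space embeds into a finite dimensional `L_1`-space, with constants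
that do not depend on the dimension. -/
theorem exists_mean_abs_inner (W : Submodule ℝ V) [FiniteDimensional ℝ W] :
    ∃ (Ω : Type) (_ : Fintype Ω) (_ : Nonempty Ω) (w : Ω → V), ∀ v ∈ W,
      Fintype.card Ω * (‖v‖ / 4) ≤ ∑ ω, |inner ℝ (w ω) v| ∧
      ∑ ω, |inner ℝ (w ω) v| ≤ Fintype.card Ω * ‖v‖ := by
  obtain ⟨Ω, i1, i2, w, hw⟩ := exists_moments_signed_sums
    (fun i => ((stdOrthonormalBasis ℝ W i : W) : V)) Finset.univ
  refine ⟨Ω, i1, i2, w, fun v hv => ?_⟩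
  have hsum : ∑ i, inner ℝ ((stdOrthonormalBasis ℝ W i : W) : V) v ^ 2 = ‖v‖ ^ 2 := by
    have := (stdOrthonormalBasis ℝ W).sum_sq_norm_inner_right ⟨v, hv⟩
    simpa using this
  obtain ⟨h2, h4⟩ := hw v
  rw [hsum] at h2 h4
  rcases eq_or_ne v 0 with rfl | hv0
  · simp
  have hr : 0 < ‖v‖ := norm_pos_iff.2 hv0
  set r := ‖v‖
  constructor
  · -- Integrate the inequality `r ^ 3 |X| ≥ r ^ 2 X ^ 2 - X ^ 4 / 4`.
    have h : ∀ ω, r ^ 2 * inner ℝ (w ω) v ^ 2 - 1 / 4 * inner ℝ (w ω) v ^ 4 ≤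
        r ^ 3 * |inner ℝ (w ω) v| := fun ω => by
      rw [← sq_abs (inner ℝ (w ω) v), ← (show Even 4 by decide).pow_abs (inner ℝ (w ω) v)]
      have hX := abs_nonneg (inner ℝ (w ω) v)
      set X := |inner ℝ (w ω) v|
      have h2 : 0 ≤ X * (X ^ 3 - 4 * r ^ 2 * X + 4 * r ^ 3) := by
        refine mul_nonneg hX ?_
        nlinarith [mul_nonneg (add_nonneg hX (by positivity : 0 ≤ 2 * r)) (sq_nonneg (X - r)),
          mul_nonneg hr.le (sq_nonneg (X - r)), mul_nonneg hX (sq_nonneg (X - r)), pow_pos hr 3,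
          mul_nonneg hr.le (sq_nonneg (5 * X - 6 * r)), mul_nonneg hX (sq_nonneg (5 * X - 6 * r))]
      linarith
    have h1 := Finset.sum_le_sum fun ω (_ : ω ∈ Finset.univ) => h ω
    rw [Finset.sum_sub_distrib, ← Finset.mul_sum, ← Finset.mul_sum, ← Finset.mul_sum, h2] at h1
    have h3 : r ^ 3 * (Fintype.card Ω * (r / 4)) ≤ r ^ 3 * ∑ ω, |inner ℝ (w ω) v| := by
      linarith
    exact le_of_mul_le_mul_left h3 (by positivity)
  · have h : ∀ ω, 2 * r * |inner ℝ (w ω) v| ≤ inner ℝ (w ω) v ^ 2 + r ^ 2 := fun ω => by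
      rw [← sq_abs (inner ℝ (w ω) v)]
      nlinarith [sq_nonneg (|inner ℝ (w ω) v| - r)]
    have h1 := Finset.sum_le_sum fun ω (_ : ω ∈ Finset.univ) => h ω
    rw [Finset.sum_add_distrib, ← Finset.mul_sum, h2, Finset.sum_const, Finset.card_univ,
      nsmul_eq_mul] at h1
    have h3 : 2 * r * ∑ ω, |inner ℝ (w ω) v| ≤ 2 * r * (Fintype.card Ω * r) := by linarith
    exact le_of_mul_le_mul_left h3 (by positivity)

theorem abs_ceil_sub_ceil_le (s t : ℝ) : |(⌈s⌉ : ℝ) - ⌈t⌉| ≤ |s - t| + 1 := by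
  have h1 := Int.le_ceil s
  have h2 := Int.ceil_lt_add_one s
  have h3 := Int.le_ceil t
  have h4 := Int.ceil_lt_add_one t
  have h5 := abs_le.1 (le_refl |s - t|)
  exact abs_le.2 ⟨by linarith, by linarith⟩

theorem le_abs_ceil_sub_ceil (s t : ℝ) : |s - t| - 1 ≤ |(⌈s⌉ : ℝ) - ⌈t⌉| := by
  have h1 := Int.le_ceil s
  have h2 := Int.ceil_lt_add_one s
  have h3 := Int.le_ceil t
  have h4 := Int.ceil_lt_add_one t
  have h5 := abs_le.1 (le_refl |(⌈s⌉ : ℝ) - ⌈t⌉|)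
  rw [sub_le_iff_le_add]
  exact abs_le.2 ⟨by linarith, by linarith⟩

/-- Rounding up the functionals of `exists_mean_abs_inner` changes the mean distances by at most
one. -/
theorem mean_abs_ceil_inner_sub {W : Submodule ℝ V} {Q Ω : Type*} [Fintype Q] [Fintype Ω]
    [Nonempty Q] [Nonempty Ω] {w : Ω → V}
    (hw : ∀ v ∈ W, Fintype.card Ω * (‖v‖ / 4) ≤ ∑ ω, |inner ℝ (w ω) v| ∧
      ∑ ω, |inner ℝ (w ω) v| ≤ Fintype.card Ω * ‖v‖)
    {x y : Q → V} (hx : ∀ i, x i ∈ W) (hy : ∀ i, y i ∈ W) {m M : ℝ}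
    (h : ∀ i, m ≤ ‖x i - y i‖ ∧ ‖x i - y i‖ ≤ M) :
    m / 4 - 1 ≤ (Fintype.card (Q × Ω) : ℝ)⁻¹ *
        ∑ z : Q × Ω, |(⌈inner ℝ (w z.2) (x z.1)⌉ : ℝ) - ⌈inner ℝ (w z.2) (y z.1)⌉| ∧
      (Fintype.card (Q × Ω) : ℝ)⁻¹ *
        ∑ z : Q × Ω, |(⌈inner ℝ (w z.2) (x z.1)⌉ : ℝ) - ⌈inner ℝ (w z.2) (y z.1)⌉| ≤ M + 1 := by
  have hcard : (0 : ℝ) < Fintype.card (Q × Ω) := by exact_mod_cast Fintype.card_pos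
  rw [inv_mul_eq_div, le_div_iff₀ hcard, div_le_iff₀ hcard, Fintype.sum_prod_type,
    Fintype.card_prod]
  push_cast
  have hconst : ∀ c : ℝ, c * (Fintype.card Q * Fintype.card Ω) =
      ∑ _i : Q, Fintype.card Ω * c := fun c => by
    rw [Finset.sum_const, Finset.card_univ, nsmul_eq_mul]; ring
  have hone : ∑ _ω : Ω, (1 : ℝ) = Fintype.card Ω := by simp
  have hΩ : (0 : ℝ) ≤ Fintype.card Ω := Nat.cast_nonneg _
  rw [hconst, hconst]
  constructor
  · refine Finset.sum_le_sum fun i _ => ?_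
    have h1 := Finset.sum_le_sum fun ω (_ : ω ∈ Finset.univ) =>
      le_abs_ceil_sub_ceil (inner ℝ (w ω) (x i)) (inner ℝ (w ω) (y i))
    simp only [← inner_sub_right] at h1
    rw [Finset.sum_sub_distrib, hone] at h1
    have h2 := (hw _ (W.sub_mem (hx i) (hy i))).1
    have h3 := mul_le_mul_of_nonneg_left (h i).1 hΩ
    linarith
  · refine Finset.sum_le_sum fun i _ => ?_
    have h1 := Finset.sum_le_sum fun ω (_ : ω ∈ Finset.univ) =>
      abs_ceil_sub_ceil_le (inner ℝ (w ω) (x i)) (inner ℝ (w ω) (y i))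
    simp only [← inner_sub_right] at h1
    rw [Finset.sum_add_distrib, hone] at h1
    have h2 := (hw _ (W.sub_mem (hx i) (hy i))).2
    have h3 := mul_le_mul_of_nonneg_left (h i).2 hΩ
    linarith

end Rademacher

/-! ### Walls on the open cone -/

section ConeWalls

variable {𝕜 : Type} [RCLike 𝕜] {E : Type w} [NormedAddCommGroup E] [NormedSpace 𝕜 E]
  {Γ : Type u} [Group Γ] {N : ℕ → Subgroup Γ} [∀ n, (N n).Normal] {hN : Antitone N}
  {H : Type v} [NormedAddCommGroup H] [InnerProductSpace ℂ H]
  (L : UnitaryLinearization Γ (profiniteCompletion N hN) H)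

/-- A point of the completion on the ray of `x`. -/
noncomputable def coneDir (x : L.openCone) : profiniteCompletion N hN := x.2.choose_spec.choose

theorem norm_smul_emb_coneDir (x : L.openCone) : ((‖x.1‖ : ℝ) : ℂ) • L.emb (coneDir L x) = x.1 := by
  obtain ⟨h0, h⟩ := x.2.choose_spec.choose_spec
  have h1 : ‖x.1‖ = x.2.choose := by
    conv_lhs => rw [h]
    rw [norm_smul, L.norm_emb, mul_one, Complex.norm_real, Real.norm_of_nonneg h0]
  rw [h1]
  exact h.symm

theorem coneDir_smul (γ : Γ) (x : L.openCone) (hx : x.1 ≠ 0) :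
    coneDir L (γ • x) = γ • coneDir L x := by
  have h1 := norm_smul_emb_coneDir L (γ • x)
  have h2 : (γ • x).1 = L.rep γ x.1 := rfl
  rw [h2, LinearIsometryEquiv.norm_map, ← norm_smul_emb_coneDir L x, map_smul, ← L.equivariant,
    norm_smul_emb_coneDir L x] at h1
  refine L.isEmbedding.injective (smul_right_injective H ?_ h1)
  simpa using hx

/-- An approximation of `g⁻¹ x`, where `g` is a lift of the element `i` of `Γ ⧸ N n`. -/
noncomputable def coneApprox (n : ℕ) (i : Γ ⧸ N n) (x : L.openCone) : H :=
  ((‖x.1‖ : ℝ) : ℂ) • liftVec L n (i⁻¹ * (coneDir L x).1 n)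

theorem coneApprox_smul (γ : Γ) (n : ℕ) (i : Γ ⧸ N n) (x : L.openCone) :
    coneApprox L n ((γ : Γ ⧸ N n) * i) (γ • x) = coneApprox L n i x := by
  have h2 : (γ • x).1 = L.rep γ x.1 := rfl
  by_cases hx : x.1 = 0
  · simp [coneApprox, h2, hx]
  · rw [coneApprox, coneDir_smul L γ x hx, h2, LinearIsometryEquiv.norm_map,
      profiniteCompletion.coord_smul, mul_inv_rev, mul_assoc, inv_mul_cancel_left]
    rfl

theorem norm_coneApprox (n : ℕ) (i : Γ ⧸ N n) (x : L.openCone) :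
    ‖coneApprox L n i x‖ = ‖x.1‖ := by
  rw [coneApprox, norm_smul, liftVec, L.norm_emb, mul_one, Complex.norm_real, norm_norm]

theorem eventually_norm_rep_coneApprox_sub_le (x : L.openCone) :
    ∀ᶠ n in atTop, ∀ i, ‖L.rep i.out (coneApprox L n i x) - x.1‖ ≤ 1 / 2 := by
  obtain ⟨n₀, hn₀⟩ := exists_norm_emb_sub_le L
    (show 0 < 1 / (2 * (‖x.1‖ + 1)) by positivity)
  filter_upwards [eventually_ge_atTop n₀] with n hn i
  have h1 := hn₀ n hn (i.out • toProfiniteCompletion N hN (i⁻¹ * (coneDir L x).1 n).out)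
    (coneDir L x) (by
      rw [profiniteCompletion.coord_smul, toProfiniteCompletion_out_coord, QuotientGroup.out_eq',
        mul_inv_cancel_left])
  have h2 : L.rep i.out (coneApprox L n i x) - x.1 = ((‖x.1‖ : ℝ) : ℂ) •
      (L.emb (i.out • toProfiniteCompletion N hN (i⁻¹ * (coneDir L x).1 n).out) -
        L.emb (coneDir L x)) := by
    rw [smul_sub, norm_smul_emb_coneDir, coneApprox, map_smul, rep_liftVec]
  rw [h2, norm_smul, Complex.norm_real, norm_norm]
  rw [le_div_iff₀ (by positivity)] at h1
  nlinarith [norm_nonneg (L.emb (i.out • toProfiniteCompletion N hN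
    (i⁻¹ * (coneDir L x).1 n).out) - L.emb (coneDir L x)), norm_nonneg x.1]

theorem eventually_abs_norm_coneApprox_sub (x y : L.openCone) :
    ∀ᶠ n in atTop, ∀ i, ‖x.1 - y.1‖ - 1 ≤ ‖coneApprox L n i x - coneApprox L n i y‖ ∧
      ‖coneApprox L n i x - coneApprox L n i y‖ ≤ ‖x.1 - y.1‖ + 1 := by
  filter_upwards [eventually_norm_rep_coneApprox_sub_le L x,
    eventually_norm_rep_coneApprox_sub_le L y] with n hx hy i
  have h0 := abs_norm_sub_norm_le (L.rep i.out (coneApprox L n i x - coneApprox L n i y))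
    (x.1 - y.1)
  rw [LinearIsometryEquiv.norm_map, map_sub, sub_sub_sub_comm] at h0
  have h1 := norm_sub_le (L.rep i.out (coneApprox L n i x) - x.1)
    (L.rep i.out (coneApprox L n i y) - y.1)
  have h2 := abs_le.1 (h0.trans h1)
  have h3 := hx i
  have h4 := hy i
  constructor <;> linarith

variable {p : ℝ≥0∞} [Fact (1 ≤ p)]

/-- Adding the walls of the cone to an action `α`, one obtains an action on an ultrapower of
`ℓ_p(E)` whose displacements dominate both those of `α` and those of the cone. -/
theorem exists_action_and_map [∀ n, (N n).FiniteIndex] (hp : p ≠ ∞) (U : Ultrafilter ℕ)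
    (hU : (U : Filter ℕ) ≤ atTop) [Nontrivial E] (α : Γ →* (E ≃ᵃⁱ[𝕜] E)) :
    ∃ (J : Type) (_ : Countable J) (β : Γ →* (Ultrapower 𝕜 U (lp (fun _ : J => E) p) ≃ᵃⁱ[𝕜]
      Ultrapower 𝕜 U (lp (fun _ : J => E) p)))
      (F : L.openCone → Ultrapower 𝕜 U (lp (fun _ : J => E) p)), ∀ γ x y,
      ‖α γ 0‖ ^ p.toReal + ‖L.rep γ x.1 - y.1‖ / 4 - 2 ≤ ‖β γ (F x) - F y‖ ^ p.toReal ∧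
      ‖β γ (F x) - F y‖ ^ p.toReal ≤ ‖α γ 0‖ ^ p.toReal + ‖L.rep γ x.1 - y.1‖ + 2 := by
  classical
  let _ : ∀ n, Fintype (Γ ⧸ N n) := fun n => Fintype.ofFinite _
  let _ : InnerProductSpace ℝ H := InnerProductSpace.complexToReal
  let W : ℕ → Submodule ℝ H := fun n => Submodule.span ℝ (Set.range (liftVec L n))
  have hWfin : ∀ n, FiniteDimensional ℝ (W n) := fun n =>
    FiniteDimensional.span_of_finite ℝ (Set.finite_range _)
  have hWmem : ∀ n i x, coneApprox L n i x ∈ W n := fun n i x =>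
    (W n).smul_mem ‖x.1‖ (Submodule.subset_span ⟨_, rfl⟩)
  choose Ω i1 i2 w hw using fun n => exists_mean_abs_inner (W n)
  let σ : ∀ n, Γ →* Equiv.Perm ((Γ ⧸ N n) × Ω n) := fun n =>
    MonoidHom.mk' (fun γ => Equiv.prodCongr (Equiv.mulLeft (γ : Γ ⧸ N n)) (Equiv.refl _))
      fun γ γ' => by ext z <;> simp [mul_assoc]
  let a : L.openCone → ∀ n, (Γ ⧸ N n) × Ω n → ℤ := fun x n z =>
    ⌈inner ℝ (w n z.2) (coneApprox L n z.1 x)⌉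
  have ha : ∀ γ x n z, a (γ • x) n (σ n γ z) = a x n z := fun γ x n z => by
    simp only [a]
    rw [← coneApprox_smul L γ n z.1 x]
    rfl
  have hmean := fun n (x y : L.openCone) m M h => mean_abs_ceil_inner_sub (hw n)
    (fun i => hWmem n i x) (fun i => hWmem n i y) (m := m) (M := M) h
  have hbd : ∀ x, ∃ C, ∀ n, (Fintype.card ((Γ ⧸ N n) × Ω n) : ℝ)⁻¹ * ∑ z, |(a x n z : ℝ)| ≤ C := by
    intro x
    refine ⟨‖x.1‖ + 1, fun n => ?_⟩
    have := (mean_abs_ceil_inner_sub (hw n) (fun i => hWmem n i x) (y := fun _ => 0)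
      (fun _ => (W n).zero_mem) (m := 0) (M := ‖x.1‖)
      (fun i => by simp [norm_coneApprox])).2
    simpa using this
  obtain ⟨J, hJ, β, F, hF⟩ := exists_ultrapower_action (𝕜 := 𝕜) (E := E) σ inferInstance a ha hbd
    hp U α
  refine ⟨J, hJ, β, F, fun γ x y => ?_⟩
  have hev := hU (eventually_abs_norm_coneApprox_sub L (γ • x) y)
  have hval : (γ • x).1 = L.rep γ x.1 := rfl
  constructor
  · refine ge_of_tendsto (hF γ x y) ?_
    filter_upwards [hev] with n hn
    have := (hmean n (γ • x) y _ _ hn).1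
    rw [hval] at this
    linarith
  · refine le_of_tendsto (hF γ x y) ?_
    filter_upwards [hev] with n hn
    have := (hmean n (γ • x) y _ _ hn).2
    rw [hval] at this
    linarith

end ConeWalls

/-! ### From an action to the warped cone -/

section ActionToCone

variable {𝕜 : Type} [RCLike 𝕜] {Γ : Type u} [Group Γ] {S : Set Γ}

/-- Control functions for the sum of a proper function on `Γ` and a distance. The lower one is the
infimum, the upper one the supremum of all values that are compatible with the total length. -/
theorem exists_control_functions (hfin : S.Finite) (hS : Subgroup.closure S = ⊤) {b : Γ → ℝ}
    (hb0 : ∀ γ, 0 ≤ b γ) (hb : Tendsto b (comap (wordLength S) atTop) atTop) :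
    ∃ ρ₁ ρ₂ : ℝ → ℝ, Monotone ρ₁ ∧ MonotoneOn ρ₂ (Set.Ici 0) ∧ Tendsto ρ₁ atTop atTop ∧
      Tendsto ρ₂ atTop atTop ∧ ∀ γ, ∀ t : ℝ, 0 ≤ t → ∀ s : ℝ,
        (s ≤ wordLength S γ + t → ρ₁ s ≤ b γ + t / 4) ∧
        (wordLength S γ + t ≤ s + 1 → b γ + t ≤ ρ₂ s) := by
  let A : ℝ → Set ℝ := fun s => {c | ∃ γ, ∃ t ≥ 0, s ≤ wordLength S γ + t ∧ c = b γ + t / 4}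
  let B : ℝ → Set ℝ := fun s => {c | ∃ γ, ∃ t ≥ 0, wordLength S γ + t ≤ s + 1 ∧ c = b γ + t}
  have hA : ∀ s, (A s).Nonempty := fun s =>
    ⟨_, 1, |s|, abs_nonneg s, by rw [wordLength_one]; simpa using le_abs_self s, rfl⟩
  have hAb : ∀ s, BddBelow (A s) := fun s => ⟨0, by
    rintro _ ⟨γ, t, ht, -, rfl⟩
    have := hb0 γ
    positivity⟩
  have hBmem : ∀ s ≥ 0, b 1 + (s + 1) ∈ B s := fun s hs =>
    ⟨1, s + 1, by linarith, by rw [wordLength_one]; simp, rfl⟩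
  have hBb : ∀ s, BddAbove (B s) := fun s => by
    obtain ⟨R, hR⟩ := exists_nat_ge (s + 1)
    obtain ⟨C, hC⟩ := ((finite_wordLength_le hfin hS R).image b).bddAbove
    refine ⟨C + (s + 1), ?_⟩
    rintro _ ⟨γ, t, ht, hle, rfl⟩
    have h0 : (0 : ℝ) ≤ wordLength S γ := Nat.cast_nonneg _
    have h1 : wordLength S γ ≤ R := by
      have : (wordLength S γ : ℝ) ≤ R := by linarith
      exact_mod_cast this
    have h2 := hC ⟨γ, h1, rfl⟩
    linarith
  refine ⟨fun s => sInf (A s), fun s => sSup (B s), ?_, ?_, ?_, ?_, ?_⟩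
  · intro s s' hs
    refine csInf_le_csInf (hAb s) (hA s') ?_
    rintro _ ⟨γ, t, ht, hle, rfl⟩
    exact ⟨γ, t, ht, hs.trans hle, rfl⟩
  · intro s hs s' _ hss'
    refine csSup_le_csSup (hBb s') ⟨_, hBmem s hs⟩ ?_
    rintro _ ⟨γ, t, ht, hle, rfl⟩
    exact ⟨γ, t, ht, hle.trans (by linarith), rfl⟩
  · refine tendsto_atTop.2 fun M => ?_
    obtain ⟨l, hl⟩ := eventually_atTop.1 (eventually_comap.1 (tendsto_atTop.1 hb M))
    filter_upwards [eventually_ge_atTop (l + 4 * M)] with s hs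
    refine le_csInf (hA s) ?_
    rintro _ ⟨γ, t, ht, hle, rfl⟩
    rcases le_total l (wordLength S γ) with h | h
    · have := hl _ h γ rfl
      linarith
    · have h1 : (wordLength S γ : ℝ) ≤ l := by exact_mod_cast h
      have := hb0 γ
      linarith
  · refine tendsto_atTop_mono' _ ?_ (tendsto_atTop_add_const_left _ (b 1)
      (tendsto_atTop_add_const_right _ (1 : ℝ) tendsto_id))
    filter_upwards [eventually_ge_atTop 0] with s hs using le_csSup (hBb s) (hBmem s hs)
  · exact fun γ t ht s => ⟨fun h => csInf_le (hAb s) ⟨γ, t, ht, h, rfl⟩,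
      fun h => le_csSup (hBb s) ⟨γ, t, ht, h, rfl⟩⟩

variable {N : ℕ → Subgroup Γ} [∀ n, (N n).Normal] {hN : Antitone N}
  {H : Type v} [NormedAddCommGroup H] [InnerProductSpace ℂ H]
  (L : UnitaryLinearization Γ (profiniteCompletion N hN) H)

/-- Over a small set `C` far from the origin, the trivialization at `x` is the inverse of the action
of the unique short element of `Γ` that moves a base point of `C` near `x`. -/
theorem nonempty_fibredCoarseEmbedding_cone (hfin : S.Finite) (hS : Subgroup.closure S = ⊤)
    (hbot : ⨅ n, N n = ⊥) {W : Type w} [NormedAddCommGroup W] [NormedSpace 𝕜 W] [CompleteSpace W]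
    (β : Γ →* (W ≃ᵃⁱ[𝕜] W)) (F : L.openCone → W) {q : ℝ} (hq : 0 < q) {b : Γ → ℝ}
    (hb0 : ∀ γ, 0 ≤ b γ) (hb : Tendsto b (comap (wordLength S) atTop) atTop)
    (hF : ∀ γ x y, b γ + ‖L.rep γ x.1 - y.1‖ / 4 - 2 ≤ ‖β γ (F x) - F y‖ ^ q ∧
      ‖β γ (F x) - F y‖ ^ q ≤ b γ + ‖L.rep γ x.1 - y.1‖ + 2) :
    Nonempty (FibredCoarseEmbedding 𝕜 (WarpedCone L hS) W) := by
  classical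
  obtain ⟨ρ₁, ρ₂, hm₁, hm₂, ht₁, ht₂, hρ⟩ := exists_control_functions hfin hS hb0 hb
  have hq' : 0 ≤ q⁻¹ := by positivity
  have hmul : ∀ γ γ' v, β (γ * γ') v = β γ (β γ' v) := fun γ γ' v => by rw [map_mul]; rfl
  have htend : Tendsto (fun s : ℝ => max 0 s ^ q⁻¹) atTop atTop :=
    (tendsto_rpow_atTop (inv_pos.2 hq)).comp
      (tendsto_atTop_mono (fun s => le_max_right 0 s) tendsto_id)
  have hmono : ∀ {s s' : ℝ}, s ≤ s' → max 0 s ^ q⁻¹ ≤ max 0 s' ^ q⁻¹ := fun h =>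
    Real.rpow_le_rpow (le_max_left _ _) (max_le_max le_rfl h) hq'
  refine ⟨{
    fiber := fun _ => W
    sec := F
    ρ₁ := fun s => max 0 (ρ₁ s - 2) ^ q⁻¹
    ρ₂ := fun s => max 0 (ρ₂ s + 2) ^ q⁻¹
    monotone₁ := fun s _ s' _ h => hmono (sub_le_sub_right (hm₁ h) 2)
    monotone₂ := fun s hs s' hs' h => hmono (by linarith [hm₂ hs hs' h])
    tendsto₁ := htend.comp (tendsto_atTop_add_const_right _ (-2) ht₁)
    tendsto₂ := htend.comp (tendsto_atTop_add_const_right _ 2 ht₂)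
    exists_trivialization := fun r hr => ?_ }⟩
  obtain ⟨R, hR⟩ := exists_nat_ge r
  obtain ⟨T, hT⟩ := exists_forall_eq_of_norm_rep_sub_le L hfin hS hbot (2 * R) (4 * r)
  have hlen : ∀ {γ : Γ} {t : ℝ}, 0 ≤ t → wordLength S γ + t < r → wordLength S γ ≤ R := by
    intro γ t ht h
    have : (wordLength S γ : ℝ) ≤ R := by linarith
    exact_mod_cast this
  refine ⟨{x | ‖coneVec x‖ < T}, ?_, ?_⟩
  · refine Metric.isBounded_iff.2 ⟨2 * T, fun x hx y hy => ?_⟩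
    have h1 := dist_cone_le x y 1
    rw [wordLength_one, rep_one_apply, Nat.cast_zero, zero_add] at h1
    have h2 := norm_sub_le (coneVec x) (coneVec y)
    have h3 : ‖coneVec x‖ < T := hx
    have h4 : ‖coneVec y‖ < T := hy
    linarith
  have hdist : ∀ C ∈ smallSetsOff {x : WarpedCone L hS | ‖coneVec x‖ < T} r,
      ∀ x ∈ C, ∀ y ∈ C, dist x y < r := fun C hC x hx y hy =>
    (Metric.dist_le_diam_of_mem hC.2.1 hx hy).trans_lt hC.2.2
  have hbase : ∀ C ∈ smallSetsOff {x : WarpedCone L hS | ‖coneVec x‖ < T} r, ∃ c : H, ∀ x ∈ C,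
      ∃ γ : Γ, (c ∈ L.openCone ∧ T ≤ ‖c‖) ∧ wordLength S γ + ‖L.rep γ c - coneVec x‖ < r := by
    intro C hC
    rcases C.eq_empty_or_nonempty with rfl | ⟨c, hc⟩
    · exact ⟨0, fun x hx => hx.elim⟩
    · refine ⟨coneVec c, fun x hx => ?_⟩
      obtain ⟨γ, hγ⟩ := exists_wordLength_add_norm_lt (hdist C hC c hc x hx)
      exact ⟨γ, ⟨coneVec_mem c, not_lt.1 (hC.1 hc)⟩, hγ⟩
  choose c g hcT hg using hbase
  refine ⟨fun C hC x hx => (β (g C hC x hx))⁻¹, ?_, ?_⟩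
  · intro C hC x hx y hy
    obtain ⟨δ, hδ⟩ := exists_wordLength_add_norm_lt
      (lt_min (hdist C hC x hx y hy) (lt_add_one (dist x y)))
    have hδr := hδ.trans_le (min_le_left _ _)
    have hδd := hδ.trans_le (min_le_right _ _)
    have hgx := hg C hC x hx
    have hgy := hg C hC y hy
    obtain ⟨hcone, hcn⟩ := hcT C hC x hx
    -- The short elements satisfy `δ * g x = g y`, since both move the base point near `y`.
    have hδg : δ * g C hC x hx = g C hC y hy := by
      refine hT _ hcone hcn _ _ ?_ ?_ ?_
      · have h1 := wordLength_mul_le hS δ (g C hC x hx)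
        have h2 := hlen (norm_nonneg _) hδr
        have h3 := hlen (norm_nonneg _) hgx
        omega
      · have h3 := hlen (norm_nonneg _) hgy
        omega
      · rw [rep_mul_apply]
        have h1 : ‖L.rep δ (L.rep (g C hC x hx) (c C hC)) - L.rep δ (coneVec x)‖ =
            ‖L.rep (g C hC x hx) (c C hC) - coneVec x‖ := by
          rw [← map_sub, LinearIsometryEquiv.norm_map]
        have h2 := norm_sub_le_norm_sub_add_norm_sub
          (L.rep δ (L.rep (g C hC x hx) (c C hC))) (L.rep δ (coneVec x)) (coneVec y)
        have h3 := norm_sub_le_norm_sub_add_norm_sub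
          (L.rep δ (L.rep (g C hC x hx) (c C hC))) (coneVec y) (L.rep (g C hC y hy) (c C hC))
        rw [norm_sub_rev (coneVec y)] at h3
        have h4 : (0 : ℝ) ≤ wordLength S δ := Nat.cast_nonneg _
        have h5 : (0 : ℝ) ≤ wordLength S (g C hC x hx) := Nat.cast_nonneg _
        have h6 : (0 : ℝ) ≤ wordLength S (g C hC y hy) := Nat.cast_nonneg _
        linarith
    have hnorm : ‖(β (g C hC x hx))⁻¹ (F x) - (β (g C hC y hy))⁻¹ (F y)‖ =
        ‖β δ (F x) - F y‖ := by
      have h1 : (β (g C hC x hx))⁻¹ (F x) = (β (g C hC y hy))⁻¹ (β δ (F x)) := by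
        rw [← map_inv, ← map_inv, ← hmul, ← hδg]
        simp
      rw [h1]
      exact AffineIsometryEquiv.norm_sub_map _ _ _
    rw [hnorm]
    obtain ⟨hF₁, hF₂⟩ := hF δ x y
    obtain ⟨hρ₁, hρ₂⟩ := hρ δ _ (norm_nonneg (L.rep δ (coneVec x) - coneVec y)) (dist x y)
    have hρ₁ := hρ₁ (dist_cone_le x y δ)
    have hρ₂ := hρ₂ hδd.le
    have hpow : ‖β δ (F x) - F y‖ = (‖β δ (F x) - F y‖ ^ q) ^ q⁻¹ :=
      (Real.rpow_rpow_inv (norm_nonneg _) hq.ne').symm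
    rw [hpow]
    have h0 : 0 ≤ ‖β δ (F x) - F y‖ ^ q := by positivity
    constructor
    · refine Real.rpow_le_rpow (le_max_left _ _) (max_le h0 ?_) hq'
      exact (sub_le_sub_right hρ₁ 2).trans hF₁
    · refine Real.rpow_le_rpow h0 (le_max_of_le_right ?_) hq'
      exact hF₂.trans (add_le_add_left hρ₂ 2)
  · rintro C₁ hC₁ C₂ hC₂ ⟨z, hz₁, hz₂⟩
    -- The quotient of the two short elements does not depend on the point.
    have hconst : ∀ x (hx₁ : x ∈ C₁) (hx₂ : x ∈ C₂), (g C₂ hC₂ x hx₂)⁻¹ * g C₁ hC₁ x hx₁ =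
        (g C₂ hC₂ z hz₂)⁻¹ * g C₁ hC₁ z hz₁ := by
      intro x hx₁ hx₂
      obtain ⟨hcone, hcn⟩ := hcT C₁ hC₁ z hz₁
      have hlen' : ∀ y (hy₁ : y ∈ C₁) (hy₂ : y ∈ C₂),
          wordLength S ((g C₂ hC₂ y hy₂)⁻¹ * g C₁ hC₁ y hy₁) ≤ 2 * R := fun y hy₁ hy₂ => by
        have h1 := wordLength_mul_le hS (g C₂ hC₂ y hy₂)⁻¹ (g C₁ hC₁ y hy₁)
        have h2 := hlen (norm_nonneg _) (hg C₁ hC₁ y hy₁)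
        have h3 := hlen (norm_nonneg _) (hg C₂ hC₂ y hy₂)
        rw [wordLength_inv] at h1
        omega
      have hnear : ∀ y (hy₁ : y ∈ C₁) (hy₂ : y ∈ C₂),
          ‖L.rep ((g C₂ hC₂ y hy₂)⁻¹ * g C₁ hC₁ y hy₁) (c C₁ hC₁) - c C₂ hC₂‖ ≤ 2 * r :=
        fun y hy₁ hy₂ => by
        have h1 : ‖L.rep ((g C₂ hC₂ y hy₂)⁻¹ * g C₁ hC₁ y hy₁) (c C₁ hC₁) - c C₂ hC₂‖ =
            ‖L.rep (g C₁ hC₁ y hy₁) (c C₁ hC₁) - L.rep (g C₂ hC₂ y hy₂) (c C₂ hC₂)‖ := by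
          rw [← (L.rep (g C₂ hC₂ y hy₂)).norm_map, map_sub, ← rep_mul_apply, mul_inv_cancel_left]
        have h2 := norm_sub_le_norm_sub_add_norm_sub
          (L.rep (g C₁ hC₁ y hy₁) (c C₁ hC₁)) (coneVec y) (L.rep (g C₂ hC₂ y hy₂) (c C₂ hC₂))
        rw [norm_sub_rev (coneVec y)] at h2
        have h3 := hg C₁ hC₁ y hy₁
        have h4 := hg C₂ hC₂ y hy₂
        have h5 : (0 : ℝ) ≤ wordLength S (g C₁ hC₁ y hy₁) := Nat.cast_nonneg _
        have h6 : (0 : ℝ) ≤ wordLength S (g C₂ hC₂ y hy₂) := Nat.cast_nonneg _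
        linarith
      refine hT _ hcone hcn _ _ (hlen' x hx₁ hx₂) (hlen' z hz₁ hz₂) ?_
      have h1 := norm_sub_le_norm_sub_add_norm_sub
        (L.rep ((g C₂ hC₂ x hx₂)⁻¹ * g C₁ hC₁ x hx₁) (c C₁ hC₁)) (c C₂ hC₂)
        (L.rep ((g C₂ hC₂ z hz₂)⁻¹ * g C₁ hC₁ z hz₁) (c C₁ hC₁))
      rw [norm_sub_rev (c C₂ hC₂)] at h1
      have h2 := hnear x hx₁ hx₂
      have h3 := hnear z hz₁ hz₂
      linarith
    refine ⟨β ((g C₂ hC₂ z hz₂)⁻¹ * g C₁ hC₁ z hz₁)⁻¹, fun x hx₁ hx₂ => ?_⟩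
    rw [← hconst x hx₁ hx₂, mul_inv_rev, inv_inv, map_mul, map_inv]
    rfl

variable {p : ℝ≥0∞} [Fact (1 ≤ p)]

/-- A proper affine isometric action on a space of a class closed under `ℓ_p`-sums and ultrapowers
gives a fibred coarse embedding of the warped cone into a space of this class. -/
theorem fibredCoarseEmbedsInto_cone_of_actsProperlyOn [∀ n, (N n).FiniteIndex] (hp : p ≠ ∞)
    (hfin : S.Finite) (hS : Subgroup.closure S = ⊤) (hbot : ⨅ n, N n = ⊥) {B : BanachClass.{w} 𝕜}
    (hB : HasLpSumsAndUltrapowers p B) (h : ActsProperlyOn S B) :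
    FibredCoarseEmbedsInto (WarpedCone L hS) (WarpedCone.instMetricSpace L hS) B := by
  -- If `Γ` is bounded, the trivial action on a nonzero space of the class is proper.
  have h' : ∃ (E : Type w) (_ : NormedAddCommGroup E) (_ : NormedSpace 𝕜 E) (_ : CompleteSpace E),
      B E ∧ Nontrivial E ∧ Nonempty (ProperAffineIsometricAction 𝕜 S E) := by
    obtain ⟨E, i1, i2, i3, hE, ⟨α⟩⟩ := h
    rcases subsingleton_or_nontrivial E with hsub | hnt
    · obtain ⟨E', j1, j2, j3, hE', hnt⟩ := hB.exists_nontrivial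
      refine ⟨E', j1, j2, j3, hE', hnt, ⟨⟨1, ?_⟩⟩⟩
      have h1 : Tendsto (fun _ : Γ => (0 : ℝ)) (comap (wordLength S) atTop) atTop :=
        α.proper.congr fun γ => by rw [Subsingleton.elim (α.act γ 0) 0, norm_zero]
      exact h1.congr fun γ => by simp
    · exact ⟨E, i1, i2, i3, hE, hnt, ⟨α⟩⟩
  obtain ⟨E, i1, i2, i3, hE, hnt, ⟨α⟩⟩ := h'
  have hU : ((hyperfilter ℕ : Ultrafilter ℕ) : Filter ℕ) ≤ atTop :=
    Nat.cofinite_eq_atTop ▸ hyperfilter_le_cofinite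
  obtain ⟨J, hJ, β, F, hF⟩ := exists_action_and_map L hp (hyperfilter ℕ) hU α.act
  have hq := toReal_pos_of_one_le p hp
  exact ⟨_, inferInstance, inferInstance, inferInstance,
    hB.ultra _ _ hyperfilter_le_cofinite (hB.lpSum E J hE),
    nonempty_fibredCoarseEmbedding_cone L hfin hS hbot β F hq (fun γ => Real.rpow_nonneg (norm_nonneg _) _)
      ((tendsto_rpow_atTop hq).comp α.proper) hF⟩

end ActionToCone

/-! ### From the warped cone to the box space -/

section ConeToBox

variable {𝕜 : Type} [RCLike 𝕜]

/-- Pull back of a fibred coarse embedding along a map that is almost isometric at small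
distances and far away. -/
noncomputable def FibredCoarseEmbedding.pullback {X : Type*} [MetricSpace X] {Y : Type*}
    [MetricSpace Y] {E : Type w} [NormedAddCommGroup E] [NormedSpace 𝕜 E]
    (F : FibredCoarseEmbedding 𝕜 X E) (φ : Y → X)
    (hφ : ∀ (r : ℝ) (K : Set X), Bornology.IsBounded K → ∃ K' : Set Y, Bornology.IsBounded K' ∧
      ∀ x ∉ K', φ x ∉ K ∧ ∀ y ∉ K', dist x y < r →
        dist x y ≤ dist (φ x) (φ y) ∧ dist (φ x) (φ y) ≤ dist x y + 1) :
    FibredCoarseEmbedding 𝕜 Y E :=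
  letI := F.fiberGroup
  letI := F.fiberSpace
  letI := F.fiberComplete
  { fiber := fun y => F.fiber (φ y)
    sec := fun y => F.sec (φ y)
    ρ₁ := F.ρ₁
    ρ₂ := fun s => F.ρ₂ (s + 1)
    monotone₁ := F.monotone₁
    monotone₂ := fun a ha b hb hab => F.monotone₂
      (show 0 ≤ a + 1 from add_nonneg ha zero_le_one)
      (show 0 ≤ b + 1 from add_nonneg hb zero_le_one) (by linarith)
    tendsto₁ := F.tendsto₁
    tendsto₂ := F.tendsto₂.comp (tendsto_atTop_add_const_right _ _ tendsto_id)
    exists_trivialization := fun r hr => by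
      obtain ⟨K, hK, t, ht1, ht2⟩ := F.exists_trivialization (r + 2) (by linarith)
      obtain ⟨K', hK', hφK⟩ := hφ r K hK
      have hdist : ∀ C ∈ smallSetsOff K' r, ∀ x ∈ C, ∀ y ∈ C,
          dist x y ≤ dist (φ x) (φ y) ∧ dist (φ x) (φ y) ≤ dist x y + 1 := fun C hC x hx y hy =>
        (hφK x (hC.1 hx)).2 y (hC.1 hy)
          ((Metric.dist_le_diam_of_mem hC.2.1 hx hy).trans_lt hC.2.2)
      have himg : ∀ C ∈ smallSetsOff K' r, φ '' C ∈ smallSetsOff K (r + 2) := by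
        intro C hC
        have hle : ∀ a ∈ φ '' C, ∀ b ∈ φ '' C, dist a b ≤ r + 1 := by
          rintro _ ⟨x, hx, rfl⟩ _ ⟨y, hy, rfl⟩
          have h1 := (hdist C hC x hx y hy).2
          have h2 := (Metric.dist_le_diam_of_mem hC.2.1 hx hy).trans_lt hC.2.2
          linarith
        refine ⟨?_, ?_, ?_⟩
        · rintro _ ⟨x, hx, rfl⟩
          exact (hφK x (hC.1 hx)).1
        · exact Metric.isBounded_iff.2 ⟨r + 1, fun a ha b hb => hle a ha b hb⟩
        · exact (Metric.diam_le_of_forall_dist_le (by linarith) hle).trans_lt (by linarith)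
      refine ⟨K', hK', fun C hC x hx => t (φ '' C) (himg C hC) (φ x) ⟨x, hx, rfl⟩, ?_, ?_⟩
      · intro C hC x hx y hy
        have h := ht1 (φ '' C) (himg C hC) (φ x) ⟨x, hx, rfl⟩ (φ y) ⟨y, hy, rfl⟩
        have hd := hdist C hC x hx y hy
        exact ⟨(F.monotone₁ dist_nonneg dist_nonneg hd.1).trans h.1,
          h.2.trans (F.monotone₂ dist_nonneg (add_nonneg dist_nonneg zero_le_one) hd.2)⟩
      · rintro C₁ hC₁ C₂ hC₂ ⟨z, hz₁, hz₂⟩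
        obtain ⟨T, hT⟩ := ht2 (φ '' C₁) (himg C₁ hC₁) (φ '' C₂) (himg C₂ hC₂)
          ⟨φ z, ⟨z, hz₁, rfl⟩, ⟨z, hz₂, rfl⟩⟩
        exact ⟨T, fun x hx₁ hx₂ => hT (φ x) ⟨x, hx₁, rfl⟩ ⟨x, hx₂, rfl⟩⟩ }

variable {Γ : Type u} [Group Γ] {S : Set Γ} {N : ℕ → Subgroup Γ}

theorem BoxSpace.isBounded_lt [∀ n, (N n).FiniteIndex] (d : MetricSpace (BoxSpace N)) (n₀ : ℕ) :
    Bornology.IsBounded {x : BoxSpace N | x.1 < n₀} := by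
  refine Set.Finite.isBounded ?_
  have hfin : (⋃ n ∈ Set.Iio n₀, Set.range fun q : Γ ⧸ N n => (⟨n, q⟩ : BoxSpace N)).Finite :=
    (Set.finite_Iio n₀).biUnion fun n _ => Set.finite_range _
  refine hfin.subset ?_
  rintro ⟨n, q⟩ h
  exact Set.mem_iUnion₂.2 ⟨n, h, q, rfl⟩

variable [∀ n, (N n).Normal] {hN : Antitone N}

variable {H : Type v} [NormedAddCommGroup H] [InnerProductSpace ℂ H]
  (L : UnitaryLinearization Γ (profiniteCompletion N hN) H)

/-- Radii that tend to infinity so slowly that the fibers of the coordinate maps have diameter at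
most one at the corresponding height of the cone. -/
theorem exists_radii : ∃ t : ℕ → ℕ, Tendsto t atTop atTop ∧
    ∀ n g h, g.1 n = h.1 n → t n * ‖L.emb g - L.emb h‖ ≤ 1 := by
  classical
  let Q : ℕ → ℕ → Prop := fun n k => ∀ g h : profiniteCompletion N hN, g.1 n = h.1 n →
    k * ‖L.emb g - L.emb h‖ ≤ 1
  refine ⟨fun n => Nat.findGreatest (Q n) n, ?_, fun n => ?_⟩
  · refine tendsto_atTop.2 fun k => ?_
    obtain ⟨n₀, hn₀⟩ := exists_norm_emb_sub_le L (ε := 1 / (k + 1 : ℝ)) (by positivity)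
    filter_upwards [eventually_ge_atTop n₀, eventually_ge_atTop k] with n hn hk
    refine Nat.le_findGreatest hk fun g h hgh => ?_
    have h1 := hn₀ n hn g h hgh
    rw [le_div_iff₀ (by positivity)] at h1
    nlinarith [norm_nonneg (L.emb g - L.emb h)]
  · exact Nat.findGreatest_spec (P := Q n) (Nat.zero_le n) fun g h _ => by simp

/-- A fibred coarse embedding of the warped cone induces one of the box space. -/
theorem fibredCoarseEmbedsInto_box_of_cone [∀ n, (N n).FiniteIndex] (hfin : S.Finite)
    (hS : Subgroup.closure S = ⊤) (hbot : ⨅ n, N n = ⊥) (d : MetricSpace (BoxSpace N))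
    (hd : IsBoxMetric S N d) (B : BanachClass.{w} 𝕜)
    (h : FibredCoarseEmbedsInto (WarpedCone L hS) (WarpedCone.instMetricSpace L hS) B) :
    FibredCoarseEmbedsInto (BoxSpace N) d B := by
  obtain ⟨E, i1, i2, i3, hE, ⟨F⟩⟩ := h
  obtain ⟨t, ht, htN⟩ := exists_radii L
  -- The inverse turns the left invariant metric of the box space into displacements by the left
  -- action of `Γ`.
  let φ : BoxSpace N → WarpedCone L hS := fun x =>
    (⟨(((t x.1 : ℝ) : ℂ)) • liftVec L x.1 x.2⁻¹, t x.1, _, Nat.cast_nonneg _, rfl⟩ : L.openCone)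
  have hφ : ∀ n q, coneVec (φ ⟨n, q⟩) = (((t n : ℝ) : ℂ)) • liftVec L n q⁻¹ := fun n q => rfl
  have hnorm : ∀ n q, ‖coneVec (φ ⟨n, q⟩)‖ = t n := fun n q => by
    rw [hφ, norm_smul, liftVec, L.norm_emb, mul_one, Complex.norm_real, Real.norm_natCast]
  refine ⟨E, i1, i2, i3, hE, ⟨F.pullback φ fun r K hK => ?_⟩⟩
  obtain ⟨R, hrR⟩ := exists_nat_gt r
  obtain ⟨T, hT⟩ := exists_forall_eq_of_norm_rep_sub_le L hfin hS hbot R (r + 1)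
  obtain ⟨T', hT'⟩ : ∃ T', ∀ x ∈ K, ‖coneVec x‖ ≤ T' := by
    rcases K.eq_empty_or_nonempty with rfl | ⟨x₀, hx₀⟩
    · exact ⟨0, by simp⟩
    · obtain ⟨D, hD⟩ := Metric.isBounded_iff.1 hK
      refine ⟨‖coneVec x₀‖ + D, fun x hx => ?_⟩
      have h1 := abs_norm_sub_norm_le_dist x x₀
      have h2 := hD hx hx₀
      linarith [le_abs_self (‖coneVec x‖ - ‖coneVec x₀‖)]
  obtain ⟨n₁, hn₁⟩ := hd.dist_ne r
  have htR : Tendsto (fun n => (t n : ℝ)) atTop atTop := tendsto_natCast_atTop_atTop.comp ht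
  obtain ⟨n₂, hn₂⟩ := eventually_atTop.1
    ((htR.eventually_ge_atTop T).and (htR.eventually_gt_atTop T'))
  refine ⟨{x | x.1 < max n₁ n₂}, BoxSpace.isBounded_lt d _, ?_⟩
  rintro ⟨n, x⟩ hx
  have hxn : max n₁ n₂ ≤ n := not_lt.1 hx
  have hn := hn₂ n ((le_max_right _ _).trans hxn)
  refine ⟨fun hK' => ?_, ?_⟩
  · have := hT' _ hK'
    rw [hnorm] at this
    linarith [hn.2]
  rintro ⟨m, y⟩ hy hxy
  obtain rfl : n = m := by
    by_contra hne
    exact absurd hxy (not_lt.2 (hn₁ n m hne (by have := le_max_left n₁ n₂; omega) x y))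
  rw [hd.dist_same n x y] at hxy ⊢
  obtain ⟨γ₀, hγ₀, hle⟩ := exists_lift_wordLength_le hS (N n) (y⁻¹ * x)
  have hsymm : wordLength ((fun s : Γ => (s : Γ ⧸ N n)) '' S) (x⁻¹ * y) =
      wordLength ((fun s : Γ => (s : Γ ⧸ N n)) '' S) (y⁻¹ * x) := by
    rw [← wordLength_inv, mul_inv_rev, inv_inv]
  have heq : wordLength ((fun s : Γ => (s : Γ ⧸ N n)) '' S) (x⁻¹ * y) = wordLength S γ₀ := by
    refine le_antisymm ?_ (hsymm ▸ hle)
    rw [hsymm, ← hγ₀]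
    exact wordLength_map_le hS (N n) γ₀
  rw [heq] at hxy ⊢
  have hclose : ‖L.rep γ₀ (coneVec (φ ⟨n, x⟩)) - coneVec (φ ⟨n, y⟩)‖ ≤ 1 := by
    rw [hφ, hφ, map_smul, ← smul_sub, norm_smul, Complex.norm_real, Real.norm_natCast, rep_liftVec]
    refine htN n _ _ ?_
    rw [profiniteCompletion.coord_smul, toProfiniteCompletion_out_coord,
      toProfiniteCompletion_out_coord, hγ₀]
    group
  constructor
  · by_contra! hlt
    obtain ⟨γ, hγ⟩ := exists_wordLength_add_norm_lt hlt
    have hlt' : (wordLength S γ : ℝ) < wordLength S γ₀ := by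
      linarith [norm_nonneg (L.rep γ (coneVec (φ ⟨n, x⟩)) - coneVec (φ ⟨n, y⟩))]
    have hR0 : wordLength S γ₀ ≤ R := by exact_mod_cast (hxy.trans hrR).le
    have : γ = γ₀ := by
      refine hT _ (coneVec_mem (φ ⟨n, x⟩)) (by rw [hnorm]; exact hn.1) γ γ₀ ?_ hR0 ?_
      · exact_mod_cast (hlt'.trans (hxy.trans hrR)).le
      · have h1 := norm_sub_le_norm_sub_add_norm_sub (L.rep γ (coneVec (φ ⟨n, x⟩)))
          (coneVec (φ ⟨n, y⟩)) (L.rep γ₀ (coneVec (φ ⟨n, x⟩)))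
        rw [norm_sub_rev (coneVec (φ ⟨n, y⟩))] at h1
        have h2 : (0 : ℝ) ≤ wordLength S γ := Nat.cast_nonneg _
        linarith
    rw [this] at hlt'
    exact lt_irrefl _ hlt'
  · exact (dist_cone_le _ _ γ₀).trans (by linarith)

end ConeToBox

/-! ### From the box space to an action -/

section BoxToAction

theorem exists_level_wordLength {Γ : Type u} [Group Γ] {S : Set Γ} {N : ℕ → Subgroup Γ}
    (hN : Antitone N) (hfin : S.Finite) (hS : Subgroup.closure S = ⊤) (hbot : ⨅ n, N n = ⊥)
    (R : ℕ) : ∀ᶠ n in atTop, ∀ h ∈ N n, wordLength S h ≤ R → h = 1 := by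
  have h1 : ∀ᶠ n in atTop, ∀ h ∈ {h : Γ | wordLength S h ≤ R}, h ∈ N n → h = 1 := by
    refine (eventually_all_finite (finite_wordLength_le hfin hS R)).2 fun h _ => ?_
    by_cases h1 : h = 1
    · exact Eventually.of_forall fun _ _ => h1
    · obtain ⟨m, hm⟩ : ∃ m, h ∉ N m := by
        by_contra! hc
        exact h1 (by simpa [hbot] using (Subgroup.mem_iInf.2 hc : h ∈ ⨅ n, N n))
      filter_upwards [eventually_ge_atTop m] with n hn hmem
      exact absurd (hN hn hmem) hm
  filter_upwards [h1] with n hn h hmem hle using hn h hle hmem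

variable {𝕜 : Type} [RCLike 𝕜] {E : Type w} [NormedAddCommGroup E] [NormedSpace 𝕜 E]

/-- The conjugate `v ↦ A (v + u) - u'` of an affine isometry by two translations. -/
noncomputable def translationConj (A : E ≃ᵃⁱ[𝕜] E) (u u' : E) : E ≃ᵃⁱ[𝕜] E :=
  ((AffineIsometryEquiv.constVAdd 𝕜 E u).trans A).trans (AffineIsometryEquiv.constVAdd 𝕜 E (-u'))

@[simp] theorem translationConj_apply (A : E ≃ᵃⁱ[𝕜] E) (u u' v : E) :
    translationConj A u u' v = A (v + u) - u' := by
  simp [translationConj, add_comm, sub_eq_add_neg]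

variable {Γ : Type u} [Group Γ] {S : Set Γ} {N : ℕ → Subgroup Γ} [∀ n, (N n).Normal]

/-- The trivializations of a fibred coarse embedding of a box space over the balls of radius `k`
of a late quotient `Γ ⧸ N n` compare along right translations by affine isometries `A γ x`, which
form a cocycle on the ball of radius `k` of `Γ`. Translating each of them by the value of the
section at the centre of the ball yields displacements of the origin controlled by `ρ₁` and
`ρ₂`. -/
theorem exists_partial_cocycle [∀ n, (N n).FiniteIndex] (hN : Antitone N) (hfin : S.Finite)
    (hS : Subgroup.closure S = ⊤) (hbot : ⨅ n, N n = ⊥) (d : MetricSpace (BoxSpace N))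
    (hd : IsBoxMetric S N d) (F : FibredCoarseEmbedding 𝕜 (BoxSpace N) E) (k : ℕ) :
    ∃ (n : ℕ) (A : Γ → (Γ ⧸ N n) → (E ≃ᵃⁱ[𝕜] E)),
      (∀ γ γ', wordLength S γ ≤ k → wordLength S γ' ≤ k → wordLength S (γ * γ') ≤ k →
        ∀ x v, A (γ * γ') x v = A γ x (A γ' (x * (γ : Γ ⧸ N n)) v)) ∧
      ∀ γ, wordLength S γ ≤ k → ∀ x,
        F.ρ₁ (wordLength S γ) ≤ ‖A γ x 0‖ ∧ ‖A γ x 0‖ ≤ F.ρ₂ (wordLength S γ) := by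
  classical
  let _ := F.fiberGroup
  let _ := F.fiberSpace
  obtain ⟨K, hK, t, ht1, ht2⟩ := F.exists_trivialization (2 * k + 1) (by positivity)
  obtain ⟨n₀, hn₀⟩ : ∃ n₀, ∀ n ≥ n₀, ∀ x : Γ ⧸ N n, (⟨n, x⟩ : BoxSpace N) ∉ K := by
    rcases K.eq_empty_or_nonempty with rfl | ⟨⟨m, x₀⟩, hx₀⟩
    · exact ⟨0, fun _ _ _ => id⟩
    · obtain ⟨D, hD⟩ := Metric.isBounded_iff.1 hK
      obtain ⟨l, hl⟩ := hd.dist_ne (D + 1)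
      refine ⟨max l (m + 1), fun n hn x hx => ?_⟩
      have h1 := hl n m (by have := le_max_right l (m + 1); omega)
        (by have := le_max_left l (m + 1); omega) x x₀
      have h2 : d.dist ⟨n, x⟩ ⟨m, x₀⟩ ≤ D := hD hx hx₀
      linarith
  obtain ⟨n, hnK, hnS⟩ := ((eventually_ge_atTop n₀).and
    (exists_level_wordLength hN hfin hS hbot (2 * k))).exists
  let pt : (Γ ⧸ N n) → BoxSpace N := fun x => ⟨n, x⟩
  have hdist : ∀ γ, wordLength S γ ≤ k → ∀ x : Γ ⧸ N n,
      dist (pt x) (pt (x * (γ : Γ ⧸ N n))) = wordLength S γ := by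
    intro γ hγ x
    refine (hd.dist_same n _ _).trans ?_
    rw [inv_mul_cancel_left, wordLength_mk_eq hS (N n) (by omega) hnS]
  let C : (Γ ⧸ N n) → Set (BoxSpace N) := fun x =>
    {z | ∃ γ : Γ, wordLength S γ ≤ k ∧ z = (pt (x * (γ : Γ ⧸ N n)))}
  have hCmem : ∀ γ, wordLength S γ ≤ k → ∀ x, pt (x * (γ : Γ ⧸ N n)) ∈ C x :=
    fun γ hγ x => ⟨γ, hγ, rfl⟩
  have hself : ∀ x, pt x ∈ C x := fun x =>
    ⟨1, by simp [wordLength_one], by rw [QuotientGroup.mk_one, mul_one]⟩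
  have hC : ∀ x, C x ∈ smallSetsOff K (2 * k + 1) := by
    intro x
    have hle : ∀ a ∈ C x, ∀ b ∈ C x, dist a b ≤ 2 * k := by
      rintro _ ⟨γ, hγ, rfl⟩ _ ⟨γ', hγ', rfl⟩
      have h1 := dist_triangle_left (pt (x * (γ : Γ ⧸ N n)))
        (pt (x * (γ' : Γ ⧸ N n))) (pt x)
      have h2 : dist (pt x) (pt (x * (γ : Γ ⧸ N n))) = _ := hdist γ hγ x
      have h3 : dist (pt x) (pt (x * (γ' : Γ ⧸ N n))) = _ := hdist γ' hγ' x
      have h4 : (wordLength S γ : ℝ) ≤ k := by exact_mod_cast hγ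
      have h5 : (wordLength S γ' : ℝ) ≤ k := by exact_mod_cast hγ'
      linarith
    refine ⟨?_, Metric.isBounded_iff.2 ⟨2 * k, fun a ha b hb => hle a ha b hb⟩,
      (Metric.diam_le_of_forall_dist_le (by positivity) hle).trans_lt (by linarith)⟩
    rintro _ ⟨γ, -, rfl⟩
    exact hn₀ n hnK _
  let u : (Γ ⧸ N n) → E := fun x => t (C x) (hC x) (pt x) (hself x) (F.sec (pt x))
  let A₀ : Γ → (Γ ⧸ N n) → (E ≃ᵃⁱ[𝕜] E) := fun γ x =>
    if h : wordLength S γ ≤ k then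
      (t (C (x * (γ : Γ ⧸ N n))) (hC _) (pt (x * (γ : Γ ⧸ N n))) (hself _)).symm.trans
        (t (C x) (hC x) (pt (x * (γ : Γ ⧸ N n))) (hCmem γ h x))
    else .refl 𝕜 E
  -- The transition may be computed at any common point of the two balls.
  have hA₀ : ∀ γ, wordLength S γ ≤ k → ∀ x z (h₁ : z ∈ C x) (h₂ : z ∈ C (x * (γ : Γ ⧸ N n))) (v),
      A₀ γ x (t _ (hC (x * (γ : Γ ⧸ N n))) z h₂ v) = t _ (hC x) z h₁ v := by
    intro γ hγ x z h₁ h₂ v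
    obtain ⟨T, hT⟩ := ht2 (C x) (hC x) (C (x * (γ : Γ ⧸ N n))) (hC _) ⟨z, h₁, h₂⟩
    have h3 : A₀ γ x = T := by
      simp only [A₀, dif_pos hγ]
      exact hT _ (hCmem γ hγ x) (hself _)
    rw [h3, ← hT z h₁ h₂]
    simp
  refine ⟨n, fun γ x => translationConj (A₀ γ x) (u (x * (γ : Γ ⧸ N n))) (u x), ?_, ?_⟩
  · intro γ γ' hγ hγ' hγγ' x v
    simp only [translationConj_apply, sub_add_cancel]
    congr 1
    have hmul : x * ((γ * γ' : Γ) : Γ ⧸ N n) = x * (γ : Γ ⧸ N n) * (γ' : Γ ⧸ N n) := by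
      rw [QuotientGroup.mk_mul, mul_assoc]
    have hz₂ : pt (x * ((γ * γ' : Γ) : Γ ⧸ N n)) ∈ C (x * (γ : Γ ⧸ N n)) := by
      rw [hmul]; exact hCmem γ' hγ' _
    have hz₃ : pt (x * ((γ * γ' : Γ) : Γ ⧸ N n)) ∈
        C (x * (γ : Γ ⧸ N n) * (γ' : Γ ⧸ N n)) := by
      rw [hmul]; exact hself _
    rw [← hmul]
    obtain ⟨v', hv'⟩ := (t _ (hC (x * ((γ * γ' : Γ) : Γ ⧸ N n))) _ (hself _)).surjective
      (v + u (x * ((γ * γ' : Γ) : Γ ⧸ N n)))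
    rw [← hv', hA₀ (γ * γ') hγγ' x _ (hCmem _ hγγ' x) (hself _) v']
    have h1 := hA₀ γ' hγ' (x * (γ : Γ ⧸ N n)) _ hz₂ hz₃ v'
    have h2 := hA₀ γ hγ x _ (hCmem _ hγγ' x) hz₂ v'
    rw [← h2, ← h1]
    congr 2
    simp only [hmul]
  · intro γ hγ x
    have h1 := ht1 (C x) (hC x) _ (hself x) _ (hCmem γ hγ x)
    have h2 : dist (pt x) (pt (x * (γ : Γ ⧸ N n))) = _ := hdist γ hγ x
    rw [h2, norm_sub_rev] at h1
    simpa only [translationConj_apply, zero_add, u, hA₀ γ hγ x _ (hCmem γ hγ x) (hself _)] using h1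

variable {p : ℝ≥0∞} [Fact (1 ≤ p)]

/-- A function that vanishes off one block is summed over this block. -/
theorem hasSum_block {J : Type*} {Q : ℕ → Type*} [∀ k, Fintype (Q k)] (e : J ≃ Σ k, Q k)
    {f : J → ℝ} (k : ℕ) (hf : ∀ j, (e j).1 ≠ k → f j = 0) :
    HasSum f (∑ x, f (e.symm ⟨k, x⟩)) := by
  have hinj : Function.Injective fun x : Q k => e.symm ⟨k, x⟩ :=
    e.symm.injective.comp sigma_mk_injective
  refine (hinj.hasSum_iff fun j hj => hf j fun h => hj ?_).1 (hasSum_fintype _)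
  subst h
  exact ⟨(e j).2, e.symm_apply_apply j⟩

/-- The affine isometry with the linear part of `A` and the translation part scaled by `c`. -/
noncomputable def scaleTranslation (c : ℝ) (A : E ≃ᵃⁱ[𝕜] E) : E ≃ᵃⁱ[𝕜] E :=
  affineIsometryOf A.linearIsometryEquiv ((c : 𝕜) • A 0)

theorem scaleTranslation_apply (c : ℝ) (A : E ≃ᵃⁱ[𝕜] E) (v : E) :
    scaleTranslation c A v = A v - A 0 + (c : 𝕜) • A 0 := by
  rw [scaleTranslation, affineIsometryOf_apply, A.apply_eq_linear_add v, add_sub_cancel_right]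

theorem scaleTranslation_zero (c : ℝ) (A : E ≃ᵃⁱ[𝕜] E) :
    scaleTranslation c A 0 = (c : 𝕜) • A 0 := by
  simp [scaleTranslation_apply]

theorem scaleTranslation_comp (c : ℝ) {A A' A'' : E ≃ᵃⁱ[𝕜] E} (h : ∀ v, A'' v = A (A' v)) (v : E) :
    scaleTranslation c A'' v = scaleTranslation c A (scaleTranslation c A' v) := by
  have h0 : A'' 0 = A.linearIsometryEquiv (A' 0) + A 0 := by rw [h, A.apply_eq_linear_add (A' 0)]
  have h1 : A''.linearIsometryEquiv v = A.linearIsometryEquiv (A'.linearIsometryEquiv v) := by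
    have h2 := A''.apply_eq_linear_add v
    rw [h, A.apply_eq_linear_add (A' v), A'.apply_eq_linear_add v, h0, map_add, add_assoc] at h2
    exact (add_right_cancel h2).symm
  rw [scaleTranslation, scaleTranslation, scaleTranslation, affineIsometryOf_apply,
    affineIsometryOf_apply, affineIsometryOf_apply, h0, h1, map_add, map_smul, smul_add, add_assoc]

/-- A fibred coarse embedding of the box space into a space of a class closed under `ℓ_p`-sums and
ultrapowers gives a proper affine isometric action on a space of this class. -/
theorem actsProperlyOn_of_box [∀ n, (N n).FiniteIndex] (hp : p ≠ ∞) (hN : Antitone N)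
    (hfin : S.Finite) (hS : Subgroup.closure S = ⊤) (hbot : ⨅ n, N n = ⊥)
    (d : MetricSpace (BoxSpace N)) (hd : IsBoxMetric S N d) {B : BanachClass.{w} 𝕜}
    (hB : HasLpSumsAndUltrapowers p B) (h : FibredCoarseEmbedsInto (BoxSpace N) d B) :
    ActsProperlyOn S B := by
  classical
  obtain ⟨E, i1, i2, i3, hE, ⟨F⟩⟩ := h
  choose n A hmul hnorm using exists_partial_cocycle hN hfin hS hbot d hd F
  have hq := toReal_pos_of_one_le p hp
  set q := p.toReal with hqdef
  let _ : ∀ k, Fintype (Γ ⧸ N (n k)) := fun k => Fintype.ofFinite _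
  obtain ⟨J, hJ, ⟨e⟩⟩ : ∃ J : Type, Countable J ∧ Nonempty (J ≃ Σ k, Γ ⧸ N (n k)) :=
    ⟨Shrink.{0} (Σ k, Γ ⧸ N (n k)), (equivShrink _).symm.countable_iff.2 inferInstance,
      ⟨(equivShrink _).symm⟩⟩
  -- The normalization turns the `ℓ_p`-norm over a block into an average.
  let c : ℕ → ℝ := fun k => (Fintype.card (Γ ⧸ N (n k)) : ℝ) ^ (-(1 / q))
  have hcq : ∀ k, c k ^ q = (Fintype.card (Γ ⧸ N (n k)) : ℝ)⁻¹ := fun k => by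
    rw [← Real.rpow_mul (Nat.cast_nonneg _), neg_mul, one_div_mul_cancel hq.ne', Real.rpow_neg_one]
  have hc0 : ∀ k, 0 ≤ c k := fun k => by positivity
  let σ : Γ → Equiv.Perm J := fun γ =>
    (e.trans (Equiv.sigmaCongrRight fun k => Equiv.mulRight (γ : Γ ⧸ N (n k)))).trans e.symm
  have hσ : ∀ γ j, e (σ γ j) = ⟨(e j).1, (e j).2 * (γ : Γ ⧸ N (n (e j).1))⟩ := fun γ j => by
    simp [σ, Equiv.sigmaCongrRight]
  let D : ℕ → Γ → (Σ k, Γ ⧸ N (n k)) → (E ≃ᵃⁱ[𝕜] E) := fun k γ s =>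
    if s.1 = k ∧ wordLength S γ ≤ k then scaleTranslation (c s.1) (A s.1 γ s.2) else .refl 𝕜 E
  let A' : ℕ → Γ → J → (E ≃ᵃⁱ[𝕜] E) := fun k γ j => D k γ (e j)
  have hA'0 : ∀ k γ j, (e j).1 ≠ k → A' k γ j 0 = 0 := fun k γ j hj => by
    simp [A', D, hj]
  have hA'1 : ∀ k γ, wordLength S γ ≤ k → ∀ x,
      ‖A' k γ (e.symm ⟨k, x⟩) 0‖ ^ q = (Fintype.card (Γ ⧸ N (n k)) : ℝ)⁻¹ * ‖A k γ x 0‖ ^ q := by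
    intro k γ hγ x
    have h1 : A' k γ (e.symm ⟨k, x⟩) = scaleTranslation (c k) (A k γ x) := by
      simp only [A', Equiv.apply_symm_apply]
      simp [D, hγ]
    rw [h1, scaleTranslation_zero, norm_smul, RCLike.norm_ofReal, abs_of_nonneg (hc0 k),
      Real.mul_rpow (hc0 k) (norm_nonneg _), hcq]
  have hsum : ∀ k γ, HasSum (fun j => ‖A' k γ j 0‖ ^ q)
      (∑ x, ‖A' k γ (e.symm ⟨k, x⟩) 0‖ ^ q) := fun k γ =>
    hasSum_block e k fun j hj => by rw [hA'0 k γ j hj, norm_zero, Real.zero_rpow hq.ne']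
  have hmem : ∀ k γ, Memℓp (fun j => A' k γ j 0) p := fun k γ => memℓp_gen (hsum k γ).summable
  let T : ℕ → Γ → (lp (fun _ : J => E) p ≃ᵃⁱ[𝕜] lp (fun _ : J => E) p) := fun k γ =>
    lpTwist hp (σ γ) (A' k γ) (hmem k γ)
  have hT0 : ∀ k γ, ‖T k γ 0‖ ^ q = ∑ x, ‖A' k γ (e.symm ⟨k, x⟩) 0‖ ^ q := fun k γ => by
    rw [lp.norm_rpow_eq_tsum hq, ← (hsum k γ).tsum_eq]
    simp [T, hqdef]
  have hcard : ∀ k, ∑ _x : Γ ⧸ N (n k), (Fintype.card (Γ ⧸ N (n k)) : ℝ)⁻¹ = 1 := fun k => by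
    simp
  have hlower : ∀ k γ, wordLength S γ ≤ k → F.ρ₁ (wordLength S γ) ≤ ‖T k γ 0‖ := by
    intro k γ hγ
    rcases le_total (F.ρ₁ (wordLength S γ)) 0 with h0 | h0
    · exact h0.trans (norm_nonneg _)
    refine (Real.rpow_le_rpow_iff h0 (norm_nonneg _) hq).1 ?_
    rw [hT0, ← one_mul (F.ρ₁ _ ^ q), ← hcard k, Finset.sum_mul]
    refine Finset.sum_le_sum fun x _ => ?_
    rw [hA'1 k γ hγ]
    exact mul_le_mul_of_nonneg_left (Real.rpow_le_rpow h0 (hnorm k γ hγ x).1 hq.le) (by positivity)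
  have hupper : ∀ k γ, ‖T k γ 0‖ ≤ max 0 (F.ρ₂ (wordLength S γ)) := by
    intro k γ
    refine (Real.rpow_le_rpow_iff (norm_nonneg _) (le_max_left _ _) hq).1 ?_
    rw [hT0, ← one_mul (max _ _ ^ q), ← hcard k, Finset.sum_mul]
    refine Finset.sum_le_sum fun x _ => ?_
    by_cases hγ : wordLength S γ ≤ k
    · rw [hA'1 k γ hγ]
      exact mul_le_mul_of_nonneg_left (Real.rpow_le_rpow (norm_nonneg _)
        ((hnorm k γ hγ x).2.trans (le_max_right _ _)) hq.le) (by positivity)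
    · simp only [A', D, hγ, and_false, if_false, AffineIsometryEquiv.coe_refl, id, norm_zero,
        Real.zero_rpow hq.ne']
      positivity
  let U : Ultrafilter ℕ := hyperfilter ℕ
  have hU : (U : Filter ℕ) ≤ atTop := Nat.cofinite_eq_atTop ▸ hyperfilter_le_cofinite
  have hTmul : ∀ k γ γ', wordLength S γ ≤ k → wordLength S γ' ≤ k → wordLength S (γ * γ') ≤ k →
      ∀ ξ, T k (γ * γ') ξ = T k γ (T k γ' ξ) := by
    intro k γ γ' h1 h2 h3 ξ
    ext j
    simp only [T, lpTwist_apply]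
    have hσσ : σ γ' (σ γ j) = σ (γ * γ') j := by
      apply e.injective
      rw [hσ, hσ]
      simp only [hσ, QuotientGroup.mk_mul, mul_assoc]
    rw [hσσ]
    simp only [A', hσ]
    simp only [D, h1, h2, h3, and_true]
    split_ifs with hj
    · exact scaleTranslation_comp _ (fun v => by
        obtain rfl := hj
        exact hmul _ γ γ' h1 h2 h3 _ v) _
    · rfl
  have hge : ∀ m : ℕ, ∀ᶠ k in U, m ≤ k := fun m => hU (eventually_ge_atTop m)
  have hT1 : ∀ᶠ k in U, ∀ ξ, T k 1 ξ = ξ := Eventually.of_forall fun k ξ => by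
    have := hTmul k 1 1 (by simp [wordLength_one]) (by simp [wordLength_one])
      (by simp [wordLength_one]) ξ
    rw [mul_one] at this
    exact ((T k 1).injective this).symm
  have hTmul' : ∀ γ γ', ∀ᶠ k in U, ∀ ξ, T k (γ * γ') ξ = T k γ (T k γ' ξ) := fun γ γ' => by
    filter_upwards [hge (wordLength S γ), hge (wordLength S γ'), hge (wordLength S (γ * γ'))]
      with k h1 h2 h3 using hTmul k γ γ' h1 h2 h3
  let α := ultraAction U T (fun γ => ⟨_, fun k => hupper k γ⟩) hT1 hTmul'
  refine ⟨_, inferInstance, inferInstance, inferInstance,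
    hB.ultra _ U hyperfilter_le_cofinite (hB.lpSum E J hE), ⟨⟨α, ?_⟩⟩⟩
  have hα : ∀ γ, F.ρ₁ (wordLength S γ) ≤ ‖α γ 0‖ := by
    intro γ
    have h0 : (0 : Ultrapower 𝕜 U (lp (fun _ : J => E) p)) = ultraMk 𝕜 U 0 := rfl
    rw [h0, ultraAction_mk]
    refine ge_of_tendsto (tendsto_norm_ultraMk U _) ?_
    filter_upwards [hge (wordLength S γ)] with k hk using hlower k γ hk
  exact tendsto_atTop_mono hα
    (F.tendsto₁.comp (tendsto_natCast_atTop_atTop.comp tendsto_comap))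

end BoxToAction

/-! ### The equivalence -/

theorem tfae_of_hasLpSumsAndUltrapowers {𝕜 : Type} [RCLike 𝕜] {Γ : Type u} [Group Γ]
    {S : Set Γ} (hfin : S.Finite) (hS : Subgroup.closure S = ⊤)
    {N : ℕ → Subgroup Γ} [∀ n, (N n).Normal] [∀ n, (N n).FiniteIndex]
    (hN : Antitone N) (hbot : ⨅ n, N n = ⊥)
    {H : Type v} [NormedAddCommGroup H] [InnerProductSpace ℂ H]
    (L : UnitaryLinearization Γ (profiniteCompletion N hN) H)
    {d : MetricSpace (BoxSpace N)} (hd : IsBoxMetric S N d)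
    {p : ℝ≥0∞} [Fact (1 ≤ p)] (hp : p ≠ ∞) {B : BanachClass.{w} 𝕜}
    (hB : HasLpSumsAndUltrapowers p B) :
    List.TFAE [
      ActsProperlyOn S B,
      FibredCoarseEmbedsInto (WarpedCone L hS) (WarpedCone.instMetricSpace L hS) B,
      FibredCoarseEmbedsInto (BoxSpace N) d B] := by
  tfae_have 1 → 2 := fibredCoarseEmbedsInto_cone_of_actsProperlyOn L hp hfin hS hbot hB
  tfae_have 2 → 3 := fibredCoarseEmbedsInto_box_of_cone L hfin hS hbot d hd B
  tfae_have 3 → 1 := actsProperlyOn_of_box hp hN hfin hS hbot d hd hB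
  tfae_finish

theorem theorem5p3 {𝕜 : Type} [RCLike 𝕜] {Γ : Type u} [Group Γ]
    (S : Set Γ) (hfin : S.Finite) (hS : Subgroup.closure S = ⊤)
    (N : ℕ → Subgroup Γ) [∀ n, (N n).Normal] [∀ n, (N n).FiniteIndex]
    (hN : Antitone N) (hbot : ⨅ n, N n = ⊥)
    {H : Type v} [NormedAddCommGroup H] [InnerProductSpace ℂ H] [CompleteSpace H]
    (L : UnitaryLinearization Γ (profiniteCompletion N hN) H)
    (d : MetricSpace (BoxSpace N)) (hd : IsBoxMetric S N d)
    (p : ℝ≥0∞) [Fact (1 ≤ p)] (hp : p ≠ ∞) :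
    List.TFAE [
      ActsProperlyOn S (LpClass.{w} 𝕜 p),
      FibredCoarseEmbedsInto (WarpedCone L hS) (WarpedCone.instMetricSpace L hS) (LpClass.{w} 𝕜 p),
      FibredCoarseEmbedsInto (BoxSpace N) d (LpClass.{w} 𝕜 p)] ∧
    ∀ B : BanachClass.{w} 𝕜, IsStableClass p B →
      List.TFAE [
        ActsProperlyOn S B,
        FibredCoarseEmbedsInto (WarpedCone L hS) (WarpedCone.instMetricSpace L hS) B,
        FibredCoarseEmbedsInto (BoxSpace N) d B] :=
  ⟨tfae_of_hasLpSumsAndUltrapowers hfin hS hN hbot L hd hp (LpClass.hasLpSumsAndUltrapowers hp),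
    fun _ hB => tfae_of_hasLpSumsAndUltrapowers hfin hS hN hbot L hd hp
      (hB.hasLpSumsAndUltrapowers hp)⟩
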